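/- Let $d\ge 1$ be an odd integer, $\ell=\sqrt{2\pi/d}$, $\mathcal H=L^2(\mathbb R)$, and for $x,p\in\mathbb R$ let $\hat D(x,p)=e^{ixp/2}e^{-ix\hat p}e^{ip\hat x}$, i.e. $(\hat D(x,p)\psi)(y)=e^{ipy-ixp/2}\psi(y-x)$. Let $\mathbb T_{d\ell}^2=[0,d\ell)^2$ carry the measure $\frac1d\,du\,dv$. As generalised operators (sesquilinear forms on the Schwartz space) put $$\hat\Delta(u,v)=\hat D(u,v)\Big[\tfrac1{2\pi}\sum_{m,n\in\mathbb Z}(-1)^{mn}\hat D(n\ell,m\ell)\Big]\hat D(u,v)^\dagger .$$ For a trace-class operator $\hat A$ on $\mathcal H$, its Zak–Gross Wigner function $W_{\hat A}\in L^1(\mathbb T^2_{d\ell})$ is $W_{\hat A}(u,v)=\mathrm{Tr}[\hat\Delta(u,v)\hat A]$, the series being summed (over the squares $|m|,|n|\le N$, $N\to\infty$) in the sense of distributions on the torus; this limit exists and is an integrable function. Let $|\bar j\rangle=\ell^{-1/2}\sum_{n\in\mathbb Z}|j\ell+d\ell n\rangle_{\hat x}$, $0\le j<d$ (Dirac combs),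 and let $\hat P_{(s,t)}=\sum_{j=0}^{d-1}\hat D(s,t)|\bar j\rangle\langle\bar j|\hat D(s,t)^\dagger$ for $(s,t)\in[0,\ell)^2$. For trace-class $\hat A$ let $\hat A(s,t)$ be the $d\times d$ matrix $\big(\langle\bar j|\hat D(s,t)^\dagger\hat A\hat D(s,t)|\bar k\rangle\big)_{jk}$, which is defined for almost every $(s,t)$: if $\hat A=\sum_i|\phi_i\rangle\langle\psi_i|$ with $\sum_i\|\phi_i\|\|\psi_i\|<\infty$, it is $\sum_i\langle\bar j|\hat D(s,t)^\dagger\phi_i\rangle\,\overline{\langle\bar k|\hat D(s,t)^\dagger\psi_i\rangle}$, almost everywhere independently of the decomposition. The twirl $\mathcal E(\hat A)=\int_{[0,\ell)^2}\hat P_{(s,t)}\hat A\hat P_{(s,t)}\,ds\,dt$ is the generalised operator whose matrix elements between Schwartz functions are the integrals of those of $\hat P_{(s,t)}\hat A\hat P_{(s,t)}$ (which are integrable). Products of twirls live on the continuous family of displaced code spaces, and their trace is the integral of the traces over the individual code spaces: $$\mathrm{Tr}[\mathcal E(\hat A)\mathcal E(\hat B)]:=\int_{[0,\ell)^2}\mathrm{tr}\big(\hat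 A(s,t)\hat B(s,t)\big)\,ds\,dt .$$ Then, for all trace-class operators $\hat A,\hat B$: 1. (Linearity) $\hat A\mapsto W_{\hat A}$ is linear, and $W_{\hat A}=W_{\hat B}$ if and only if $\mathcal E(\hat A)=\mathcal E(\hat B)$. 2. (Reality) $W_{\hat A^\dagger}=\overline{W_{\hat A}}$ almost everywhere. 3. (Standardisation) $\int_{\mathbb T_{d\ell}^2}\frac1d\,du\,dv\,W_{\hat A}(u,v)=\mathrm{Tr}[\hat A]$. 4. (Covariance) For all $\varphi,x,p\in\mathbb R$, with $\pi(g)=e^{i\varphi}e^{-ix\hat p}e^{ip\hat x}$, one has $W_{\pi(g)^\dagger\hat A\pi(g)}(u,v)=W_{\hat A}(u+x \bmod d\ell,\;v+p\bmod d\ell)$ for almost every $(u,v)\in\mathbb T^2_{d\ell}$. 5. (Traciality) If $W_{\hat A}W_{\hat B}$ is integrable, then $\mathrm{tr}(\hat A(s,t)\hat B(s,t))$ is integrable on $[0,\ell)^2$ and $\int_{\mathbb T_{d\ell}^2}\frac1d\,du\,dv\,W_{\hat A}W_{\hat B}=\mathrm{Tr}[\mathcal E(\hat A)\mathcal E(\hat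 B)]$; this also equals $\mathrm{Tr}[\mathcal E(\hat A)\hat B]$, respectively $\mathrm{Tr}[\hat A\mathcal E(\hat B)]$ (ordinary operator traces), whenever the operator $\mathcal E(\hat A)\hat B$, respectively $\hat A\mathcal E(\hat B)$, is trace class. If $W_{\hat A}$ is essentially bounded, then $W_{\hat A}W_{\hat B}$ is integrable and $\mathcal E(\hat A)\hat B$ and $\hat B\mathcal E(\hat A)$ are trace class, for every trace-class $\hat B$. 6. (Reconstruction) $\mathcal E(\hat A)=\int_{\mathbb T^2_{d\ell}}\frac1d\,du\,dv\,W_{\hat A}(u,v)\,\hat\Delta(u,v)$, as an equality of matrix elements between Schwartz functions: the series for $\langle f|\hat\Delta(u,v)|g\rangle$ converges absolutely and $W_{\hat A}(u,v)\langle f|\hat\Delta(u,v)|g\rangle$ is integrable. -/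

import Mathlib

open MeasureTheory Filter Topology
open scoped SchwartzMap InnerProduct ENNReal ComplexConjugate

noncomputable section

namespace ZakGross

/-! ### The oscillator Hilbert space and trace-class operators -/

/-- The Hilbert space `L²(ℝ)` of a single bosonic mode. -/
abbrev Hilb : Type := Lp ℂ 2 (volume : Measure ℝ)

/-- `A = ∑ i, |φ i⟩⟨ψ i|` with `∑ i, ‖φ i‖ ‖ψ i‖ < ∞`. -/
def IsNuclearRep (A : Hilb →L[ℂ] Hilb) (φ ψ : ℕ → Hilb) : Prop :=
  Summable (fun i => ‖φ i‖ * ‖ψ i‖) ∧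
    ∀ x : Hilb, HasSum (fun i => (inner ℂ (ψ i) x : ℂ) • φ i) (A x)

/-- Trace-class (nuclear) operators on `L²(ℝ)`. -/
def IsTraceClass (A : Hilb →L[ℂ] Hilb) : Prop :=
  ∃ φ ψ : ℕ → Hilb, IsNuclearRep A φ ψ

/-- The index set of a fixed Hilbert basis of `L²(ℝ)`. -/
def basisIndex : Set Hilb := (exists_hilbertBasis ℂ Hilb).choose

/-- A fixed Hilbert basis of `L²(ℝ)`. -/
def basis : HilbertBasis basisIndex ℂ Hilb := (exists_hilbertBasis ℂ Hilb).choose_spec.choose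

/-- The trace `∑ᵢ ⟨bᵢ, A bᵢ⟩` of a trace-class operator. -/
def trace (A : Hilb →L[ℂ] Hilb) : ℂ := ∑' i, (inner ℂ (basis i) (A (basis i)) : ℂ)

/-- A Schwartz function as a vector of `L²(ℝ)`. -/
def vec (f : 𝓢(ℝ, ℂ)) : Hilb := f.toLp 2 volume

/-! ### Displacement operators -/

/-- `e^{-i x p̂}`, i.e. `ψ ↦ ψ(· - x)`. -/
def shift (x : ℝ) : Hilb →L[ℂ] Hilb :=
  (Lp.compMeasurePreservingₗᵢ ℂ (fun y : ℝ => y - x)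
    (measurePreserving_sub_right volume x)).toContinuousLinearMap

lemma norm_modulation (p y : ℝ) : ‖Complex.exp (Complex.I * p * y)‖ = 1 := by
  have : Complex.I * p * y = ((p * y : ℝ) : ℂ) * Complex.I := by push_cast; ring
  rw [this, Complex.norm_exp_ofReal_mul_I]

lemma memLp_modulation (p : ℝ) (f : Hilb) :
    MemLp (fun y : ℝ => Complex.exp (Complex.I * p * y) * f y) 2 volume := by
  refine (memLp_congr_norm (Lp.memLp f).1 ?_ ?_).1 (Lp.memLp f)
  · exact (Continuous.aestronglyMeasurable (by fun_prop)).mul (Lp.memLp f).1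
  · filter_upwards with y
    rw [norm_mul, norm_modulation, one_mul]

/-- `e^{i p x̂}`, i.e. multiplication by `y ↦ e^{i p y}`. -/
def modulate (p : ℝ) : Hilb →L[ℂ] Hilb :=
  LinearMap.mkContinuous
    { toFun := fun f => (memLp_modulation p f).toLp _
      map_add' := fun f g => by
        rw [← MemLp.toLp_add]
        refine MemLp.toLp_congr _ _ ?_
        filter_upwards [Lp.coeFn_add f g] with y hy
        simp only [Pi.add_apply, hy, mul_add]
      map_smul' := fun c f => by
        rw [RingHom.id_apply, ← MemLp.toLp_const_smul]
        refine MemLp.toLp_congr _ _ ?_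
        filter_upwards [Lp.coeFn_smul c f] with y hy
        simp only [Pi.smul_apply, hy, smul_eq_mul]
        ring } 1
    (fun f => by
      rw [one_mul]
      change ‖(memLp_modulation p f).toLp _‖ ≤ ‖f‖
      rw [Lp.norm_toLp, Lp.norm_def]
      refine le_of_eq (congrArg _ (eLpNorm_congr_norm_ae ?_))
      filter_upwards with y
      rw [norm_mul, norm_modulation, one_mul])

/-- The displacement operator
`D(x, p) = e^{i x p / 2} e^{-i x p̂} e^{i p x̂} = e^{i (p x̂ - x p̂)}`. -/
def disp (x p : ℝ) : Hilb →L[ℂ] Hilb :=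
  Complex.exp (Complex.I * x * p / 2) • (shift x ∘L modulate p)

/-- The representation `π(g) = e^{iφ} e^{-i x p̂} e^{i p x̂}` of `g = g(φ, x, p)` in the
Heisenberg–Weyl group. -/
def heisenberg (φ x p : ℝ) : Hilb →L[ℂ] Hilb :=
  Complex.exp (Complex.I * φ) • (shift x ∘L modulate p)

/-! ### The toroidal phase space -/

/-- The logical step size `ℓ = √(2π/d)`. -/
def step (d : ℕ) : ℝ := Real.sqrt (2 * Real.pi / d)

/-- Lebesgue measure on the cell `[0, L) × [0, L)`. -/
def cellMeasure (L : ℝ) : Measure (ℝ × ℝ) :=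
  (volume.restrict (Set.Ico 0 L)).prod (volume.restrict (Set.Ico 0 L))

/-- The invariant measure `(1/d) du dv` on `[0, dℓ) × [0, dℓ)`. -/
def torusMeasure (d : ℕ) : Measure (ℝ × ℝ) := (d : ℝ≥0∞)⁻¹ • cellMeasure (d * step d)

/-- The representative of `r` modulo `L` in `[0, L)`. -/
def modL (L r : ℝ) : ℝ := L * Int.fract (r / L)

/-- The action `g(φ, x, p) · (u, v) = (u + x mod dℓ, v + p mod dℓ)`. -/
def act (d : ℕ) (x p : ℝ) (z : ℝ × ℝ) : ℝ × ℝ :=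
  (modL (d * step d) (z.1 + x), modL (d * step d) (z.2 + p))

/-- Smooth test functions on the torus: smooth on the plane and `dℓ`-periodic in both variables. -/
def IsTorusTest (d : ℕ) (h : ℝ × ℝ → ℂ) : Prop :=
  ContDiff ℝ (⊤ : ℕ∞) h ∧
    ∀ z : ℝ × ℝ, h (z.1 + d * step d, z.2) = h z ∧ h (z.1, z.2 + d * step d) = h z

/-! ### The kernel and the Wigner function -/

/-- The term `(1/2π) (-1)^{mn} D(nℓ, mℓ)` of the undisplaced kernel `Δ(0, 0)`. -/
def kernelTerm (d : ℕ) (m n : ℤ) : Hilb →L[ℂ] Hilb :=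
  ((1 / (2 * Real.pi) : ℂ) * (-1 : ℂ) ^ (m * n)) • disp (n * step d) (m * step d)

/-- The generalised operator `Δ(u, v) = D(u, v) Δ(0, 0) D(u, v)†`, with
`Δ(0, 0) = (1/2π) ∑_{m,n} (-1)^{mn} D(nℓ, mℓ)`, through its matrix elements
`⟨f|Δ(u, v)|g⟩` between Schwartz functions. -/
def kernel (d : ℕ) (z : ℝ × ℝ) (f g : 𝓢(ℝ, ℂ)) : ℂ :=
  ∑' mn : ℤ × ℤ,
    (inner ℂ (((disp z.1 z.2)†) (vec f))
      (kernelTerm d mn.1 mn.2 (((disp z.1 z.2)†) (vec g))) : ℂ)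

/-- The partial sums over `|m|, |n| ≤ N` of the kernel `Δ(u, v)`; these are bounded operators. -/
def kernelPartial (d N : ℕ) (z : ℝ × ℝ) : Hilb →L[ℂ] Hilb :=
  disp z.1 z.2 ∘L
    (∑ m ∈ Finset.Icc (-(N : ℤ)) N, ∑ n ∈ Finset.Icc (-(N : ℤ)) N, kernelTerm d m n) ∘L
      (disp z.1 z.2)†

/-- `W(u, v) = Tr[Δ(u, v) A]`, the series in `Δ` being summed in the sense of distributions on the
torus. -/
def IsWigner (d : ℕ) (A : Hilb →L[ℂ] Hilb) (W : Lp ℂ 1 (torusMeasure d)) : Prop :=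
  ∀ h : ℝ × ℝ → ℂ, IsTorusTest d h →
    Tendsto (fun N : ℕ => ∫ z, trace (kernelPartial d N z ∘L A) * h z ∂(torusMeasure d)) atTop
      (𝓝 (∫ z, W z * h z ∂(torusMeasure d)))

open Classical in
/-- The Zak–Gross Wigner function `W_A` of a trace-class operator `A`, an integrable function on the
torus. -/
def wigner (d : ℕ) (A : Hilb →L[ℂ] Hilb) : Lp ℂ 1 (torusMeasure d) :=
  if h : ∃ W : Lp ℂ 1 (torusMeasure d), IsWigner d A W then h.choose else 0

/-! ### Displaced code spaces and the twirl -/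

/-- The value of `D(s, t)† φ` at the point `y`. -/
def dispAdjAt (φ : ℝ → ℂ) (s t y : ℝ) : ℂ :=
  Complex.exp (-(Complex.I * (t * y + s * t / 2))) * φ (y + s)

lemma memLp_dispAdjAt (φ : Hilb) (L y : ℝ) :
    MemLp (fun z : ℝ × ℝ => dispAdjAt φ z.1 z.2 y) 2 (cellMeasure L) := by
  have h1 : MemLp (fun s : ℝ => φ (y + s)) 2 (volume.restrict (Set.Ico 0 L)) :=
    ((Lp.memLp φ).comp_measurePreserving (measurePreserving_add_left volume y)).restrict _
  have h2 : MemLp (fun z : ℝ × ℝ => φ (y + z.1)) 2 (cellMeasure L) :=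
    h1.comp_fst (volume.restrict (Set.Ico 0 L))
  refine (memLp_congr_norm h2.1 ?_ ?_).1 h2
  · exact (Continuous.aestronglyMeasurable (by fun_prop)).mul h2.1
  · filter_upwards with z
    have : -(Complex.I * ((z.2 : ℂ) * y + z.1 * z.2 / 2)) =
        ((-(z.2 * y + z.1 * z.2 / 2) : ℝ) : ℂ) * Complex.I := by push_cast; ring
    simp only [dispAdjAt]
    rw [norm_mul, this, Complex.norm_exp_ofReal_mul_I, one_mul]

/-- The overlaps `⟨j̄|D(s, t)†|φ⟩` of `φ` with the displaced codewords `D(s, t)|j̄⟩`, where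
`|j̄⟩ = ℓ^{-1/2} ∑_n |jℓ + dℓn⟩` is a Dirac comb; an element of `L²([0, ℓ)²)`, the sum over `n`
being an orthogonal series there. -/
def overlap (d : ℕ) (j : Fin d) (φ : Hilb) : Lp ℂ 2 (cellMeasure (step d)) :=
  ((1 / Real.sqrt (step d) : ℝ) : ℂ) • ∑' n : ℤ,
    (memLp_dispAdjAt φ (step d) ((j : ℕ) * step d + d * step d * n)).toLp _

open Classical in
/-- The matrix `⟨j̄|D(s, t)† A D(s, t)|k̄⟩` of `P_{(s,t)} A P_{(s,t)}` in the codewords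
`D(s, t)|j̄⟩`, where `P_{(s,t)} = ∑_j D(s, t)|j̄⟩⟨j̄|D(s, t)†` is the projector onto a displaced
code space. -/
def codeMatrix (d : ℕ) (A : Hilb →L[ℂ] Hilb) (z : ℝ × ℝ) : Matrix (Fin d) (Fin d) ℂ :=
  if h : IsTraceClass A then
    Matrix.of fun j k =>
      ∑' i : ℕ, overlap d j (h.choose i) z * conj (overlap d k (h.choose_spec.choose i) z)
  else 0

/-- The matrix element `⟨f|P_{(s,t)} A P_{(s,t)}|g⟩` at `z = (s, t)`. -/
def codePairing (d : ℕ) (A : Hilb →L[ℂ] Hilb) (f g : Hilb) (z : ℝ × ℝ) : ℂ :=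
  ∑ j : Fin d, ∑ k : Fin d, conj (overlap d j f z) * codeMatrix d A z j k * overlap d k g z

/-- The twirl `E(A) = ∫_{[0,ℓ)²} P_{(s,t)} A P_{(s,t)} ds dt`, a generalised operator given by its
matrix elements `⟨f|E(A)|g⟩` between Schwartz functions. -/
def twirl (d : ℕ) (A : Hilb →L[ℂ] Hilb) (f g : 𝓢(ℝ, ℂ)) : ℂ :=
  ∫ z, codePairing d A (vec f) (vec g) z ∂(cellMeasure (step d))

/-- The trace of `P_{(s,t)} A P_{(s,t)} B P_{(s,t)}` over the displaced code space at `(s, t)`. -/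
def codeTrace (d : ℕ) (A B : Hilb →L[ℂ] Hilb) (z : ℝ × ℝ) : ℂ :=
  (codeMatrix d A z * codeMatrix d B z).trace

/-- The trace `Tr[E(A) E(B)]` over the continuous family of displaced code spaces: the integral over
`[0, ℓ)²` of the traces over the individual code spaces. -/
def twirlTrace (d : ℕ) (A B : Hilb →L[ℂ] Hilb) : ℂ :=
  ∫ z, codeTrace d A B z ∂(cellMeasure (step d))

/-- The product `E(A) B` is the bounded operator `C`. -/
def IsTwirlMul (d : ℕ) (A B C : Hilb →L[ℂ] Hilb) : Prop :=
  ∀ (f : 𝓢(ℝ, ℂ)) (g : Hilb),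
    Integrable (codePairing d A (vec f) (B g)) (cellMeasure (step d)) ∧
      ∫ z, codePairing d A (vec f) (B g) z ∂(cellMeasure (step d)) = inner ℂ (vec f) (C g)

/-- The product `A E(B)` is the bounded operator `C`. -/
def IsMulTwirl (d : ℕ) (A B C : Hilb →L[ℂ] Hilb) : Prop :=
  ∀ (f : Hilb) (g : 𝓢(ℝ, ℂ)),
    Integrable (codePairing d B ((A†) f) (vec g)) (cellMeasure (step d)) ∧
      ∫ z, codePairing d B ((A†) f) (vec g) z ∂(cellMeasure (step d)) = inner ℂ f (C (vec g))

end ZakGross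

end

/-!
Everything is reduced to matrices over the displaced code spaces. The overlaps of a vector with the
displaced codewords map `L²(ℝ)` isometrically to `d` copies of `L²([0, ℓ)²)` (a Zak transform,
`sum_inner_ov`), where `D(nℓ, mℓ)` acts by a phase depending on the point and a shift
of the codeword label (`ov_disp`). A trace-class operator `A` thus has an integrable code matrix
`cm d A`, and the trace of `A` times any operator built from bounded multipliers is the integral of
the corresponding finite-dimensional trace (`trace_entryOp`).

The Wigner function is determined by its Fourier coefficients, which are the signed traces
`(-1)^{mn} Tr[D(nℓ, mℓ) A]`. Computing these from the code matrix gives an explicit solution: cut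
the torus `[0, dℓ)²` into `d²` tiles congruent to `[0, ℓ)²`; on the tile with label `(a, b)` the
Wigner function is the discrete Wigner function of the code matrix at the phase point `(a, b)` of
`(ℤ/d)²` (`wigner_add_corner`). For odd `d` the sign `(-1)^{mn}` is just what makes the phases of
`D(nℓ, mℓ)` characters of `ℤ/d` (`neg_one_zpow_mul_exp`), and the discrete Wigner transform is
invertible and satisfies Parseval's identity, since `2` is invertible in `ℤ/d`.

Linearity, reality, standardisation and covariance are read off from the Fourier coefficients.
Parseval's identity, integrated over the cell, gives traciality in the form
`∫ W_A W_B = Tr[E(A) E(B)]`. The kernel `⟨f|Δ(u, v)|g⟩` is the Wigner function of `|g⟩⟨f|`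
(`wigner_ketbra`), a bounded one because the ambiguity function of two Schwartz functions is
summable over the lattice; reconstruction is therefore traciality for the pair `A`, `|g⟩⟨f|`.

The twirl determines the code matrix, hence the Wigner function: bumps supported in `(0, ℓ)`,
displaced by lattice vectors, have overlaps with one codeword only, and their overlaps with it run
through all characters of the cell (`ae_eq_zero_of_schwartz`). By the same separation argument, an
operator `C = E(A) B` acts on almost every displaced code space by the product of the code matrix of
`A` with `B` (`IsTwirlMul.ov_eq`). Truncating to the set on which the code matrix of `A` is bounded
turns this into an identity of trace-class operators, and letting the bound tend to infinity gives
`Tr C = Tr[E(A) E(B)]`. A bounded Wigner function has a bounded code matrix, which is a bounded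
operator on `L²(ℝ)`.
-/

open MeasureTheory Filter Topology
open scoped SchwartzMap InnerProduct ENNReal ComplexConjugate

noncomputable section

namespace ZakGross

/-! ### Fourier series of integrable functions on the torus -/

/-- The character `t ↦ exp (2π i n t / L)` of `ℝ / Lℤ`. -/
def chr (L : ℝ) (n : ℤ) (t : ℝ) : ℂ := Complex.exp (2 * Real.pi * Complex.I * n * t / L)

/-- The character `(u, v) ↦ exp (2π i (m u + n v) / L)` of `(ℝ / Lℤ)²`. -/
def chr₂ (L : ℝ) (m n : ℤ) (z : ℝ × ℝ) : ℂ := chr L m z.1 * chr L n z.2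

lemma chr_eq (L : ℝ) (n : ℤ) (t : ℝ) :
    chr L n t = Complex.exp ((2 * Real.pi * n * t / L : ℝ) * Complex.I) := by
  rw [chr]; congr 1; push_cast; ring

lemma norm_chr (L : ℝ) (n : ℤ) (t : ℝ) : ‖chr L n t‖ = 1 := by
  rw [chr_eq, Complex.norm_exp_ofReal_mul_I]

lemma norm_chr₂ (L : ℝ) (m n : ℤ) (z : ℝ × ℝ) : ‖chr₂ L m n z‖ = 1 := by
  rw [chr₂, norm_mul, norm_chr, norm_chr, one_mul]

@[fun_prop]
lemma continuous_chr (L : ℝ) (n : ℤ) : Continuous (chr L n) := by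
  unfold chr; fun_prop

@[fun_prop]
lemma continuous_chr₂ (L : ℝ) (m n : ℤ) : Continuous (chr₂ L m n) := by
  unfold chr₂; fun_prop

lemma chr_zero (L t : ℝ) : chr L 0 t = 1 := by simp [chr]

lemma chr₂_zero (L : ℝ) (z : ℝ × ℝ) : chr₂ L 0 0 z = 1 := by simp [chr₂, chr_zero]

lemma chr_add (L : ℝ) (m n : ℤ) (t : ℝ) : chr L (m + n) t = chr L m t * chr L n t := by
  rw [chr, chr, chr, ← Complex.exp_add]; congr 1; push_cast; ring

lemma chr_add_right (L : ℝ) (n : ℤ) (s t : ℝ) : chr L n (s + t) = chr L n s * chr L n t := by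
  rw [chr, chr, chr, ← Complex.exp_add]; congr 1; push_cast; ring

lemma conj_chr (L : ℝ) (n : ℤ) (t : ℝ) : conj (chr L n t) = chr L (-n) t := by
  rw [chr_eq, chr_eq, ← Complex.exp_conj]
  congr 1
  simp only [map_mul, Complex.conj_ofReal, Complex.conj_I]
  push_cast
  ring

lemma conj_chr₂ (L : ℝ) (m n : ℤ) (z : ℝ × ℝ) : conj (chr₂ L m n z) = chr₂ L (-m) (-n) z := by
  rw [chr₂, map_mul, conj_chr, conj_chr, chr₂]

lemma chr₂_mul (L : ℝ) (m n m' n' : ℤ) (z : ℝ × ℝ) :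
    chr₂ L m n z * chr₂ L m' n' z = chr₂ L (m + m') (n + n') z := by
  simp only [chr₂, chr_add]; ring

lemma chr_self (L : ℝ) (hL : L ≠ 0) (n : ℤ) : chr L n L = 1 := by
  rw [chr, ← Complex.exp_int_mul_two_pi_mul_I n]
  congr 1
  have : (L : ℂ) ≠ 0 := by exact_mod_cast hL
  field_simp

lemma chr_period (L : ℝ) (hL : L ≠ 0) (n : ℤ) (t : ℝ) : chr L n (t + L) = chr L n t := by
  rw [chr_add_right, chr_self L hL, mul_one]

/-- An integrable function on a circle all of whose Fourier coefficients vanish is zero: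
trigonometric polynomials are uniformly dense in the continuous functions. -/
lemma ae_eq_zero_of_fourier (L : ℝ) (hL : 0 < L) (f : ℝ → ℂ)
    (hf : IntegrableOn f (Set.Ico 0 L)) (h : ∀ n : ℤ, ∫ t in Set.Ico 0 L, f t * chr L n t = 0) :
    ∀ᵐ t ∂(volume.restrict (Set.Ico 0 L)), f t = 0 := by
  have : Fact (0 < L) := ⟨hL⟩
  have hcont : ∀ g : C(AddCircle L, ℂ), Continuous fun t : ℝ => g (t : AddCircle L) :=
    fun g => g.continuous.comp (AddCircle.continuous_mk' L)
  have hint : ∀ g : C(AddCircle L, ℂ), IntegrableOn (fun t => f t * g (t : AddCircle L))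
      (Set.Ico 0 L) := fun g =>
    hf.mul_bdd (c := ‖g‖) (hcont g).aestronglyMeasurable
      (Eventually.of_forall fun t => g.norm_coe_le_norm _)
  let Φ : C(AddCircle L, ℂ) →L[ℂ] ℂ := LinearMap.mkContinuous
    { toFun := fun g => ∫ t in Set.Ico 0 L, f t * g (t : AddCircle L)
      map_add' := fun g g' => by
        rw [← integral_add (hint g) (hint g')]
        simp only [ContinuousMap.add_apply, mul_add]
      map_smul' := fun c g => by
        rw [RingHom.id_apply, smul_eq_mul, ← integral_const_mul]
        congr 1 with t
        simp only [ContinuousMap.smul_apply, smul_eq_mul]; ring }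
    (∫ t in Set.Ico 0 L, ‖f t‖) (fun g => by
      refine (norm_integral_le_integral_norm _).trans ?_
      rw [← integral_mul_const]
      refine integral_mono (hint g).norm (hf.norm.mul_const _) fun t => ?_
      rw [norm_mul]
      exact mul_le_mul_of_nonneg_left (g.norm_coe_le_norm _) (norm_nonneg _))
  have hΦ : ∀ g, Φ g = 0 := by
    have h1 : (Submodule.span ℂ (Set.range (@fourier L))) ≤
        LinearMap.ker (Φ : C(AddCircle L, ℂ) →ₗ[ℂ] ℂ) := by
      rw [Submodule.span_le]
      rintro _ ⟨n, rfl⟩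
      change ∫ t in Set.Ico 0 L, f t * fourier n (t : AddCircle L) = 0
      rw [← h n]
      congr 1 with t
      rw [fourier_coe_apply, chr]
    have h2 := Submodule.topologicalClosure_minimal _ h1 Φ.isClosed_ker
    rw [span_fourier_closure_eq_top] at h2
    exact fun g => h2 (Submodule.mem_top (x := g))
  have key : ∀ᵐ t, t ∈ Set.Ioo 0 L → f t = 0 := by
    refine isOpen_Ioo.ae_eq_zero_of_integral_contDiff_smul_eq_zero
      ((hf.mono_set Set.Ioo_subset_Ico_self).locallyIntegrableOn) fun g hg hgc hgs => ?_
    have hz : ∀ t, t ∉ Set.Ioo 0 L → g t = 0 := fun t ht =>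
      image_eq_zero_of_notMem_tsupport fun h' => ht (hgs h')
    let G : C(AddCircle L, ℂ) := ⟨AddCircle.liftIco L 0 (fun t => (g t : ℂ)),
      AddCircle.liftIco_zero_continuous (by
        rw [hz 0 (by simp), hz L (by simp)]) (by
        exact (Complex.continuous_ofReal.comp hg.continuous).continuousOn)⟩
    have h3 := hΦ G
    change ∫ t in Set.Ico 0 L, f t * G (t : AddCircle L) = 0 at h3
    rw [← h3, ← setIntegral_eq_integral_of_forall_compl_eq_zero (s := Set.Ico 0 L)]
    · refine setIntegral_congr_fun measurableSet_Ico fun t ht => ?_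
      have : G (t : AddCircle L) = g t :=
        AddCircle.liftIco_zero_coe_apply (f := fun t => (g t : ℂ)) ht
      simp only [this, Complex.real_smul]; ring
    · intro t ht
      rw [hz t fun h' => ht (Set.Ioo_subset_Ico_self h'), zero_smul]
  rw [← Measure.restrict_congr_set Ioo_ae_eq_Ico, ae_restrict_iff' measurableSet_Ioo]
  exact key

instance (L : ℝ) : IsFiniteMeasure (cellMeasure L) := by unfold cellMeasure; infer_instance

/-- The two-dimensional version of `ae_eq_zero_of_fourier`, by slicing. -/
lemma ae_eq_zero_of_fourier₂ (L : ℝ) (hL : 0 < L) (f : ℝ × ℝ → ℂ)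
    (hf : Integrable f (cellMeasure L))
    (h : ∀ m n : ℤ, ∫ z, f z * chr₂ L m n z ∂(cellMeasure L) = 0) :
    ∀ᵐ z ∂(cellMeasure L), f z = 0 := by
  unfold cellMeasure at *
  set μ := (volume : Measure ℝ).restrict (Set.Ico 0 L)
  have hfn : ∀ m n : ℤ, Integrable (fun z => f z * chr₂ L m n z) (μ.prod μ) := fun m n =>
    hf.mul_bdd (c := 1) (continuous_chr₂ L m n).aestronglyMeasurable
      (Eventually.of_forall fun z => (norm_chr₂ L m n z).le)
  have h1 : ∀ n : ℤ, ∀ᵐ s ∂μ, ∫ t, f (s, t) * chr L n t ∂μ = 0 := by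
    intro n
    have hi : Integrable (fun s => ∫ t, f (s, t) * chr L n t ∂μ) μ := by
      refine (hfn 0 n).integral_prod_left.congr (Eventually.of_forall fun s => ?_)
      simp [chr₂, chr_zero]
    refine ae_eq_zero_of_fourier L hL _ hi fun m => ?_
    rw [← h m n, integral_prod _ (hfn m n)]
    congr 1 with s
    rw [← integral_mul_const]
    congr 1 with t
    simp only [chr₂]; ring
  rw [← ae_all_iff] at h1
  have h2 : ∀ᵐ s ∂μ, ∀ᵐ t ∂μ, f (s, t) = 0 := by
    filter_upwards [h1, hf.prod_right_ae] with s hs hs'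
    exact ae_eq_zero_of_fourier L hL _ hs' hs
  have h4 : (∫⁻ z, ‖f z‖ₑ ∂(μ.prod μ)) = 0 := by
    rw [lintegral_prod _ hf.1.enorm]
    rw [lintegral_eq_zero_iff' (hf.1.enorm.lintegral_prod_right')]
    filter_upwards [h2] with s hs
    simp only [Pi.zero_apply]
    rw [lintegral_congr_ae (g := fun _ => 0)]
    · simp
    · filter_upwards [hs] with t ht
      simp [ht]
  rw [lintegral_eq_zero_iff' hf.1.enorm] at h4
  filter_upwards [h4] with z hz
  simpa using hz

lemma ae_eq_of_fourier₂ (L : ℝ) (hL : 0 < L) {f g : ℝ × ℝ → ℂ}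
    (hf : Integrable f (cellMeasure L)) (hg : Integrable g (cellMeasure L))
    (h : ∀ m n : ℤ, ∫ z, f z * chr₂ L m n z ∂(cellMeasure L) =
      ∫ z, g z * chr₂ L m n z ∂(cellMeasure L)) :
    f =ᵐ[cellMeasure L] g := by
  have hb : ∀ {f : ℝ × ℝ → ℂ} (_ : Integrable f (cellMeasure L)) (m n : ℤ),
      Integrable (fun z => f z * chr₂ L m n z) (cellMeasure L) := fun hf m n =>
    hf.mul_bdd (c := 1) (continuous_chr₂ L m n).aestronglyMeasurable
      (Eventually.of_forall fun z => (norm_chr₂ L m n z).le)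
  have := ae_eq_zero_of_fourier₂ L hL (fun z => f z - g z) (hf.sub hg) fun m n => by
    simp only [sub_mul]
    rw [integral_sub (hb hf m n) (hb hg m n), h, sub_self]
  filter_upwards [this] with z hz
  exact sub_eq_zero.1 hz

/-- Orthogonality of the characters of the circle. -/
lemma integral_chr (L : ℝ) (hL : 0 < L) (n : ℤ) :
    ∫ t in Set.Ico 0 L, chr L n t = if n = 0 then (L : ℂ) else 0 := by
  rw [restrict_Ico_eq_restrict_Ioc, ← intervalIntegral.integral_of_le hL.le]
  split_ifs with h
  · subst h; simp [chr_zero]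
  · have hne : (L : ℂ) ≠ 0 := by exact_mod_cast hL.ne'
    have hn : (n : ℂ) ≠ 0 := by exact_mod_cast h
    have hc : (2 * Real.pi * Complex.I * n / L : ℂ) ≠ 0 := by
      simp [hne, hn, Real.pi_ne_zero]
    have : ∀ t : ℝ, chr L n t = Complex.exp ((2 * Real.pi * Complex.I * n / L) * t) := fun t => by
      rw [chr]; congr 1; ring
    simp only [this]
    rw [integral_exp_mul_complex hc]
    have h1 := this L
    rw [chr_self L hL.ne'] at h1
    rw [← h1]; simp

lemma integral_chr₂ (L : ℝ) (hL : 0 < L) (m n : ℤ) :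
    ∫ z, chr₂ L m n z ∂(cellMeasure L) = if m = 0 ∧ n = 0 then (L ^ 2 : ℂ) else 0 := by
  unfold cellMeasure chr₂
  rw [integral_prod_mul (chr L m) (chr L n), integral_chr L hL, integral_chr L hL]
  split_ifs <;> simp_all [sq]

/-- The sum of an absolutely convergent Fourier series on the torus. -/
def fourierSum (L : ℝ) (c : ℤ × ℤ → ℂ) (z : ℝ × ℝ) : ℂ := ∑' k : ℤ × ℤ, c k * chr₂ L k.1 k.2 z

lemma summable_mul_chr₂ (L : ℝ) {c : ℤ × ℤ → ℂ} (hc : Summable c) (z : ℝ × ℝ) :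
    Summable fun k : ℤ × ℤ => c k * chr₂ L k.1 k.2 z := by
  refine Summable.of_norm ?_
  simpa only [norm_mul, norm_chr₂, mul_one] using hc.norm

lemma continuous_fourierSum (L : ℝ) {c : ℤ × ℤ → ℂ} (hc : Summable c) :
    Continuous (fourierSum L c) :=
  continuous_tsum (fun k => by fun_prop) hc.norm fun k z => by rw [norm_mul, norm_chr₂, mul_one]

lemma norm_fourierSum_le (L : ℝ) {c : ℤ × ℤ → ℂ} (hc : Summable c) (z : ℝ × ℝ) :
    ‖fourierSum L c z‖ ≤ ∑' k, ‖c k‖ :=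
  tsum_of_norm_bounded hc.norm.hasSum fun k => by rw [norm_mul, norm_chr₂, mul_one]

/-- An integrable function may be integrated term by term against an absolutely convergent
Fourier series. -/
lemma hasSum_integral_mul_fourierSum (L : ℝ) {c : ℤ × ℤ → ℂ} (hc : Summable c)
    {f : ℝ × ℝ → ℂ} {μ : Measure (ℝ × ℝ)} (hf : Integrable f μ) :
    HasSum (fun k : ℤ × ℤ => c k * ∫ z, f z * chr₂ L k.1 k.2 z ∂μ)
      (∫ z, f z * fourierSum L c z ∂μ) := by
  have hi : ∀ k : ℤ × ℤ, Integrable (fun z => c k * (f z * chr₂ L k.1 k.2 z)) μ := fun k =>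
    (hf.mul_bdd (c := 1) (continuous_chr₂ L k.1 k.2).aestronglyMeasurable
      (Eventually.of_forall fun z => (norm_chr₂ L k.1 k.2 z).le)).const_mul _
  have h := hasSum_integral_of_summable_integral_norm hi (by
    have : ∀ k : ℤ × ℤ, ∫ z, ‖c k * (f z * chr₂ L k.1 k.2 z)‖ ∂μ = ‖c k‖ * ∫ z, ‖f z‖ ∂μ := by
      intro k
      rw [← integral_const_mul]
      simp only [norm_mul, norm_chr₂, mul_one]
    simp only [this]
    exact hc.norm.mul_right _)
  simp only [integral_const_mul] at h
  have he : ∫ z, f z * fourierSum L c z ∂μ =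
      ∫ z, ∑' k : ℤ × ℤ, c k * (f z * chr₂ L k.1 k.2 z) ∂μ := by
    refine integral_congr_ae (Eventually.of_forall fun z => ?_)
    simp only [fourierSum, ← tsum_mul_left]
    congr 1 with k
    ring
  rw [he]
  exact h

lemma integrable_fourierSum (L : ℝ) {c : ℤ × ℤ → ℂ} (hc : Summable c) {μ : Measure (ℝ × ℝ)}
    [IsFiniteMeasure μ] : Integrable (fourierSum L c) μ :=
  Integrable.of_bound (continuous_fourierSum L hc).aestronglyMeasurable _
    (Eventually.of_forall (norm_fourierSum_le L hc))

lemma integral_fourierSum_mul_chr₂ (L : ℝ) (hL : 0 < L) {c : ℤ × ℤ → ℂ} (hc : Summable c)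
    (m n : ℤ) :
    ∫ z, fourierSum L c z * chr₂ L m n z ∂(cellMeasure L) = L ^ 2 * c (-m, -n) := by
  have h := hasSum_integral_mul_fourierSum L hc (f := chr₂ L m n) (μ := cellMeasure L)
    (Integrable.of_bound (continuous_chr₂ L m n).aestronglyMeasurable 1
      (Eventually.of_forall fun z => (norm_chr₂ L m n z).le))
  have h2 := hasSum_ite_eq ((-m, -n) : ℤ × ℤ) (c (-m, -n) * (L : ℂ) ^ 2)
  have h3 := h.unique (h2.congr_fun fun k => by
    simp only [chr₂_mul]
    rw [integral_chr₂ L hL]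
    by_cases hk : k = (-m, -n)
    · subst hk; simp
    · rw [if_neg hk, if_neg, mul_zero]
      rintro ⟨h1, h2⟩
      exact hk (Prod.ext (by simpa using by linarith) (by simpa using by linarith)))
  rw [mul_comm, ← h3]
  congr 1 with z
  ring

/-- An integrable function on the torus with summable Fourier coefficients is the sum of its Fourier
series. -/
lemma ae_eq_fourierSum (L : ℝ) (hL : 0 < L) {f : ℝ × ℝ → ℂ} (hf : Integrable f (cellMeasure L))
    {c : ℤ × ℤ → ℂ} (hc : Summable c)
    (h : ∀ m n : ℤ, ∫ z, f z * chr₂ L m n z ∂(cellMeasure L) = L ^ 2 * c (-m, -n)) :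
    f =ᵐ[cellMeasure L] fourierSum L c :=
  ae_eq_of_fourier₂ L hL hf (integrable_fourierSum L hc) fun m n => by
    rw [h, integral_fourierSum_mul_chr₂ L hL hc]

/-! ### Rapidly decreasing double sequences -/

lemma summable_one_div_one_add_sq : Summable fun m : ℤ => 1 / (1 + (m : ℝ) ^ 2) := by
  have h : Summable fun m : ℤ => 1 / (m : ℝ) ^ 2 := by
    have := Real.summable_one_div_int_pow (p := 2)
    exact this.2 (by norm_num)
  refine Summable.of_norm_bounded_eventually h ?_
  filter_upwards [(Set.finite_singleton (0 : ℤ)).compl_mem_cofinite] with m hm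
  have hm : m ≠ 0 := by simpa using hm
  have h0 : (0 : ℝ) < (m : ℝ) ^ 2 := by positivity
  rw [Real.norm_of_nonneg (by positivity)]
  exact one_div_le_one_div_of_le h0 (by linarith)

/-- If a family of bounded double sequences is, up to linear combinations, stable under
multiplication by both indices, then its members decay fast enough to be summable. -/
lemma summable_of_mul_mem_span {T : Set (ℤ × ℤ → ℂ)} (hb : ∀ c ∈ T, ∃ C : ℝ, ∀ k, ‖c k‖ ≤ C)
    (h₁ : ∀ c ∈ T, (fun k : ℤ × ℤ => (k.1 : ℂ) * c k) ∈ Submodule.span ℂ T)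
    (h₂ : ∀ c ∈ T, (fun k : ℤ × ℤ => (k.2 : ℂ) * c k) ∈ Submodule.span ℂ T)
    {c : ℤ × ℤ → ℂ} (hc : c ∈ T) : Summable c := by
  have hb' : ∀ c ∈ Submodule.span ℂ T, ∃ C : ℝ, ∀ k, ‖c k‖ ≤ C := by
    intro c hc
    induction hc using Submodule.span_induction with
    | mem c hc => exact hb c hc
    | zero => exact ⟨0, fun k => by simp⟩
    | add c c' _ _ h h' =>
      obtain ⟨C, hC⟩ := h
      obtain ⟨C', hC'⟩ := h'
      exact ⟨C + C', fun k => (norm_add_le _ _).trans (add_le_add (hC k) (hC' k))⟩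
    | smul a c _ h =>
      obtain ⟨C, hC⟩ := h
      refine ⟨‖a‖ * C, fun k => ?_⟩
      rw [Pi.smul_apply, norm_smul]
      exact mul_le_mul_of_nonneg_left (hC k) (norm_nonneg _)
  have hmul : ∀ w : ℤ × ℤ → ℂ, (∀ c ∈ T, (fun k => w k * c k) ∈ Submodule.span ℂ T) →
      ∀ c ∈ Submodule.span ℂ T, (fun k => w k * c k) ∈ Submodule.span ℂ T := by
    intro w hw c hc
    induction hc using Submodule.span_induction with
    | mem c hc => exact hw c hc
    | zero => convert Submodule.zero_mem (Submodule.span ℂ T) using 1; ext k; simp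
    | add c c' _ _ h h' =>
      convert Submodule.add_mem _ h h' using 1; ext k; simp [mul_add]
    | smul a c _ h =>
      convert Submodule.smul_mem _ a h using 1; ext k; simp; ring
  have hs := Submodule.subset_span (R := ℂ) hc
  have h3 := Submodule.add_mem _ hs (hmul _ h₁ _ (hmul _ h₁ _ hs))
  obtain ⟨C, hC⟩ := hb' _ (Submodule.add_mem _ h3 (hmul _ h₂ _ (hmul _ h₂ _ h3)))
  have hS := (summable_one_div_one_add_sq.mul_of_nonneg summable_one_div_one_add_sq
    (fun m => by positivity) (fun m => by positivity)).mul_left C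
  refine Summable.of_norm_bounded hS fun k => ?_
  have h4 := hC k
  have h5 : ‖((1 + (k.1 : ℝ) ^ 2) * (1 + (k.2 : ℝ) ^ 2) : ℝ) • c k‖ ≤ C := by
    convert h4 using 2
    simp only [Pi.add_apply, Complex.real_smul]
    push_cast
    ring
  rw [norm_smul, Real.norm_of_nonneg (by positivity)] at h5
  rw [← mul_div_mul_comm, mul_one, ← mul_div_assoc, mul_one, le_div_iff₀ (by positivity)]
  linarith

/-! ### Fourier coefficients of smooth periodic functions -/

lemma cellMeasure_eq (L : ℝ) :
    cellMeasure L = (volume : Measure (ℝ × ℝ)).restrict (Set.Ico 0 L ×ˢ Set.Ico 0 L) := by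
  rw [cellMeasure, Measure.prod_restrict]; rfl

lemma _root_.Continuous.integrable_cellMeasure {h : ℝ × ℝ → ℂ} (hh : Continuous h) (L : ℝ) :
    Integrable h (cellMeasure L) := by
  rw [cellMeasure_eq]
  exact (hh.continuousOn.integrableOn_compact (isCompact_Icc.prod isCompact_Icc)).mono_set
    (Set.prod_mono Set.Ico_subset_Icc_self Set.Ico_subset_Icc_self)

lemma step_pos {d : ℕ} (hd : 0 < d) : 0 < step d := by
  unfold step; have : (0 : ℝ) < d := by exact_mod_cast hd
  positivity

lemma mul_step_sq {d : ℕ} (hd : 0 < d) : d * step d ^ 2 = 2 * Real.pi := by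
  have : (0 : ℝ) < d := by exact_mod_cast hd
  rw [step, Real.sq_sqrt (by positivity)]; field_simp

lemma mul_step_pos {d : ℕ} (hd : 0 < d) : 0 < d * step d :=
  mul_pos (by exact_mod_cast hd) (step_pos hd)

lemma hasDerivAt_chr (L : ℝ) (n : ℤ) (t : ℝ) :
    HasDerivAt (chr L n) (2 * Real.pi * Complex.I * n / L * chr L n t) t := by
  have h1 : HasDerivAt (fun t : ℝ => 2 * Real.pi * Complex.I * n / L * (t : ℂ))
      (2 * Real.pi * Complex.I * n / L) t := by
    simpa using (Complex.ofRealCLM.hasDerivAt (x := t)).const_mul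
      (2 * Real.pi * Complex.I * n / L : ℂ)
  have h2 : ∀ t : ℝ, chr L n t = Complex.exp (2 * Real.pi * Complex.I * n / L * (t : ℂ)) := by
    intro t; rw [chr]; congr 1; ring
  rw [funext h2]
  convert h1.cexp using 1
  exact mul_comm _ _

/-- Partial derivative in the first variable. -/
def partialFst (h : ℝ × ℝ → ℂ) (z : ℝ × ℝ) : ℂ := fderiv ℝ h z (1, 0)

lemma IsTorusTest.continuous {d : ℕ} {h : ℝ × ℝ → ℂ} (hh : IsTorusTest d h) : Continuous h :=
  hh.1.continuous

lemma IsTorusTest.partialFst {d : ℕ} {h : ℝ × ℝ → ℂ} (hh : IsTorusTest d h) :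
    IsTorusTest d (partialFst h) := by
  refine ⟨?_, fun z => ?_⟩
  · exact (hh.1.fderiv_right (m := (⊤ : ℕ∞)) (by norm_cast)).clm_apply contDiff_const
  · have h1 : (fun w : ℝ × ℝ => h (w + (d * step d, 0))) = h := by
      ext w; rw [← (hh.2 w).1]; congr 1; ext <;> simp
    have h2 : (fun w : ℝ × ℝ => h (w + (0, d * step d))) = h := by
      ext w; rw [← (hh.2 w).2]; congr 1; ext <;> simp
    constructor
    · have := congrArg (fun F => fderiv ℝ F z (1, 0)) h1
      simp only [fderiv_comp_add_right] at this
      rw [ZakGross.partialFst, ZakGross.partialFst, ← this]; congr 2; ext <;> simp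
    · have := congrArg (fun F => fderiv ℝ F z (1, 0)) h2
      simp only [fderiv_comp_add_right] at this
      rw [ZakGross.partialFst, ZakGross.partialFst, ← this]; congr 2; ext <;> simp

lemma IsTorusTest.swap {d : ℕ} {h : ℝ × ℝ → ℂ} (hh : IsTorusTest d h) :
    IsTorusTest d (h ∘ Prod.swap) :=
  ⟨hh.1.comp (contDiff_snd.prodMk contDiff_fst), fun z =>
    ⟨(hh.2 z.swap).2, (hh.2 z.swap).1⟩⟩

/-- Integration by parts in the first variable on the torus. -/
lemma integral_partialFst {d : ℕ} (hd : 0 < d) {h : ℝ × ℝ → ℂ} (hh : IsTorusTest d h) (m n : ℤ) :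
    ∫ z, partialFst h z * chr₂ (d * step d) m n z ∂(cellMeasure (d * step d)) =
      -(2 * Real.pi * Complex.I / (d * step d : ℝ)) *
        (m * ∫ z, h z * chr₂ (d * step d) m n z ∂(cellMeasure (d * step d))) := by
  set L : ℝ := d * step d with hLdef
  have hL : 0 < L := mul_step_pos hd
  have hc1 := hh.continuous
  have hc2 := hh.partialFst.continuous
  have hi1 : Integrable (fun z => partialFst h z * chr₂ L m n z) (cellMeasure L) :=
    (hc2.mul (continuous_chr₂ L m n)).integrable_cellMeasure L
  have hi2 : Integrable (fun z => 2 * Real.pi * Complex.I * m / L * (h z * chr₂ L m n z))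
      (cellMeasure L) :=
    (continuous_const.mul (hc1.mul (continuous_chr₂ L m n))).integrable_cellMeasure L
  have key : ∫ z, (partialFst h z * chr₂ L m n z +
      2 * Real.pi * Complex.I * m / L * (h z * chr₂ L m n z)) ∂(cellMeasure L) = 0 := by
    have hi3 : Integrable (fun z => partialFst h z * chr₂ L m n z +
        2 * Real.pi * Complex.I * m / L * (h z * chr₂ L m n z)) (cellMeasure L) := hi1.add hi2
    unfold cellMeasure at hi3 ⊢
    rw [integral_prod_symm _ hi3]
    refine integral_eq_zero_of_ae (Eventually.of_forall fun v => ?_)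
    simp only [Pi.zero_apply]
    have hd1 : ∀ u : ℝ, HasDerivAt (fun u : ℝ => h (u, v) * chr₂ L m n (u, v))
        (partialFst h (u, v) * chr₂ L m n (u, v) +
          2 * Real.pi * Complex.I * m / L * (h (u, v) * chr₂ L m n (u, v))) u := by
      intro u
      have e1 : HasDerivAt (fun u : ℝ => h (u, v)) (partialFst h (u, v)) u :=
        ((hh.1.differentiable (by simp)) (u, v)).hasFDerivAt.comp_hasDerivAt u
          ((hasDerivAt_id u).prodMk (hasDerivAt_const u v))
      have e2 := (hasDerivAt_chr L m u).mul_const (chr L n v)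
      refine (e1.mul e2).congr_deriv ?_
      simp only [chr₂]; ring
    rw [restrict_Ico_eq_restrict_Ioc, ← intervalIntegral.integral_of_le hL.le,
      intervalIntegral.integral_eq_sub_of_hasDerivAt (fun u _ => hd1 u)]
    · have p1 := (hh.2 (0, v)).1
      have p2 := chr_period L hL.ne' m 0
      rw [zero_add] at p1 p2
      rw [← hLdef] at p1
      simp only [chr₂, p1, p2, sub_self]
    · refine Continuous.intervalIntegrable ?_ _ _
      fun_prop
  rw [integral_add hi1 hi2, integral_const_mul] at key
  rw [eq_neg_of_add_eq_zero_left key]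
  ring

lemma integral_swap_chr₂ (L : ℝ) (h : ℝ × ℝ → ℂ) (m n : ℤ) :
    ∫ z, (h ∘ Prod.swap) z * chr₂ L m n z ∂(cellMeasure L) =
      ∫ z, h z * chr₂ L n m z ∂(cellMeasure L) := by
  unfold cellMeasure
  rw [← integral_prod_swap]
  congr 1 with z
  simp only [Function.comp, chr₂, Prod.fst_swap, Prod.snd_swap, Prod.swap_swap]
  ring

/-- The Fourier coefficients of a smooth function on the torus are summable. -/
lemma IsTorusTest.summable_fourier {d : ℕ} (hd : 0 < d) {h : ℝ × ℝ → ℂ} (hh : IsTorusTest d h) :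
    Summable fun k : ℤ × ℤ =>
      ∫ z, h z * chr₂ (d * step d) k.1 k.2 z ∂(cellMeasure (d * step d)) := by
  set L : ℝ := d * step d with hLdef
  have hL : 0 < L := mul_step_pos hd
  have hne : (2 * Real.pi * Complex.I / (L : ℂ)) ≠ 0 := by
    have : (L : ℂ) ≠ 0 := by exact_mod_cast hL.ne'
    simp [this, Real.pi_ne_zero]
  let cf : (ℝ × ℝ → ℂ) → ℤ × ℤ → ℂ := fun h k => ∫ z, h z * chr₂ L k.1 k.2 z ∂(cellMeasure L)
  have h1 : ∀ g, IsTorusTest d g → ∀ k : ℤ × ℤ,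
      (k.1 : ℂ) * cf g k =
        -(2 * Real.pi * Complex.I / (L : ℂ))⁻¹ * cf (ZakGross.partialFst g) k := by
    intro g hg k
    have := integral_partialFst hd hg k.1 k.2
    simp only [cf]
    rw [← hLdef] at this
    rw [this, ← mul_assoc, neg_mul_neg, inv_mul_cancel₀ hne, one_mul]
  refine summable_of_mul_mem_span (T := {c | ∃ g, IsTorusTest d g ∧ c = cf g}) ?_ ?_ ?_
    ⟨h, hh, rfl⟩
  · rintro _ ⟨g, hg, rfl⟩
    refine ⟨∫ z, ‖g z‖ ∂(cellMeasure L), fun k => (norm_integral_le_integral_norm _).trans ?_⟩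
    simp only [norm_mul, norm_chr₂, mul_one, le_refl]
  · rintro _ ⟨g, hg, rfl⟩
    have := Submodule.smul_mem _ (-(2 * Real.pi * Complex.I / (L : ℂ))⁻¹)
      (Submodule.subset_span (R := ℂ) (s := {c | ∃ g, IsTorusTest d g ∧ c = cf g})
        ⟨_, hg.partialFst, rfl⟩)
    convert this using 1
    ext k
    exact h1 g hg k
  · rintro _ ⟨g, hg, rfl⟩
    have := Submodule.smul_mem _ (-(2 * Real.pi * Complex.I / (L : ℂ))⁻¹)
      (Submodule.subset_span (R := ℂ) (s := {c | ∃ g, IsTorusTest d g ∧ c = cf g})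
        ⟨_, hg.swap.partialFst.swap, rfl⟩)
    convert this using 1
    ext k
    have e := h1 _ hg.swap (k.2, k.1)
    simp only [cf, integral_swap_chr₂] at e
    simp only [Pi.smul_apply, smul_eq_mul, cf, integral_swap_chr₂]
    exact e

lemma isTorusTest_chr₂ {d : ℕ} (hd : 0 < d) (m n : ℤ) :
    IsTorusTest d (chr₂ (d * step d) m n) := by
  have hL := (mul_step_pos hd).ne'
  have hc : ∀ k : ℤ, ContDiff ℝ (⊤ : ℕ∞) (chr (d * step d) k) := by
    intro k
    unfold chr
    refine ContDiff.cexp ?_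
    exact (contDiff_const.mul Complex.ofRealCLM.contDiff).div_const _
  refine ⟨((hc m).comp contDiff_fst).mul ((hc n).comp contDiff_snd), fun z => ⟨?_, ?_⟩⟩
  · simp only [chr₂, chr_period _ hL]
  · simp only [chr₂, chr_period _ hL]

/-- The squares `|m|, |n| ≤ N` exhaust the lattice. -/
lemma tendsto_sum_square {c : ℤ × ℤ → ℂ} {s : ℂ} (hc : HasSum c s) :
    Tendsto (fun N : ℕ => ∑ m ∈ Finset.Icc (-(N : ℤ)) N, ∑ n ∈ Finset.Icc (-(N : ℤ)) N, c (m, n))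
      atTop (𝓝 s) := by
  have h1 : Tendsto (fun N : ℕ => Finset.Icc (-(N : ℤ)) N ×ˢ Finset.Icc (-(N : ℤ)) N) atTop
      (atTop : Filter (Finset (ℤ × ℤ))) := by
    refine tendsto_atTop_finset_of_monotone (fun N M h => ?_) fun k => ?_
    · have : (N : ℤ) ≤ M := by exact_mod_cast h
      exact Finset.product_subset_product (Finset.Icc_subset_Icc (by linarith) this)
        (Finset.Icc_subset_Icc (by linarith) this)
    · refine ⟨max k.1.natAbs k.2.natAbs, ?_⟩
      simp only [Finset.mem_product, Finset.mem_Icc]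
      omega
  refine (Tendsto.comp hc h1).congr fun N => ?_
  simp only [Function.comp, Finset.sum_product]

/-! ### Displacement operators -/

lemma coeFn_shift (x : ℝ) (φ : Hilb) : shift x φ =ᵐ[volume] fun y => φ (y - x) :=
  Lp.coeFn_compMeasurePreserving φ (measurePreserving_sub_right volume x)

lemma coeFn_modulate (p : ℝ) (φ : Hilb) :
    modulate p φ =ᵐ[volume] fun y => Complex.exp (Complex.I * p * y) * φ y :=
  MemLp.coeFn_toLp (memLp_modulation p φ)

lemma coeFn_shift_modulate (x p : ℝ) (φ : Hilb) :
    shift x (modulate p φ) =ᵐ[volume]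
      fun y => Complex.exp (Complex.I * p * (y - x)) * φ (y - x) := by
  refine (coeFn_shift x _).trans ?_
  filter_upwards [(measurePreserving_sub_right volume x).quasiMeasurePreserving.ae
    (coeFn_modulate p φ)] with y hy
  rw [hy]; push_cast; rfl

lemma coeFn_disp (x p : ℝ) (φ : Hilb) :
    disp x p φ =ᵐ[volume]
      fun y => Complex.exp (Complex.I * (p * y - x * p / 2)) * φ (y - x) := by
  have h : disp x p φ = Complex.exp (Complex.I * x * p / 2) • shift x (modulate p φ) := rfl
  rw [h]
  filter_upwards [coeFn_shift_modulate x p φ,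
    Lp.coeFn_smul (Complex.exp (Complex.I * x * p / 2)) (shift x (modulate p φ))] with y h1 h2
  rw [h2, Pi.smul_apply, h1, smul_eq_mul, ← mul_assoc, ← Complex.exp_add]
  congr 2; ring

/-- The Weyl relation. -/
lemma disp_disp (a b x p : ℝ) (φ : Hilb) :
    disp a b (disp x p φ) =
      Complex.exp (Complex.I * (b * x - a * p) / 2) • disp (a + x) (b + p) φ := by
  refine Lp.ext ?_
  filter_upwards [coeFn_disp a b (disp x p φ), coeFn_disp (a + x) (b + p) φ,
    Lp.coeFn_smul (Complex.exp (Complex.I * (b * x - a * p) / 2)) (disp (a + x) (b + p) φ),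
    (measurePreserving_sub_right volume a).quasiMeasurePreserving.ae
      (coeFn_disp x p φ)] with y h1 h2 h3 h4
  rw [h1, h4, h3, Pi.smul_apply, h2, smul_eq_mul, ← mul_assoc, ← mul_assoc, ← Complex.exp_add,
    ← Complex.exp_add, sub_sub]
  congr 2; push_cast; ring

lemma disp_zero (φ : Hilb) : disp 0 0 φ = φ := by
  refine Lp.ext ?_
  filter_upwards [coeFn_disp 0 0 φ] with y h
  rw [h]; simp

lemma disp_neg_disp (x p : ℝ) (φ : Hilb) : disp (-x) (-p) (disp x p φ) = φ := by
  rw [disp_disp, neg_add_cancel, neg_add_cancel, disp_zero]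
  have : Complex.I * (((-p : ℝ) : ℂ) * x - ((-x : ℝ) : ℂ) * p) / 2 = 0 := by push_cast; ring
  rw [this, Complex.exp_zero, one_smul]

lemma disp_disp_neg (x p : ℝ) (φ : Hilb) : disp x p (disp (-x) (-p) φ) = φ := by
  simpa using disp_neg_disp (-x) (-p) φ

lemma norm_exp_I_mul (r : ℝ) : ‖Complex.exp (Complex.I * r)‖ = 1 := by
  rw [mul_comm, Complex.norm_exp_ofReal_mul_I]

lemma norm_disp (x p : ℝ) (φ : Hilb) : ‖disp x p φ‖ = ‖φ‖ := by
  have h1 : ‖modulate p φ‖ = ‖φ‖ := by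
    change ‖(memLp_modulation p φ).toLp _‖ = ‖φ‖
    rw [Lp.norm_toLp, Lp.norm_def]
    refine congrArg _ (eLpNorm_congr_norm_ae ?_)
    filter_upwards with y
    rw [norm_mul, norm_modulation, one_mul]
  have h2 : ‖shift x (modulate p φ)‖ = ‖modulate p φ‖ :=
    LinearIsometry.norm_map (Lp.compMeasurePreservingₗᵢ ℂ (fun y : ℝ => y - x)
      (measurePreserving_sub_right volume x)) _
  have h : disp x p φ = Complex.exp (Complex.I * x * p / 2) • shift x (modulate p φ) := rfl
  rw [h, norm_smul, h2, h1]
  have : Complex.I * x * p / 2 = Complex.I * ((x * p / 2 : ℝ) : ℂ) := by push_cast; ring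
  rw [this, norm_exp_I_mul, one_mul]

lemma disp_adjoint (x p : ℝ) : (disp x p)† = disp (-x) (-p) := by
  have h := (ContinuousLinearMap.norm_map_iff_adjoint_comp_self (disp x p)).1 (norm_disp x p)
  ext1 φ
  have h2 := congrArg (fun T : Hilb →L[ℂ] Hilb => T (disp (-x) (-p) φ)) h
  simpa [disp_disp_neg] using h2

/-- Conjugation by a displacement multiplies a displacement by a phase. -/
lemma disp_conj (u v x p : ℝ) (φ : Hilb) :
    disp u v (disp x p (disp (-u) (-v) φ)) =
      Complex.exp (Complex.I * (v * x - u * p)) • disp x p φ := by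
  rw [disp_disp x p, map_smul, disp_disp, smul_smul, ← Complex.exp_add]
  have h1 : u + (x + -u) = x := by ring
  have h2 : v + (p + -v) = p := by ring
  rw [h1, h2]
  congr 2; push_cast; ring

lemma heisenberg_eq (c x p : ℝ) (φ : Hilb) :
    heisenberg c x p φ = Complex.exp (Complex.I * (c - x * p / 2)) • disp x p φ := by
  have h : disp x p φ = Complex.exp (Complex.I * x * p / 2) • shift x (modulate p φ) := rfl
  have h' : heisenberg c x p φ = Complex.exp (Complex.I * c) • shift x (modulate p φ) := rfl
  rw [h, h', smul_smul, ← Complex.exp_add]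
  congr 2; ring

/-! ### Nuclear representations and the trace -/

lemma HilbertBasis.sum_norm_inner_mul_le {ι E : Type*} [NormedAddCommGroup E]
    [InnerProductSpace ℂ E] (b : HilbertBasis ι ℂ E) (x y : E) :
    ∑' i, ‖(inner ℂ x (b i) : ℂ) * inner ℂ (b i) y‖ ≤ ‖x‖ * ‖y‖ := by
  refine (b.summable_inner_mul_inner x y).norm.tsum_le_of_sum_le fun s => ?_
  have hx : ∑ i ∈ s, ‖(inner ℂ (b i) x : ℂ)‖ ^ 2 ≤ ‖x‖ ^ 2 := b.orthonormal.sum_inner_products_le x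
  have hy : ∑ i ∈ s, ‖(inner ℂ (b i) y : ℂ)‖ ^ 2 ≤ ‖y‖ ^ 2 := b.orthonormal.sum_inner_products_le y
  have h := Real.sum_mul_le_sqrt_mul_sqrt s (fun i => ‖(inner ℂ (b i) x : ℂ)‖)
    (fun i => ‖(inner ℂ (b i) y : ℂ)‖)
  calc ∑ i ∈ s, ‖(inner ℂ x (b i) : ℂ) * inner ℂ (b i) y‖
      = ∑ i ∈ s, ‖(inner ℂ (b i) x : ℂ)‖ * ‖(inner ℂ (b i) y : ℂ)‖ := by
        refine Finset.sum_congr rfl fun i _ => ?_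
        rw [norm_mul, norm_inner_symm x]
    _ ≤ _ := h
    _ ≤ √(‖x‖ ^ 2) * √(‖y‖ ^ 2) := by gcongr
    _ = ‖x‖ * ‖y‖ := by rw [Real.sqrt_sq (norm_nonneg _), Real.sqrt_sq (norm_nonneg _)]

/-- The trace of `T A` in terms of any nuclear representation of `A`. -/
lemma IsNuclearRep.hasSum_trace {A : Hilb →L[ℂ] Hilb} {φ ψ : ℕ → Hilb} (h : IsNuclearRep A φ ψ)
    (T : Hilb →L[ℂ] Hilb) :
    HasSum (fun i => (inner ℂ (ψ i) (T (φ i)) : ℂ)) (trace (T ∘L A)) := by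
  have hi : ∀ i, HasSum (fun α => (inner ℂ (ψ i) (basis α) : ℂ) * inner ℂ (basis α) (T (φ i)))
      (inner ℂ (ψ i) (T (φ i))) := fun i => basis.hasSum_inner_mul_inner (ψ i) (T (φ i))
  have hb : ∀ i, ∑' α, ‖(inner ℂ (ψ i) (basis α) : ℂ) * inner ℂ (basis α) (T (φ i))‖ ≤
      ‖ψ i‖ * ‖T (φ i)‖ := fun i => HilbertBasis.sum_norm_inner_mul_le basis (ψ i) (T (φ i))
  have hα : ∀ α, HasSum (fun i => (inner ℂ (ψ i) (basis α) : ℂ) * inner ℂ (basis α) (T (φ i)))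
      (inner ℂ (basis α) (T (A (basis α)))) := fun α => by
    refine (((h.2 (basis α)).mapL T).mapL (innerSL ℂ (basis α))).congr_fun fun i => ?_
    rw [map_smul, map_smul, innerSL_apply_apply, smul_eq_mul]
  generalize hF : (fun k : ℕ × basisIndex =>
    (inner ℂ (ψ k.1) (basis k.2) : ℂ) * inner ℂ (basis k.2) (T (φ k.1))) = F
  have hF' : ∀ i α, (inner ℂ (ψ i) (basis α) : ℂ) * inner ℂ (basis α) (T (φ i)) = F (i, α) :=
    fun i α => congrFun hF (i, α)
  simp only [hF'] at hi hb hα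
  have hFs : Summable F := by
    refine Summable.of_norm ((summable_prod_of_nonneg fun k => norm_nonneg (F k)).2 ⟨fun i =>
      (hi i).summable.norm, ?_⟩)
    refine Summable.of_nonneg_of_le (fun i => tsum_nonneg fun _ => norm_nonneg _) hb ?_
    refine Summable.of_nonneg_of_le (fun i => by positivity) (fun i => ?_) (h.1.mul_left ‖T‖)
    calc ‖ψ i‖ * ‖T (φ i)‖ ≤ ‖ψ i‖ * (‖T‖ * ‖φ i‖) := by gcongr; exact T.le_opNorm _
      _ = ‖T‖ * (‖φ i‖ * ‖ψ i‖) := by ring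
  have h1 : HasSum (fun i => (inner ℂ (ψ i) (T (φ i)) : ℂ)) (∑' k, F k) :=
    hFs.hasSum.prod_fiberwise hi
  have h2 : HasSum (fun α => (inner ℂ (basis α) (T (A (basis α))) : ℂ)) (∑' k, F k) :=
    ((Equiv.prodComm basisIndex ℕ).hasSum_iff.2 hFs.hasSum).prod_fiberwise hα
  have h3 : trace (T ∘L A) = ∑' k, F k := h2.tsum_eq
  rw [h3]
  exact h1

lemma IsTraceClass.trace_add {A : Hilb →L[ℂ] Hilb} (h : IsTraceClass A) (S T : Hilb →L[ℂ] Hilb) :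
    trace ((S + T) ∘L A) = trace (S ∘L A) + trace (T ∘L A) := by
  obtain ⟨φ, ψ, h⟩ := h
  refine (h.hasSum_trace (S + T)).unique
    (((h.hasSum_trace S).add (h.hasSum_trace T)).congr_fun fun i => ?_)
  rw [add_apply, inner_add_right]

lemma IsTraceClass.trace_smul {A : Hilb →L[ℂ] Hilb} (h : IsTraceClass A) (c : ℂ)
    (T : Hilb →L[ℂ] Hilb) : trace ((c • T) ∘L A) = c * trace (T ∘L A) := by
  obtain ⟨φ, ψ, h⟩ := h
  refine (h.hasSum_trace (c • T)).unique (((h.hasSum_trace T).mul_left c).congr_fun fun i => ?_)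
  rw [smul_apply, inner_smul_right]

lemma IsTraceClass.trace_sum {A : Hilb →L[ℂ] Hilb} (h : IsTraceClass A) {ι : Type*}
    (s : Finset ι) (T : ι → Hilb →L[ℂ] Hilb) :
    trace ((∑ i ∈ s, T i) ∘L A) = ∑ i ∈ s, trace (T i ∘L A) := by
  classical
  induction s using Finset.induction_on with
  | empty => simp [trace]
  | insert a s ha ih => rw [Finset.sum_insert ha, Finset.sum_insert ha, h.trace_add, ih]

lemma IsNuclearRep.comp_left {A : Hilb →L[ℂ] Hilb} {φ ψ : ℕ → Hilb} (h : IsNuclearRep A φ ψ)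
    (T : Hilb →L[ℂ] Hilb) : IsNuclearRep (T ∘L A) (fun i => T (φ i)) ψ := by
  refine ⟨?_, fun x => ?_⟩
  · refine Summable.of_nonneg_of_le (fun i => by positivity) (fun i => ?_) (h.1.mul_left ‖T‖)
    rw [← mul_assoc]
    exact mul_le_mul_of_nonneg_right (T.le_opNorm _) (norm_nonneg _)
  · refine ((h.2 x).mapL T).congr_fun fun i => ?_
    rw [map_smul]

lemma IsNuclearRep.comp_right {A : Hilb →L[ℂ] Hilb} {φ ψ : ℕ → Hilb} (h : IsNuclearRep A φ ψ)
    (T : Hilb →L[ℂ] Hilb) : IsNuclearRep (A ∘L T) φ (fun i => (T†) (ψ i)) := by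
  refine ⟨?_, fun x => ?_⟩
  · refine Summable.of_nonneg_of_le (fun i => by positivity) (fun i => ?_) (h.1.mul_left ‖T†‖)
    calc ‖φ i‖ * ‖(T†) (ψ i)‖ ≤ ‖φ i‖ * (‖T†‖ * ‖ψ i‖) := by gcongr; exact (T†).le_opNorm _
      _ = ‖T†‖ * (‖φ i‖ * ‖ψ i‖) := by ring
  · refine (h.2 (T x)).congr_fun fun i => ?_
    rw [ContinuousLinearMap.adjoint_inner_left]

lemma IsNuclearRep.smul {A : Hilb →L[ℂ] Hilb} {φ ψ : ℕ → Hilb} (h : IsNuclearRep A φ ψ)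
    (c : ℂ) : IsNuclearRep (c • A) (fun i => c • φ i) ψ := by
  exact h.comp_left (c • ContinuousLinearMap.id ℂ Hilb)

lemma IsNuclearRep.adjoint {A : Hilb →L[ℂ] Hilb} {φ ψ : ℕ → Hilb} (h : IsNuclearRep A φ ψ) :
    IsNuclearRep (A†) ψ φ := by
  have hs : Summable fun i => ‖ψ i‖ * ‖φ i‖ := by simpa only [mul_comm] using h.1
  refine ⟨hs, fun x => ?_⟩
  have h1 : Summable fun i => (inner ℂ (φ i) x : ℂ) • ψ i := by
    refine Summable.of_norm_bounded (hs.mul_left ‖x‖) fun i => ?_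
    rw [norm_smul]
    calc ‖(inner ℂ (φ i) x : ℂ)‖ * ‖ψ i‖ ≤ (‖φ i‖ * ‖x‖) * ‖ψ i‖ := by
          gcongr; exact norm_inner_le_norm _ _
      _ = ‖x‖ * (‖ψ i‖ * ‖φ i‖) := by ring
  convert h1.hasSum using 1
  refine ext_inner_left ℂ fun y => ?_
  rw [ContinuousLinearMap.adjoint_inner_right]
  have h2 := h1.hasSum.mapL (innerSL ℂ y)
  have h3 := ((h.2 y).mapL (innerSL ℂ x)).star
  simp only [innerSL_apply_apply, inner_smul_right, star_mul', RCLike.star_def,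
    inner_conj_symm] at h2 h3
  refine h3.unique (h2.congr_fun fun i => ?_)
  ring

/-- The terms of two representations interleaved. -/
def interleave (φ φ' : ℕ → Hilb) (n : ℕ) : Hilb :=
  Sum.elim φ φ' (Equiv.natSumNatEquivNat.symm n)

lemma hasSum_interleave {E : Type*} [NormedAddCommGroup E] {f g : ℕ → E} {F : ℕ → E} {a b : E}
    (hf : HasSum f a) (hg : HasSum g b)
    (hF : ∀ i, F (Equiv.natSumNatEquivNat i) = Sum.elim f g i) : HasSum F (a + b) := by
  rw [← Equiv.natSumNatEquivNat.hasSum_iff]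
  exact HasSum.sum (hf.congr_fun fun i => hF (Sum.inl i)) (hg.congr_fun fun i => hF (Sum.inr i))

lemma IsNuclearRep.add {A B : Hilb →L[ℂ] Hilb} {φ ψ φ' ψ' : ℕ → Hilb} (h : IsNuclearRep A φ ψ)
    (h' : IsNuclearRep B φ' ψ') :
    IsNuclearRep (A + B) (interleave φ φ') (interleave ψ ψ') := by
  refine ⟨(hasSum_interleave h.1.hasSum h'.1.hasSum ?_).summable, fun x =>
    hasSum_interleave (h.2 x) (h'.2 x) ?_⟩
  · rintro (i | i) <;> simp [interleave]
  · rintro (i | i) <;> simp [interleave]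

lemma IsTraceClass.add {A B : Hilb →L[ℂ] Hilb} (hA : IsTraceClass A) (hB : IsTraceClass B) :
    IsTraceClass (A + B) := by
  obtain ⟨φ, ψ, h⟩ := hA
  obtain ⟨φ', ψ', h'⟩ := hB
  exact ⟨_, _, h.add h'⟩

lemma IsTraceClass.smul {A : Hilb →L[ℂ] Hilb} (hA : IsTraceClass A) (c : ℂ) :
    IsTraceClass (c • A) := by
  obtain ⟨φ, ψ, h⟩ := hA
  exact ⟨_, _, h.smul c⟩

lemma IsTraceClass.adjoint {A : Hilb →L[ℂ] Hilb} (hA : IsTraceClass A) : IsTraceClass (A†) := by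
  obtain ⟨φ, ψ, h⟩ := hA
  exact ⟨_, _, h.adjoint⟩

lemma IsTraceClass.comp_left {A : Hilb →L[ℂ] Hilb} (hA : IsTraceClass A) (T : Hilb →L[ℂ] Hilb) :
    IsTraceClass (T ∘L A) := by
  obtain ⟨φ, ψ, h⟩ := hA
  exact ⟨_, _, h.comp_left T⟩

lemma IsTraceClass.comp_right {A : Hilb →L[ℂ] Hilb} (hA : IsTraceClass A) (T : Hilb →L[ℂ] Hilb) :
    IsTraceClass (A ∘L T) := by
  obtain ⟨φ, ψ, h⟩ := hA
  exact ⟨_, _, h.comp_right T⟩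

/-- Cyclicity of the trace. -/
lemma IsTraceClass.trace_comm {A : Hilb →L[ℂ] Hilb} (hA : IsTraceClass A) (T : Hilb →L[ℂ] Hilb) :
    trace (T ∘L A) = trace (A ∘L T) := by
  obtain ⟨φ, ψ, h⟩ := hA
  refine (h.hasSum_trace T).unique ?_
  have := (h.comp_right T).hasSum_trace (ContinuousLinearMap.id ℂ Hilb)
  rw [ContinuousLinearMap.id_comp] at this
  refine this.congr_fun fun i => ?_
  rw [ContinuousLinearMap.adjoint_inner_left]; rfl

lemma IsTraceClass.trace_comp_add {A B : Hilb →L[ℂ] Hilb} (hA : IsTraceClass A)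
    (hB : IsTraceClass B) (T : Hilb →L[ℂ] Hilb) :
    trace (T ∘L (A + B)) = trace (T ∘L A) + trace (T ∘L B) := by
  obtain ⟨φ, ψ, h⟩ := hA
  obtain ⟨φ', ψ', h'⟩ := hB
  refine ((h.add h').hasSum_trace T).unique
    (hasSum_interleave (h.hasSum_trace T) (h'.hasSum_trace T) ?_)
  rintro (i | i) <;> simp [interleave]

lemma trace_adjoint (A : Hilb →L[ℂ] Hilb) : trace (A†) = conj (trace A) := by
  rw [trace, trace, Complex.conj_tsum]
  congr 1 with i
  rw [ContinuousLinearMap.adjoint_inner_right, inner_conj_symm]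

/-! ### The Zak transform -/

lemma summable_of_orthogonal {ι E : Type*} [NormedAddCommGroup E] [InnerProductSpace ℂ E]
    [CompleteSpace E] (f : ι → E) (hf : Pairwise fun i j => (inner ℂ (f i) (f j) : ℂ) = 0)
    (h : Summable fun i => ‖f i‖ ^ 2) : Summable f := by
  have ho : OrthogonalFamily ℂ (fun i => (ℂ ∙ f i : Submodule ℂ E))
      (fun i => (ℂ ∙ f i : Submodule ℂ E).subtypeₗᵢ) := by
    rintro i j hij ⟨v, hv⟩ ⟨w, hw⟩
    obtain ⟨a, rfl⟩ := Submodule.mem_span_singleton.1 hv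
    obtain ⟨b, rfl⟩ := Submodule.mem_span_singleton.1 hw
    simp [inner_smul_left, inner_smul_right, hf hij]
  exact (ho.summable_iff_norm_sq_summable
    (fun i => ⟨f i, Submodule.mem_span_singleton_self (f i)⟩)).2 h

/-- The Hilbert space of square-integrable functions on the cell of displaced codes. -/
abbrev CellHilb (d : ℕ) : Type := Lp ℂ 2 (cellMeasure (step d))

/-- The function `(s, t) ↦ (D(s, t)† φ)(y)` on the cell `[0, ℓ)²`. -/
def dispVal (d : ℕ) (y : ℝ) (φ : Hilb) : CellHilb d := (memLp_dispAdjAt φ (step d) y).toLp _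

lemma coeFn_dispVal (d : ℕ) (y : ℝ) (φ : Hilb) :
    dispVal d y φ =ᵐ[cellMeasure (step d)] fun z => dispAdjAt φ z.1 z.2 y :=
  MemLp.coeFn_toLp (memLp_dispAdjAt φ (step d) y)

lemma ae_cellMeasure_of_ae {P : ℝ → Prop} (h : ∀ᵐ x, P x) (L y : ℝ) :
    ∀ᵐ z ∂(cellMeasure L), P (y + z.1) := by
  have h1 : ∀ᵐ s ∂(volume.restrict (Set.Ico 0 L)), P (y + s) :=
    ae_restrict_of_ae ((measurePreserving_add_left volume y).quasiMeasurePreserving.ae h)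
  exact Measure.quasiMeasurePreserving_fst.ae h1

lemma dispVal_add (d : ℕ) (y : ℝ) (φ ψ : Hilb) :
    dispVal d y (φ + ψ) = dispVal d y φ + dispVal d y ψ := by
  refine Lp.ext ?_
  filter_upwards [coeFn_dispVal d y (φ + ψ), coeFn_dispVal d y φ, coeFn_dispVal d y ψ,
    Lp.coeFn_add (dispVal d y φ) (dispVal d y ψ),
    ae_cellMeasure_of_ae (Lp.coeFn_add φ ψ) (step d) y] with z h1 h2 h3 h4 h5
  rw [h1, h4, Pi.add_apply, h2, h3, dispAdjAt, dispAdjAt, dispAdjAt, h5, Pi.add_apply, mul_add]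

lemma dispVal_smul (d : ℕ) (y : ℝ) (c : ℂ) (φ : Hilb) :
    dispVal d y (c • φ) = c • dispVal d y φ := by
  refine Lp.ext ?_
  filter_upwards [coeFn_dispVal d y (c • φ), coeFn_dispVal d y φ,
    Lp.coeFn_smul c (dispVal d y φ),
    ae_cellMeasure_of_ae (Lp.coeFn_smul c φ) (step d) y] with z h1 h2 h4 h5
  rw [h1, h4, Pi.smul_apply, h2, dispAdjAt, dispAdjAt, h5, Pi.smul_apply, smul_eq_mul, smul_eq_mul]
  ring

lemma inner_dispVal (d : ℕ) (y y' : ℝ) (φ ψ : Hilb) :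
    (inner ℂ (dispVal d y φ) (dispVal d y' ψ) : ℂ) =
      (∫ s in Set.Ico 0 (step d), conj (φ (y + s)) * ψ (y' + s)) *
        ∫ t in Set.Ico 0 (step d), Complex.exp (Complex.I * ((y - y') * t)) := by
  rw [L2.inner_def, ← integral_prod_mul (fun s => conj (φ (y + s)) * ψ (y' + s))
    (fun t : ℝ => Complex.exp (Complex.I * ((y - y') * t)))]
  refine integral_congr_ae ?_
  filter_upwards [coeFn_dispVal d y φ, coeFn_dispVal d y' ψ] with z h1 h2
  rw [h1, h2, RCLike.inner_apply, dispAdjAt, dispAdjAt, map_mul, ← Complex.exp_conj]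
  have e : Complex.exp (Complex.I * ((y - y') * z.2)) =
      Complex.exp (-(Complex.I * (z.2 * y' + z.1 * z.2 / 2))) *
      Complex.exp (conj (-(Complex.I * (z.2 * y + z.1 * z.2 / 2)))) := by
    rw [← Complex.exp_add]
    congr 1
    simp only [map_neg, map_mul, map_add, map_div₀, Complex.conj_I, Complex.conj_ofReal, map_ofNat]
    ring
  rw [e]; ring

lemma integral_exp_cell {d : ℕ} (hd : 0 < d) (N M q : ℤ) (h : N = M + d * q) :
    ∫ t in Set.Ico 0 (step d),
      Complex.exp (Complex.I * (((N * step d : ℝ) - (M * step d : ℝ)) * t)) =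
        if q = 0 then (step d : ℂ) else 0 := by
  rw [← integral_chr (step d) (step_pos hd) q]
  congr 1 with t
  rw [chr]
  congr 1
  have hs : (step d : ℂ) ≠ 0 := by exact_mod_cast (step_pos hd).ne'
  have h2 : (d : ℂ) * (step d : ℂ) ^ 2 = 2 * Real.pi := by exact_mod_cast mul_step_sq hd
  rw [← h2, h]
  push_cast
  field_simp
  ring

/-- The line is the disjoint union of the translates of `[0, L)`. -/
lemma hasSum_integral_translates (L : ℝ) (hL : 0 < L) {F : ℝ → ℂ} (hF : Integrable F) :
    HasSum (fun N : ℤ => ∫ s in Set.Ico 0 L, F (N * L + s)) (∫ y, F y) := by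
  have h := hasSum_integral_iUnion (μ := volume) (f := F)
    (s := fun n : ℤ => Set.Ico (n • L) ((n + 1) • L)) (fun _ => measurableSet_Ico)
    (Set.pairwise_disjoint_Ico_zsmul L) hF.integrableOn
  rw [iUnion_Ico_zsmul hL, Measure.restrict_univ] at h
  refine h.congr_fun fun N => ?_
  have hp : (fun s : ℝ => (N * L : ℝ) + s) ⁻¹' (Set.Ico (N • L) ((N + 1) • L)) = Set.Ico 0 L := by
    ext s
    simp only [Set.mem_preimage, Set.mem_Ico, zsmul_eq_mul, Int.cast_add, Int.cast_one, add_mul,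
      one_mul, le_add_iff_nonneg_right, add_lt_add_iff_left]
  rw [← hp]
  exact (measurePreserving_add_left volume (N * L : ℝ)).setIntegral_preimage_emb
    (MeasurableEquiv.addLeft (N * L : ℝ)).measurableEmbedding F _

lemma integrable_conj_mul (φ ψ : Hilb) : Integrable fun y => conj (φ y) * ψ y := by
  refine (L2.integrable_inner φ ψ).congr (Eventually.of_forall fun y => ?_)
  simp only [RCLike.inner_apply]; ring

lemma inner_eq_integral {α : Type*} [MeasurableSpace α] {μ : Measure α} (f g : Lp ℂ 2 μ) :
    (inner ℂ f g : ℂ) = ∫ a, conj (f a) * g a ∂μ := by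
  rw [L2.inner_def]
  congr 1 with a
  rw [RCLike.inner_apply, mul_comm]

lemma inner_dispVal_self {d : ℕ} (hd : 0 < d) (N : ℤ) (φ ψ : Hilb) :
    (inner ℂ (dispVal d (N * step d) φ) (dispVal d (N * step d) ψ) : ℂ) =
      step d * ∫ s in Set.Ico 0 (step d), conj (φ (N * step d + s)) * ψ (N * step d + s) := by
  rw [inner_dispVal, integral_exp_cell hd N N 0 (by simp), if_pos rfl, mul_comm]

lemma inner_dispVal_of_ne {d : ℕ} (hd : 0 < d) (N n m : ℤ) (h : n ≠ m) (φ ψ : Hilb) :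
    (inner ℂ (dispVal d ((N + d * n : ℤ) * step d) φ)
      (dispVal d ((N + d * m : ℤ) * step d) ψ) : ℂ) = 0 := by
  rw [inner_dispVal, integral_exp_cell hd _ _ (n - m) (by ring), if_neg (sub_ne_zero.2 h), mul_zero]

lemma injective_add_mul {d : ℕ} (hd : 0 < d) (N : ℤ) :
    Function.Injective fun n : ℤ => N + d * n := by
  intro a b h
  have : (d : ℤ) ≠ 0 := by exact_mod_cast hd.ne'
  exact mul_left_cancel₀ this (add_left_cancel h)

lemma summable_dispVal {d : ℕ} (hd : 0 < d) (N : ℤ) (φ : Hilb) :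
    Summable fun n : ℤ => dispVal d ((N + d * n : ℤ) * step d) φ := by
  refine summable_of_orthogonal _ (fun n m h => inner_dispVal_of_ne hd N n m h φ φ) ?_
  have h1 := (hasSum_integral_translates (step d) (step_pos hd) (integrable_conj_mul φ φ)).summable
  have h2 := ((h1.comp_injective (injective_add_mul hd N)).mul_left (step d : ℂ)).norm
  refine h2.congr fun n => ?_
  rw [Function.comp, ← inner_dispVal_self hd, inner_self_eq_norm_sq_to_K]
  simp

section
variable {d : ℕ} [NeZero d]

/-- The overlap `⟨J̄|D(s, t)†|φ⟩`, with the codewords labelled by residues. -/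
def ov (J : ZMod d) (φ : Hilb) : CellHilb d := overlap d ⟨J.val, ZMod.val_lt J⟩ φ

lemma pos_of_neZero : 0 < d := Nat.pos_of_ne_zero (NeZero.ne d)

lemma hasSum_ov (N : ℤ) (φ : Hilb) :
    HasSum (fun n : ℤ => ((1 / Real.sqrt (step d) : ℝ) : ℂ) •
      dispVal d ((N + d * n : ℤ) * step d) φ) (ov (N : ZMod d) φ) := by
  have h : ov (N : ZMod d) φ = ((1 / Real.sqrt (step d) : ℝ) : ℂ) •
      ∑' n : ℤ, dispVal d (((N : ZMod d).val : ℕ) * step d + d * step d * n) φ := rfl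
  have h2 : ∀ n : ℤ, dispVal d (((N : ZMod d).val : ℕ) * step d + d * step d * n) φ =
      dispVal d ((N + d * (n - N / d) : ℤ) * step d) φ := by
    intro n
    congr 1
    have h3 : (((N : ZMod d).val : ℕ) : ℤ) = N - d * (N / d) := by
      rw [ZMod.val_intCast, Int.emod_def]
    have h4 : (((N : ZMod d).val : ℕ) : ℝ) = N - d * ((N / d : ℤ) : ℝ) := by exact_mod_cast h3
    rw [h4]; push_cast; ring
  rw [h]
  simp only [h2]
  have h3 := (Equiv.subRight (N / (d : ℤ))).tsum_eq
    (fun n : ℤ => dispVal d ((N + d * n : ℤ) * step d) φ)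
  simp only [Equiv.subRight_apply] at h3
  rw [h3]
  exact (summable_dispVal pos_of_neZero N φ).hasSum.const_smul _

lemma ov_add (J : ZMod d) (φ ψ : Hilb) : ov J (φ + ψ) = ov J φ + ov J ψ := by
  obtain ⟨N, rfl⟩ := ZMod.intCast_surjective J
  refine (hasSum_ov N (φ + ψ)).unique (((hasSum_ov N φ).add (hasSum_ov N ψ)).congr_fun fun n => ?_)
  rw [dispVal_add, smul_add]

lemma ov_smul (J : ZMod d) (c : ℂ) (φ : Hilb) : ov J (c • φ) = c • ov J φ := by
  obtain ⟨N, rfl⟩ := ZMod.intCast_surjective J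
  refine (hasSum_ov N (c • φ)).unique (((hasSum_ov N φ).const_smul c).congr_fun fun n => ?_)
  rw [dispVal_smul, smul_comm]

lemma hasSum_inner_ov (N : ℤ) (φ ψ : Hilb) :
    HasSum (fun n : ℤ => ∫ s in Set.Ico 0 (step d),
      conj (φ ((N + d * n : ℤ) * step d + s)) * ψ ((N + d * n : ℤ) * step d + s))
      (inner ℂ (ov (N : ZMod d) φ) (ov (N : ZMod d) ψ)) := by
  set c : ℂ := ((1 / Real.sqrt (step d) : ℝ) : ℂ)
  have hd : 0 < d := pos_of_neZero
  have hs := step_pos hd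
  have hc : conj c * c * step d = 1 := by
    rw [Complex.conj_ofReal, ← Complex.ofReal_mul, ← Complex.ofReal_mul, ← Complex.ofReal_one]
    congr 1
    rw [div_mul_div_comm, Real.mul_self_sqrt hs.le]
    field_simp
  have h1 : ∀ n : ℤ,
      (inner ℂ (c • dispVal d ((N + d * n : ℤ) * step d) φ) (ov (N : ZMod d) ψ) : ℂ) =
      ∫ s in Set.Ico 0 (step d),
        conj (φ ((N + d * n : ℤ) * step d + s)) * ψ ((N + d * n : ℤ) * step d + s) := by
    intro n
    refine ((hasSum_ov N ψ).mapL (innerSL ℂ (c • dispVal d ((N + d * n : ℤ) * step d) φ))).unique ?_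
    have h2 := hasSum_single (f := fun m : ℤ => innerSL ℂ
      (c • dispVal d ((N + d * n : ℤ) * step d) φ) (c • dispVal d ((N + d * m : ℤ) * step d) ψ)) n
      fun m hm => by
        rw [innerSL_apply_apply, inner_smul_left, inner_smul_right,
          inner_dispVal_of_ne hd N n m hm.symm, mul_zero, mul_zero]
    rw [innerSL_apply_apply, inner_smul_left, inner_smul_right, inner_dispVal_self hd,
      ← mul_assoc, ← mul_assoc, hc, one_mul] at h2
    exact h2
  have h3 := ((hasSum_ov N φ).mapL (innerSL ℂ (ov (N : ZMod d) ψ))).star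
  simp only [innerSL_apply_apply, RCLike.star_def, inner_conj_symm] at h3
  exact h3.congr_fun fun n => (h1 n).symm

/-- Division with remainder. -/
def residueEquiv (d : ℕ) [NeZero d] : ZMod d × ℤ ≃ ℤ where
  toFun k := k.1.val + d * k.2
  invFun N := ((N : ZMod d), N / d)
  left_inv k := by
    have hd : (d : ℤ) ≠ 0 := by exact_mod_cast NeZero.ne d
    ext1
    · simp
    · have h1 : (k.1.val : ℤ) / d = 0 :=
        Int.ediv_eq_zero_of_lt (by positivity) (by exact_mod_cast ZMod.val_lt k.1)
      simp only
      rw [Int.add_mul_ediv_left _ _ hd, h1, zero_add]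
  right_inv N := by
    simp only
    rw [ZMod.val_intCast]
    exact Int.emod_add_mul_ediv N d

/-- The Zak transform is an isometry. -/
lemma sum_inner_ov (φ ψ : Hilb) :
    ∑ J : ZMod d, (inner ℂ (ov J φ) (ov J ψ) : ℂ) = inner ℂ φ ψ := by
  have h := hasSum_integral_translates (step d) (step_pos pos_of_neZero) (integrable_conj_mul φ ψ)
  rw [← inner_eq_integral, ← (residueEquiv d).hasSum_iff] at h
  refine (hasSum_fintype _).unique (h.prod_fiberwise fun J => ?_)
  have h2 := hasSum_inner_ov (d := d) (J.val : ℤ) φ ψ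
  rw [Int.cast_natCast, ZMod.natCast_rightInverse] at h2
  exact h2

lemma norm_ov_le (J : ZMod d) (φ : Hilb) : ‖ov J φ‖ ≤ ‖φ‖ := by
  have h := congrArg Complex.re (sum_inner_ov (d := d) φ φ)
  rw [Complex.re_sum] at h
  have h1 : ∀ K : ZMod d, ((inner ℂ (ov K φ) (ov K φ) : ℂ)).re = ‖ov K φ‖ ^ 2 := fun K => by
    rw [inner_self_eq_norm_sq_to_K]; norm_cast
  have h2 : ((inner ℂ φ φ : ℂ)).re = ‖φ‖ ^ 2 := by
    rw [inner_self_eq_norm_sq_to_K]; norm_cast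
  simp only [h1, h2] at h
  refine pow_le_pow_iff_left₀ (norm_nonneg _) (norm_nonneg _) two_ne_zero |>.1 ?_
  rw [← h]
  exact Finset.single_le_sum (f := fun K => ‖ov K φ‖ ^ 2) (fun _ _ => by positivity)
    (Finset.mem_univ J)

/-- `φ ↦ ⟨J̄|D(s, t)†|φ⟩` as a bounded operator. -/
def ovL (J : ZMod d) : Hilb →L[ℂ] CellHilb d :=
  LinearMap.mkContinuous { toFun := ov J, map_add' := ov_add J, map_smul' := ov_smul J } 1
    fun φ => by rw [one_mul]; exact norm_ov_le J φ

lemma ovL_apply (J : ZMod d) (φ : Hilb) : ovL J φ = ov J φ := rfl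

end

/-- Multiplication by a bounded function, as an operator on `L²`. -/
def mulOp {α : Type*} [MeasurableSpace α] {μ : Measure α} {χ : α → ℂ} (hχ : MemLp χ ∞ μ) :
    Lp ℂ 2 μ →L[ℂ] Lp ℂ 2 μ :=
  (ContinuousLinearMap.mul ℂ ℂ).holderL μ ∞ 2 2 (hχ.toLp χ)

lemma coeFn_mulOp {α : Type*} [MeasurableSpace α] {μ : Measure α} {χ : α → ℂ} (hχ : MemLp χ ∞ μ)
    (f : Lp ℂ 2 μ) : mulOp hχ f =ᵐ[μ] fun z => χ z * f z := by
  have h := (ContinuousLinearMap.mul ℂ ℂ).coeFn_holder (r := 2) (hχ.toLp χ) f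
  filter_upwards [h, hχ.coeFn_toLp] with z h1 h2
  rw [← h2]
  exact h1

lemma Continuous.memLp_top_of_norm_eq_one {α : Type*} [TopologicalSpace α] [MeasurableSpace α]
    [OpensMeasurableSpace α] [SecondCountableTopology α]
    {μ : Measure α} {χ : α → ℂ} (hc : Continuous χ) (h : ∀ z, ‖χ z‖ = 1) : MemLp χ ∞ μ :=
  memLp_top_of_bound hc.aestronglyMeasurable 1 (Eventually.of_forall fun z => (h z).le)

section
variable {d : ℕ} [NeZero d]

/-- The phase by which `D(nℓ, mℓ)` acts on the `J`-th codeword of the displaced code at `(s, t)`. -/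
def weylPhase (m n : ℤ) (J : ZMod d) (z : ℝ × ℝ) : ℂ :=
  chr₂ (d * step d) m (-n) z *
    (ZMod.stdAddChar ((m : ZMod d) * J) * Complex.exp (-(Complex.I * (n * m * step d ^ 2 / 2))))

lemma norm_stdAddChar (a : ZMod d) : ‖ZMod.stdAddChar a‖ = 1 := by
  rw [ZMod.stdAddChar_apply, Circle.norm_coe]

lemma norm_weylPhase (m n : ℤ) (J : ZMod d) (z : ℝ × ℝ) : ‖weylPhase m n J z‖ = 1 := by
  rw [weylPhase, norm_mul, norm_mul, norm_chr₂, norm_stdAddChar]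
  have : -(Complex.I * (n * m * (step d : ℂ) ^ 2 / 2)) =
    Complex.I * ((-(n * m * step d ^ 2 / 2) : ℝ) : ℂ) := by push_cast; ring
  rw [this, norm_exp_I_mul, one_mul, one_mul]

lemma memLp_weylPhase (m n : ℤ) (J : ZMod d) :
    MemLp (weylPhase m n J) ∞ (cellMeasure (step d)) := by
  refine Continuous.memLp_top_of_norm_eq_one ?_ (norm_weylPhase m n J)
  unfold weylPhase
  fun_prop

lemma exp_eq_stdAddChar (k : ℤ) :
    Complex.exp (Complex.I * (k * step d ^ 2)) = ZMod.stdAddChar (k : ZMod d) := by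
  rw [ZMod.stdAddChar_coe]
  congr 1
  have hd0 : (d : ℂ) ≠ 0 := by exact_mod_cast NeZero.ne d
  have h2 : (d : ℂ) * (step d : ℂ) ^ 2 = 2 * Real.pi := by
    exact_mod_cast mul_step_sq (pos_of_neZero (d := d))
  rw [← h2]; field_simp

lemma chr_mul_step (n : ℤ) (t : ℝ) :
    chr (d * step d) n t = Complex.exp (Complex.I * (n * step d * t)) := by
  rw [chr]
  congr 1
  have hd0 : (d : ℂ) ≠ 0 := by exact_mod_cast NeZero.ne d
  have hs : (step d : ℂ) ≠ 0 := by exact_mod_cast (step_pos (pos_of_neZero (d := d))).ne'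
  have h2 : (d : ℂ) * (step d : ℂ) ^ 2 = 2 * Real.pi := by
    exact_mod_cast mul_step_sq (pos_of_neZero (d := d))
  rw [← h2]
  push_cast
  field_simp

lemma weylPhase_eq (m n N : ℤ) (z : ℝ × ℝ) :
    weylPhase m n (N : ZMod d) z = Complex.exp (Complex.I * (step d * (m * z.1 - n * z.2) +
      m * N * step d ^ 2 - n * m * step d ^ 2 / 2)) := by
  rw [weylPhase, chr₂, chr_mul_step, chr_mul_step]
  have h := exp_eq_stdAddChar (d := d) (m * N)
  rw [Int.cast_mul, Int.cast_mul] at h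
  rw [← h, ← Complex.exp_add, ← Complex.exp_add, ← Complex.exp_add]
  congr 1
  push_cast
  ring

lemma dispVal_disp (m n N : ℤ) (φ : Hilb) :
    dispVal d (N * step d) (disp (n * step d) (m * step d) φ) =
      mulOp (memLp_weylPhase m n (N : ZMod d)) (dispVal d ((N - n : ℤ) * step d) φ) := by
  refine Lp.ext ?_
  filter_upwards [coeFn_dispVal d (N * step d) (disp (n * step d) (m * step d) φ),
    coeFn_mulOp (memLp_weylPhase m n (N : ZMod d)) (dispVal d ((N - n : ℤ) * step d) φ),
    coeFn_dispVal d ((N - n : ℤ) * step d) φ,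
    ae_cellMeasure_of_ae (coeFn_disp (n * step d) (m * step d) φ) (step d) (N * step d)]
    with z h1 h2 h3 h4
  rw [h1, h2, h3, dispAdjAt, dispAdjAt, h4, weylPhase_eq, ← mul_assoc, ← mul_assoc,
    ← Complex.exp_add, ← Complex.exp_add]
  have e : (N * step d + z.1 - n * step d : ℝ) = (N - n : ℤ) * step d + z.1 := by push_cast; ring
  rw [e]
  congr 2
  push_cast
  ring

/-- The lattice displacements permute the codewords up to phases. -/
lemma ov_disp_eq (m n : ℤ) (J : ZMod d) (φ : Hilb) :
    ov J (disp (n * step d) (m * step d) φ) =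
      mulOp (memLp_weylPhase m n J) (ov (J - (n : ZMod d)) φ) := by
  obtain ⟨N, rfl⟩ := ZMod.intCast_surjective J
  refine (hasSum_ov N _).unique ?_
  have h := (hasSum_ov (d := d) (N - n) φ).mapL (mulOp (memLp_weylPhase m n (N : ZMod d)))
  rw [Int.cast_sub] at h
  refine h.congr_fun fun k => ?_
  have e1 : ((N + d * k : ℤ) : ZMod d) = (N : ZMod d) := by simp
  have e2 : N + d * k - n = N - n + d * k := by ring
  have e3 := dispVal_disp (d := d) m n (N + d * k) φ
  rw [e2] at e3
  simp only [e1] at e3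
  rw [e3, map_smul]

lemma ov_disp (m n : ℤ) (J : ZMod d) (φ : Hilb) :
    ov J (disp (n * step d) (m * step d) φ) =ᵐ[cellMeasure (step d)]
      fun z => weylPhase m n J z * ov (J - (n : ZMod d)) φ z := by
  rw [ov_disp_eq]
  exact coeFn_mulOp _ _

end

/-! ### Code matrices -/

lemma ae_summable_of_summable_integral_norm {α : Type*} [MeasurableSpace α] {μ : Measure α}
    {F : ℕ → α → ℂ} (hi : ∀ i, Integrable (F i) μ) (hs : Summable fun i => ∫ a, ‖F i a‖ ∂μ) :
    (∀ᵐ a ∂μ, Summable fun i => F i a) ∧ Integrable (fun a => ∑' i, F i a) μ := by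
  have hn : ∀ i, ‖(hi i).toL1 (F i)‖ = ∫ a, ‖F i a‖ ∂μ := fun i => by
    rw [L1.norm_eq_integral_norm]
    refine integral_congr_ae ?_
    filter_upwards [(hi i).coeFn_toL1] with a ha
    rw [ha]
  have h1 : ∑' i, ‖(hi i).toL1 (F i)‖ₑ ≠ ∞ := by
    rw [tsum_enorm_ne_top_iff_summable_norm]
    simpa only [hn] using hs
  have h2 := Lp.hasSum_coeFn_tsum h1
  have h3 : ∀ᵐ a ∂μ, ∀ i, (hi i).toL1 (F i) a = F i a :=
    ae_all_iff.2 fun i => (hi i).coeFn_toL1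
  constructor
  · filter_upwards [h2, h3] with a h2 h3
    simp only [h3] at h2
    exact h2.summable
  · refine (L1.integrable_coeFn (∑' i, (hi i).toL1 (F i))).congr ?_
    filter_upwards [h2, h3] with a h2 h3
    simp only [h3] at h2
    exact h2.tsum_eq.symm

section
variable {α : Type*} [MeasurableSpace α] {μ : Measure α}

lemma integrable_mul_conj (f g : Lp ℂ 2 μ) : Integrable (fun z => f z * conj (g z)) μ := by
  refine (L2.integrable_inner g f).congr (Eventually.of_forall fun z => ?_)
  simp only [RCLike.inner_apply]

lemma integral_norm_mul_conj_le (f g : Lp ℂ 2 μ) :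
    ∫ z, ‖f z * conj (g z)‖ ∂μ ≤ ‖f‖ * ‖g‖ := by
  have h := (ContinuousLinearMap.mul ℂ ℂ).norm_holder_apply_apply_le (r := 1) f (star g)
  have h1 : ‖(ContinuousLinearMap.mul ℂ ℂ)‖ ≤ 1 := ContinuousLinearMap.opNorm_mul_le ℂ ℂ
  have h2 : ‖star g‖ = ‖g‖ := by
    rw [Lp.norm_def, Lp.norm_def]
    refine congrArg _ (eLpNorm_congr_norm_ae ?_)
    filter_upwards [Lp.coeFn_star g] with z hz
    rw [hz, Pi.star_apply, norm_star]
  rw [L1.norm_eq_integral_norm, h2] at h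
  calc ∫ z, ‖f z * conj (g z)‖ ∂μ
      = ∫ z, ‖(ContinuousLinearMap.mul ℂ ℂ).holder 1 f (star g) z‖ ∂μ := by
        refine integral_congr_ae ?_
        filter_upwards [(ContinuousLinearMap.mul ℂ ℂ).coeFn_holder (r := 1) f (star g),
          Lp.coeFn_star g] with z h1 h2
        rw [h1, h2]; rfl
    _ ≤ _ := h
    _ ≤ 1 * ‖f‖ * ‖g‖ := by gcongr
    _ = ‖f‖ * ‖g‖ := by rw [one_mul]

end

lemma memLp_one_cell {d : ℕ} : MemLp (fun _ => (1 : ℂ)) ∞ (cellMeasure (step d)) := memLp_const 1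

section
variable {d : ℕ} [NeZero d]

/-- The matrix entry `∑ i, ⟨J̄|D(s, t)†|φ i⟩ ⟨ψ i|D(s, t)|K̄⟩` at `z = (s, t)`. -/
def repEntry (φ ψ : ℕ → Hilb) (J K : ZMod d) (z : ℝ × ℝ) : ℂ :=
  ∑' i : ℕ, ov J (φ i) z * conj (ov K (ψ i) z)

lemma summable_integral_norm_ov {φ ψ : ℕ → Hilb} (h : Summable fun i => ‖φ i‖ * ‖ψ i‖)
    (J K : ZMod d) :
    Summable fun i => ∫ z, ‖ov J (φ i) z * conj (ov K (ψ i) z)‖ ∂(cellMeasure (step d)) := by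
  refine Summable.of_nonneg_of_le (fun i => integral_nonneg fun _ => norm_nonneg _) (fun _ => ?_) h
  refine (integral_norm_mul_conj_le _ _).trans ?_
  exact mul_le_mul (norm_ov_le _ _) (norm_ov_le _ _) (norm_nonneg _) (norm_nonneg _)

lemma ae_hasSum_repEntry {φ ψ : ℕ → Hilb} (h : Summable fun i => ‖φ i‖ * ‖ψ i‖) (J K : ZMod d) :
    ∀ᵐ z ∂(cellMeasure (step d)),
      HasSum (fun i => ov J (φ i) z * conj (ov K (ψ i) z)) (repEntry φ ψ J K z) := by
  filter_upwards [(ae_summable_of_summable_integral_norm (fun _ => integrable_mul_conj _ _)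
    (summable_integral_norm_ov h J K)).1] with z hz
  exact hz.hasSum

lemma integrable_repEntry {φ ψ : ℕ → Hilb} (h : Summable fun i => ‖φ i‖ * ‖ψ i‖) (J K : ZMod d) :
    Integrable (repEntry φ ψ J K) (cellMeasure (step d)) :=
  (ae_summable_of_summable_integral_norm (fun _ => integrable_mul_conj _ _)
    (summable_integral_norm_ov h J K)).2

lemma Integrable.bdd_mul_top {α : Type*} [MeasurableSpace α] {μ : Measure α} {f χ : α → ℂ}
    (hf : Integrable f μ) (hχ : MemLp χ ∞ μ) : Integrable (fun z => χ z * f z) μ := by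
  have := (memLp_one_iff_integrable.2 hf).mul' (p := ∞) (r := 1) hχ
  exact memLp_one_iff_integrable.1 this

lemma MemLp.exists_ae_bound {α : Type*} [MeasurableSpace α] {μ : Measure α} {χ : α → ℂ}
    (hχ : MemLp χ ∞ μ) : ∃ C : ℝ, ∀ᵐ z ∂μ, ‖χ z‖ ≤ C := by
  refine ⟨(eLpNormEssSup χ μ).toReal, ?_⟩
  have h : eLpNormEssSup χ μ ≠ ∞ := by simpa only [eLpNorm_exponent_top] using hχ.2.ne
  filter_upwards [ae_le_eLpNormEssSup (f := χ) (μ := μ)] with z hz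
  rw [← toReal_enorm]
  exact ENNReal.toReal_mono h hz

lemma hasSum_integral_mul_repEntry {φ ψ : ℕ → Hilb} (h : Summable fun i => ‖φ i‖ * ‖ψ i‖)
    (J K : ZMod d) {χ : ℝ × ℝ → ℂ} (hχ : MemLp χ ∞ (cellMeasure (step d))) :
    HasSum (fun i => ∫ z, χ z * (ov J (φ i) z * conj (ov K (ψ i) z)) ∂(cellMeasure (step d)))
      (∫ z, χ z * repEntry φ ψ J K z ∂(cellMeasure (step d))) := by
  obtain ⟨C, hC⟩ := MemLp.exists_ae_bound hχ
  have hi : ∀ i, Integrable (fun z => χ z * (ov J (φ i) z * conj (ov K (ψ i) z)))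
      (cellMeasure (step d)) := fun i => Integrable.bdd_mul_top (integrable_mul_conj _ _) hχ
  have h1 := hasSum_integral_of_summable_integral_norm hi (by
    refine Summable.of_nonneg_of_le (fun i => integral_nonneg fun _ => norm_nonneg _) (fun i => ?_)
      ((summable_integral_norm_ov h J K).mul_left C)
    rw [← integral_const_mul]
    refine integral_mono_ae (hi i).norm ((integrable_mul_conj _ _).norm.const_mul C) ?_
    filter_upwards [hC] with z hz
    rw [norm_mul]
    exact mul_le_mul_of_nonneg_right hz (norm_nonneg _))
  simp only [tsum_mul_left] at h1
  exact h1

/-- The operator on `L²(ℝ)` which in the Zak picture sends the `K`-th component to the `J`-th and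
multiplies it by `χ`. -/
def entryOp {χ : ℝ × ℝ → ℂ} (hχ : MemLp χ ∞ (cellMeasure (step d))) (J K : ZMod d) :
    Hilb →L[ℂ] Hilb := (ovL J)† ∘L mulOp hχ ∘L ovL K

lemma inner_entryOp {χ : ℝ × ℝ → ℂ} (hχ : MemLp χ ∞ (cellMeasure (step d))) (J K : ZMod d)
    (φ ψ : Hilb) : (inner ℂ ψ (entryOp hχ J K φ) : ℂ) =
      ∫ z, conj (ov J ψ z) * (χ z * ov K φ z) ∂(cellMeasure (step d)) := by
  have h : entryOp hχ J K φ = ((ovL J)†) (mulOp hχ (ov K φ)) := rfl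
  rw [h, ContinuousLinearMap.adjoint_inner_right, ovL_apply, inner_eq_integral]
  refine integral_congr_ae ?_
  filter_upwards [coeFn_mulOp hχ (ov K φ)] with z hz
  rw [hz]

lemma trace_entryOp_rep {A : Hilb →L[ℂ] Hilb} {φ ψ : ℕ → Hilb} (h : IsNuclearRep A φ ψ)
    {χ : ℝ × ℝ → ℂ} (hχ : MemLp χ ∞ (cellMeasure (step d))) (J K : ZMod d) :
    trace (entryOp hχ J K ∘L A) = ∫ z, χ z * repEntry φ ψ K J z ∂(cellMeasure (step d)) := by
  refine (h.hasSum_trace (entryOp hχ J K)).unique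
    ((hasSum_integral_mul_repEntry h.1 K J hχ).congr_fun fun i => ?_)
  rw [inner_entryOp]
  congr 1 with z
  ring

lemma repEntry_congr {A : Hilb →L[ℂ] Hilb} {φ ψ φ' ψ' : ℕ → Hilb} (h : IsNuclearRep A φ ψ)
    (h' : IsNuclearRep A φ' ψ') (J K : ZMod d) :
    repEntry φ ψ J K =ᵐ[cellMeasure (step d)] repEntry φ' ψ' J K := by
  refine Integrable.ae_eq_of_forall_setIntegral_eq _ _ (integrable_repEntry h.1 J K)
    (integrable_repEntry h'.1 J K) fun s hs _ => ?_
  have hχ : MemLp (s.indicator fun _ => (1 : ℂ)) ∞ (cellMeasure (step d)) :=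
    memLp_indicator_const ∞ hs 1 (Or.inr (measure_ne_top _ _))
  have h1 := (trace_entryOp_rep h hχ K J).symm.trans (trace_entryOp_rep h' hχ K J)
  have e : ∀ f : ℝ × ℝ → ℂ, ∫ z, (s.indicator fun _ => (1 : ℂ)) z * f z ∂(cellMeasure (step d)) =
      ∫ z in s, f z ∂(cellMeasure (step d)) := by
    intro f
    rw [← integral_indicator hs]
    congr 1 with z
    by_cases hz : z ∈ s <;> simp [hz]
  rwa [e, e] at h1

/-- The code matrix with entries labelled by residues. -/
def cm (d : ℕ) [NeZero d] (A : Hilb →L[ℂ] Hilb) (z : ℝ × ℝ) : Matrix (ZMod d) (ZMod d) ℂ :=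
  fun J K => codeMatrix d A z ⟨J.val, ZMod.val_lt J⟩ ⟨K.val, ZMod.val_lt K⟩

lemma cm_eq_repEntry {A : Hilb →L[ℂ] Hilb} (h : IsTraceClass A) (J K : ZMod d) (z : ℝ × ℝ) :
    cm d A z J K = repEntry h.choose h.choose_spec.choose J K z := by
  rw [cm, codeMatrix, dif_pos h]; rfl

lemma cm_ae_eq {A : Hilb →L[ℂ] Hilb} {φ ψ : ℕ → Hilb} (h : IsNuclearRep A φ ψ) (J K : ZMod d) :
    (fun z => cm d A z J K) =ᵐ[cellMeasure (step d)] repEntry φ ψ J K := by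
  have hA : IsTraceClass A := ⟨φ, ψ, h⟩
  refine EventuallyEq.trans (Eventually.of_forall fun z => cm_eq_repEntry hA J K z)
    (repEntry_congr hA.choose_spec.choose_spec h J K)

lemma integrable_cm {A : Hilb →L[ℂ] Hilb} (h : IsTraceClass A) (J K : ZMod d) :
    Integrable (fun z => cm d A z J K) (cellMeasure (step d)) := by
  obtain ⟨φ, ψ, h⟩ := h
  exact (integrable_repEntry h.1 J K).congr (cm_ae_eq h J K).symm

lemma trace_entryOp {A : Hilb →L[ℂ] Hilb} (h : IsTraceClass A)
    {χ : ℝ × ℝ → ℂ} (hχ : MemLp χ ∞ (cellMeasure (step d))) (J K : ZMod d) :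
    trace (entryOp hχ J K ∘L A) = ∫ z, χ z * cm d A z K J ∂(cellMeasure (step d)) := by
  obtain ⟨φ, ψ, h⟩ := h
  rw [trace_entryOp_rep h]
  refine integral_congr_ae ?_
  filter_upwards [cm_ae_eq h K J] with z hz
  rw [hz]

lemma finCast_val (j : Fin d) : (⟨((j : ℕ) : ZMod d).val, ZMod.val_lt _⟩ : Fin d) = j := by
  ext; exact ZMod.val_cast_of_lt j.2

/-- The two labellings of the codewords. -/
def finEquivZMod (d : ℕ) [NeZero d] : ZMod d ≃ Fin d where
  toFun J := ⟨J.val, ZMod.val_lt J⟩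
  invFun j := ((j : ℕ) : ZMod d)
  left_inv J := ZMod.natCast_rightInverse J
  right_inv j := finCast_val j

lemma ov_natCast (j : Fin d) (φ : Hilb) : ov ((j : ℕ) : ZMod d) φ = overlap d j φ := by
  rw [ov, finCast_val]

lemma cm_natCast (A : Hilb →L[ℂ] Hilb) (z : ℝ × ℝ) (j k : Fin d) :
    cm d A z ((j : ℕ) : ZMod d) ((k : ℕ) : ZMod d) = codeMatrix d A z j k := by
  rw [cm, finCast_val, finCast_val]

lemma ae_hasSum_codeMatrix {A : Hilb →L[ℂ] Hilb} {φ ψ : ℕ → Hilb} (h : IsNuclearRep A φ ψ) :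
    ∀ᵐ z ∂(cellMeasure (step d)), ∀ j k : Fin d,
      HasSum (fun i => overlap d j (φ i) z * conj (overlap d k (ψ i) z))
        (codeMatrix d A z j k) := by
  refine ae_all_iff.2 fun j => ae_all_iff.2 fun k => ?_
  filter_upwards [ae_hasSum_repEntry h.1 ((j : ℕ) : ZMod d) ((k : ℕ) : ZMod d),
    cm_ae_eq h ((j : ℕ) : ZMod d) ((k : ℕ) : ZMod d)] with z h1 h2
  rw [← h2, cm_natCast] at h1
  simpa only [ov_natCast] using h1

lemma codePairing_eq (A : Hilb →L[ℂ] Hilb) (f g : Hilb) (z : ℝ × ℝ) :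
    codePairing d A f g z =
      ∑ J : ZMod d, ∑ K : ZMod d, conj (ov J f z) * cm d A z J K * ov K g z := by
  rw [codePairing, ← (finEquivZMod d).sum_comp]
  refine Finset.sum_congr rfl fun J _ => ?_
  rw [← (finEquivZMod d).sum_comp]
  rfl

lemma codeTrace_eq (A B : Hilb →L[ℂ] Hilb) (z : ℝ × ℝ) :
    codeTrace d A B z = ∑ J : ZMod d, ∑ K : ZMod d, cm d A z J K * cm d B z K J := by
  rw [codeTrace, Matrix.trace, ← (finEquivZMod d).sum_comp]
  refine Finset.sum_congr rfl fun J _ => ?_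
  rw [Matrix.diag_apply, Matrix.mul_apply, ← (finEquivZMod d).sum_comp]
  rfl

lemma cm_adjoint {A : Hilb →L[ℂ] Hilb} (h : IsTraceClass A) :
    ∀ᵐ z ∂(cellMeasure (step d)), ∀ J K : ZMod d, cm d (A†) z J K = conj (cm d A z K J) := by
  obtain ⟨φ, ψ, h⟩ := h
  refine ae_all_iff.2 fun J => ae_all_iff.2 fun K => ?_
  filter_upwards [cm_ae_eq h.adjoint J K, cm_ae_eq h K J] with z h1 h2
  rw [h1, h2, repEntry, repEntry, Complex.conj_tsum]
  congr 1 with i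
  rw [map_mul, Complex.conj_conj, mul_comm]

lemma sum_entryOp_one :
    ∑ J : ZMod d, entryOp (memLp_one_cell (d := d)) J J = ContinuousLinearMap.id ℂ Hilb := by
  ext1 φ
  refine ext_inner_left ℂ fun ψ => ?_
  rw [sum_apply, inner_sum, ContinuousLinearMap.id_apply,
    ← sum_inner_ov (d := d)]
  refine Finset.sum_congr rfl fun J _ => ?_
  rw [inner_entryOp, inner_eq_integral]
  simp only [one_mul]

lemma sum_entryOp_weyl (m n : ℤ) :
    ∑ J : ZMod d, entryOp (memLp_weylPhase m n J) J (J - (n : ZMod d)) =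
      disp (n * step d) (m * step d) := by
  ext1 φ
  refine ext_inner_left ℂ fun ψ => ?_
  rw [sum_apply, inner_sum, ← sum_inner_ov (d := d)]
  refine Finset.sum_congr rfl fun J _ => ?_
  rw [inner_entryOp, inner_eq_integral]
  refine integral_congr_ae ?_
  filter_upwards [ov_disp m n J φ] with z hz
  rw [hz]

lemma trace_eq_integral {A : Hilb →L[ℂ] Hilb} (h : IsTraceClass A) :
    trace A = ∑ J : ZMod d, ∫ z, cm d A z J J ∂(cellMeasure (step d)) := by
  have h1 := h.trace_sum Finset.univ fun J : ZMod d => entryOp (memLp_one_cell (d := d)) J J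
  rw [sum_entryOp_one, ContinuousLinearMap.id_comp] at h1
  rw [h1]
  refine Finset.sum_congr rfl fun J _ => ?_
  rw [trace_entryOp h]
  simp only [one_mul]

lemma trace_disp_eq_integral {A : Hilb →L[ℂ] Hilb} (h : IsTraceClass A) (m n : ℤ) :
    trace (disp (n * step d) (m * step d) ∘L A) =
      ∑ J : ZMod d, ∫ z, weylPhase m n J z * cm d A z (J - (n : ZMod d)) J
        ∂(cellMeasure (step d)) := by
  rw [← sum_entryOp_weyl, h.trace_sum]
  exact Finset.sum_congr rfl fun J _ => trace_entryOp h _ _ _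

/-- The rank-one operator `|g⟩⟨f|`. -/
def ketbra (g f : Hilb) : Hilb →L[ℂ] Hilb := (innerSL ℂ f).smulRight g

lemma isNuclearRep_ketbra (g f : Hilb) :
    IsNuclearRep (ketbra g f) (fun i => if i = 0 then g else 0)
      (fun i => if i = 0 then f else 0) := by
  refine ⟨summable_of_ne_finset_zero (s := {0}) fun i hi => ?_, fun x => ?_⟩
  · have hi : i ≠ 0 := by simpa using hi
    simp [hi]
  · refine (hasSum_ite_eq 0 (ketbra g f x)).congr_fun fun i => ?_
    by_cases hi : i = 0
    · simp [hi, ketbra]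
    · simp [hi]

lemma isTraceClass_ketbra (g f : Hilb) : IsTraceClass (ketbra g f) :=
  ⟨_, _, isNuclearRep_ketbra g f⟩

lemma cm_ketbra (g f : Hilb) : ∀ᵐ z ∂(cellMeasure (step d)), ∀ J K : ZMod d,
    cm d (ketbra g f) z J K = ov J g z * conj (ov K f z) := by
  refine ae_all_iff.2 fun J => ae_all_iff.2 fun K => ?_
  have h0 : ov J 0 = 0 := (ovL J).map_zero
  filter_upwards [cm_ae_eq (isNuclearRep_ketbra g f) J K,
    Lp.coeFn_zero ℂ 2 (cellMeasure (step d))] with z h1 h2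
  rw [h1, repEntry, tsum_eq_single 0]
  · simp
  · intro i hi
    simp only [if_neg hi, h0]
    rw [h2]; simp

lemma trace_comp_ketbra (T : Hilb →L[ℂ] Hilb) (g f : Hilb) :
    trace (T ∘L ketbra g f) = inner ℂ f (T g) := by
  refine ((isNuclearRep_ketbra g f).hasSum_trace T).unique ?_
  refine (hasSum_ite_eq 0 (inner ℂ f (T g) : ℂ)).congr_fun fun i => ?_
  by_cases hi : i = 0
  · simp [hi]
  · simp [hi]

end

/-! ### The discrete Wigner function in odd dimension -/

section
variable {d : ℕ} [NeZero d]

/-- Gross's discrete Wigner function of a `d × d` matrix at position `a` and momentum `b`,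
normalised so that its sum over `b` is `d` times a diagonal entry. -/
def discreteWigner (X : Matrix (ZMod d) (ZMod d) ℂ) (a b : ZMod d) : ℂ :=
  ∑ k : ZMod d, ZMod.stdAddChar (-(2 * b * k)) * X (a + k) (a - k)

/-- The inverse of `2` modulo `d`, for odd `d`. -/
def half (d : ℕ) : ZMod d := ((d + 1) / 2 : ℕ)

lemma two_mul_half (hd : Odd d) : 2 * half d = 1 := by
  obtain ⟨r, rfl⟩ := hd
  have h : (2 * r + 1 + 1) / 2 = r + 1 := by omega
  rw [half, h]
  have h2 : ((2 * r + 1 : ℕ) : ZMod (2 * r + 1)) = 0 := ZMod.natCast_self _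
  push_cast at h2 ⊢
  linear_combination h2

lemma sum_stdAddChar (x : ZMod d) :
    ∑ b : ZMod d, ZMod.stdAddChar (b * x) = if x = 0 then (d : ℂ) else 0 := by
  rw [AddChar.sum_mulShift x (ZMod.isPrimitive_stdAddChar d), ZMod.card]
  split_ifs <;> simp

lemma sum_stdAddChar_discreteWigner (hd : Odd d) (X : Matrix (ZMod d) (ZMod d) ℂ) (a n : ZMod d) :
    ∑ b : ZMod d, ZMod.stdAddChar (-(n * b)) * discreteWigner X a b =
      d * X (a - n * half d) (a + n * half d) := by
  have h2 := two_mul_half hd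
  simp only [discreteWigner, Finset.mul_sum]
  rw [Finset.sum_comm]
  have h3 : ∀ k : ZMod d, ∑ b : ZMod d, ZMod.stdAddChar (-(n * b)) *
      (ZMod.stdAddChar (-(2 * b * k)) * X (a + k) (a - k)) =
      if k = -(n * half d) then d * X (a - n * half d) (a + n * half d) else 0 := by
    intro k
    have h4 : ∀ b : ZMod d, ZMod.stdAddChar (-(n * b)) *
        (ZMod.stdAddChar (-(2 * b * k)) * X (a + k) (a - k)) =
        ZMod.stdAddChar (b * (-(n + 2 * k))) * X (a + k) (a - k) := by
      intro b
      rw [← mul_assoc, ← AddChar.map_add_eq_mul]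
      congr 2; ring
    simp only [h4, ← Finset.sum_mul, sum_stdAddChar]
    by_cases hk : k = -(n * half d)
    · rw [if_pos hk, if_pos, hk]
      · congr 2 <;> ring
      · rw [hk]; linear_combination n * h2
    · rw [if_neg hk, if_neg, zero_mul]
      intro h5
      refine hk ?_
      linear_combination -(half d) * h5 - k * h2
  simp only [h3, Finset.sum_ite_eq', Finset.mem_univ, if_true]

lemma sum_discreteWigner_mul (hd : Odd d) (X Y : Matrix (ZMod d) (ZMod d) ℂ) :
    ∑ p : ZMod d × ZMod d, discreteWigner X p.1 p.2 * discreteWigner Y p.1 p.2 =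
      d * ∑ J : ZMod d, ∑ K : ZMod d, X J K * Y K J := by
  have h2 := two_mul_half hd
  rw [Fintype.sum_prod_type]
  have h1 : ∀ a : ZMod d, ∑ b : ZMod d, discreteWigner X a b * discreteWigner Y a b =
      d * ∑ k : ZMod d, X (a + k) (a - k) * Y (a - k) (a + k) := by
    intro a
    have e : ∀ b : ZMod d, discreteWigner X a b * discreteWigner Y a b =
        ∑ k : ZMod d,
          X (a + k) (a - k) * (ZMod.stdAddChar (-(2 * k * b)) * discreteWigner Y a b) := by
      intro b
      rw [discreteWigner, Finset.sum_mul]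
      refine Finset.sum_congr rfl fun k _ => ?_
      rw [mul_right_comm 2 b k]; ring
    simp only [e]
    rw [Finset.sum_comm, Finset.mul_sum]
    refine Finset.sum_congr rfl fun k _ => ?_
    rw [← Finset.mul_sum, sum_stdAddChar_discreteWigner hd, mul_right_comm 2 k, h2, one_mul]
    ring
  simp only [h1]
  rw [← Finset.mul_sum]
  congr 1
  rw [← Fintype.sum_prod_type' (f := fun a k : ZMod d => X (a + k) (a - k) * Y (a - k) (a + k)),
    ← Fintype.sum_prod_type' (f := fun J K : ZMod d => X J K * Y K J)]
  let e : ZMod d × ZMod d ≃ ZMod d × ZMod d :=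
    { toFun := fun p => (p.1 + p.2, p.1 - p.2)
      invFun := fun q => ((q.1 + q.2) * half d, (q.1 - q.2) * half d)
      left_inv := fun p => by
        ext1
        · simp only; linear_combination p.1 * h2
        · simp only; linear_combination p.2 * h2
      right_inv := fun q => by
        ext1
        · simp only; linear_combination q.1 * h2
        · simp only; linear_combination q.2 * h2 }
  exact e.sum_comp fun q : ZMod d × ZMod d => X q.1 q.2 * Y q.2 q.1

lemma discreteWigner_inversion (hd : Odd d) (X : Matrix (ZMod d) (ZMod d) ℂ) (J K : ZMod d) :
    d * X J K = ∑ b : ZMod d, ZMod.stdAddChar (-((K - J) * b)) *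
      discreteWigner X ((J + K) * half d) b := by
  have h2 := two_mul_half hd
  rw [sum_stdAddChar_discreteWigner hd]
  congr 2
  · linear_combination -J * h2
  · linear_combination -K * h2

/-- The Fourier transform of the discrete Wigner function: the expectations of the Weyl matrices. -/
lemma sum_stdAddChar_mul_discreteWigner (hd : Odd d) (X : Matrix (ZMod d) (ZMod d) ℂ)
    (m n : ZMod d) :
    ∑ p : ZMod d × ZMod d, ZMod.stdAddChar (m * p.1) * ZMod.stdAddChar (-(n * p.2)) *
      discreteWigner X p.1 p.2 =
      d * ∑ J : ZMod d,
        ZMod.stdAddChar (m * J) * ZMod.stdAddChar (-(m * n * half d)) * X (J - n) J := by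
  have h2 := two_mul_half hd
  rw [Fintype.sum_prod_type]
  simp only [mul_assoc, ← Finset.mul_sum, sum_stdAddChar_discreteWigner hd]
  rw [Finset.mul_sum, ← (Equiv.subRight (n * half d)).sum_comp]
  refine Finset.sum_congr rfl fun a _ => ?_
  simp only [Equiv.subRight_apply]
  have e1 : ZMod.stdAddChar (m * (a - n * half d)) =
      ZMod.stdAddChar (m * a) * ZMod.stdAddChar (-(m * (n * half d))) := by
    rw [← AddChar.map_add_eq_mul]; congr 1; ring
  have e2 : a - n * half d - n * half d = a - n := by linear_combination -n * h2
  have e3 : a - n * half d + n * half d = a := by ring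
  rw [e1, e2, e3]
  ring

end

/-! ### Tiling the torus by cells of displaced codes -/

/-- The lower left corner of the tile with label `p`. -/
def corner {d : ℕ} (p : ZMod d × ZMod d) : ℝ × ℝ := (p.1.val * step d, p.2.val * step d)

lemma measurableEmbedding_add_corner {d : ℕ} (p : ZMod d × ZMod d) :
    MeasurableEmbedding fun z : ℝ × ℝ => z + corner p :=
  (MeasurableEquiv.addRight (corner p)).measurableEmbedding

lemma torusMeasure_ae {d : ℕ} {P : ℝ × ℝ → Prop} :
    (∀ᵐ z ∂(torusMeasure d), P z) ↔ ∀ᵐ z ∂(cellMeasure (d * step d)), P z := by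
  rw [torusMeasure, Measure.ae_ennreal_smul_measure_iff]
  simp

lemma torusMeasure_integral {d : ℕ} (F : ℝ × ℝ → ℂ) :
    ∫ z, F z ∂(torusMeasure d) = (d : ℂ)⁻¹ * ∫ z, F z ∂(cellMeasure (d * step d)) := by
  rw [torusMeasure, integral_smul_measure, ENNReal.toReal_inv, ENNReal.toReal_natCast,
    Complex.real_smul]
  push_cast; rfl

section
variable {d : ℕ} [NeZero d]

lemma restrict_Ico_eq_sum :
    (volume : Measure ℝ).restrict (Set.Ico 0 (d * step d)) = Measure.sum fun a : ZMod d =>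
      (volume.restrict (Set.Ico 0 (step d))).map (fun t => t + a.val * step d) := by
  have hL := step_pos (pos_of_neZero (d := d))
  have h1 : Set.Ico 0 (d * step d) =
      ⋃ a : ZMod d, Set.Ico (a.val * step d) (a.val * step d + step d) := by
    ext t
    simp only [Set.mem_iUnion, Set.mem_Ico]
    constructor
    · rintro ⟨h0, h1⟩
      have h2 : 0 ≤ t / step d := by positivity
      have h3 : ⌊t / step d⌋₊ < d := by
        rw [Nat.floor_lt h2, div_lt_iff₀ hL]; exact h1
      refine ⟨(⌊t / step d⌋₊ : ZMod d), ?_⟩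
      rw [ZMod.val_cast_of_lt h3]
      have h4 := Nat.floor_le h2
      have h5 := Nat.lt_floor_add_one (t / step d)
      rw [le_div_iff₀ hL] at h4
      rw [div_lt_iff₀ hL] at h5
      constructor <;> linarith
    · rintro ⟨a, h0, h1⟩
      have h2 : (a.val : ℝ) + 1 ≤ d := by exact_mod_cast ZMod.val_lt a
      have h3 : ((a.val : ℝ) + 1) * step d ≤ d * step d := by gcongr
      refine ⟨le_trans (by positivity) h0, by linarith⟩
  rw [h1, Measure.restrict_iUnion _ fun _ => measurableSet_Ico]
  · congr 1 with a : 1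
    have hp : (fun t : ℝ => t + a.val * step d) ⁻¹'
        Set.Ico (a.val * step d) (a.val * step d + step d) = Set.Ico 0 (step d) := by
      ext t
      simp only [Set.mem_preimage, Set.mem_Ico]
      constructor <;> rintro ⟨h0, h1⟩ <;> constructor <;> linarith
    have := ((measurePreserving_add_right volume (a.val * step d : ℝ)).restrict_preimage
      (s := Set.Ico (a.val * step d) (a.val * step d + step d)) measurableSet_Ico).map_eq
    rw [hp] at this
    exact this.symm
  · intro a b hab
    refine Set.disjoint_left.2 fun t ha hb => hab (ZMod.val_injective d ?_)
    rw [Set.mem_Ico] at ha hb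
    have e1 : (a.val : ℝ) < b.val + 1 := by
      have : (a.val : ℝ) * step d < (b.val + 1) * step d := by linarith
      exact lt_of_mul_lt_mul_right this hL.le
    have e2 : (b.val : ℝ) < a.val + 1 := by
      have : (b.val : ℝ) * step d < (a.val + 1) * step d := by linarith
      exact lt_of_mul_lt_mul_right this hL.le
    have e3 : a.val < b.val + 1 := by exact_mod_cast e1
    have e4 : b.val < a.val + 1 := by exact_mod_cast e2
    omega

lemma cellMeasure_eq_sum :
    cellMeasure (d * step d) = Measure.sum fun p : ZMod d × ZMod d =>
      (cellMeasure (step d)).map (fun z => z + corner p) := by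
  rw [cellMeasure, restrict_Ico_eq_sum, Measure.prod_sum]
  congr 1 with p : 1
  rw [Measure.map_prod_map _ _ (by fun_prop) (by fun_prop)]
  rfl

lemma ae_torus_iff {P : ℝ × ℝ → Prop} :
    (∀ᵐ z ∂(cellMeasure (d * step d)), P z) ↔
      ∀ p : ZMod d × ZMod d, ∀ᵐ z ∂(cellMeasure (step d)), P (z + corner p) := by
  rw [cellMeasure_eq_sum, Measure.ae_sum_iff]
  exact forall_congr' fun p => (measurableEmbedding_add_corner p).ae_map_iff

lemma integrable_torus_iff {F : ℝ × ℝ → ℂ} :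
    Integrable F (cellMeasure (d * step d)) ↔
      ∀ p : ZMod d × ZMod d, Integrable (fun z => F (z + corner p)) (cellMeasure (step d)) := by
  rw [cellMeasure_eq_sum, integrable_sum_measure_iff, and_iff_left (Summable.of_finite)]
  exact forall_congr' fun p => (measurableEmbedding_add_corner p).integrable_map_iff

lemma integral_torus {F : ℝ × ℝ → ℂ} (hF : Integrable F (cellMeasure (d * step d))) :
    ∫ z, F z ∂(cellMeasure (d * step d)) =
      ∑ p : ZMod d × ZMod d, ∫ z, F (z + corner p) ∂(cellMeasure (step d)) := by
  rw [cellMeasure_eq_sum] at hF ⊢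
  refine (hasSum_integral_measure hF).unique ?_
  refine (hasSum_fintype _).congr_fun fun p => ?_
  exact (measurableEmbedding_add_corner p).integral_map _

lemma torusMeasure_integrable {F : ℝ × ℝ → ℂ} :
    Integrable F (torusMeasure d) ↔ Integrable F (cellMeasure (d * step d)) := by
  rw [torusMeasure]
  exact integrable_smul_measure (by simp) (by simp [NeZero.ne d])

/-- The function on the torus that is given on the tile with label `p` by `w p`, in coordinates
relative to the corner of the tile. -/
def glue (w : ZMod d × ZMod d → ℝ × ℝ → ℂ) (z : ℝ × ℝ) : ℂ :=
  w ((⌊z.1 / step d⌋ : ZMod d), (⌊z.2 / step d⌋ : ZMod d))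
    (z.1 - ⌊z.1 / step d⌋ * step d, z.2 - ⌊z.2 / step d⌋ * step d)

lemma ae_mem_cell (L : ℝ) :
    ∀ᵐ z ∂(cellMeasure L), z.1 ∈ Set.Ico 0 L ∧ z.2 ∈ Set.Ico 0 L := by
  rw [cellMeasure_eq]
  exact ae_restrict_mem (measurableSet_Ico.prod measurableSet_Ico)

lemma glue_add_corner (w : ZMod d × ZMod d → ℝ × ℝ → ℂ) (p : ZMod d × ZMod d) :
    ∀ᵐ z ∂(cellMeasure (step d)), glue w (z + corner p) = w p z := by
  have hL := step_pos (pos_of_neZero (d := d))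
  have h1 : ∀ (a : ZMod d) (t : ℝ), t ∈ Set.Ico 0 (step d) →
      ⌊(t + a.val * step d) / step d⌋ = a.val := by
    intro a t ht
    rw [Int.floor_eq_iff]
    constructor
    · rw [le_div_iff₀ hL]; push_cast; linarith [ht.1]
    · rw [div_lt_iff₀ hL]; push_cast; linarith [ht.2]
  filter_upwards [ae_mem_cell (step d)] with z hz
  simp only [glue, corner, Prod.fst_add, Prod.snd_add, h1 _ _ hz.1, h1 _ _ hz.2]
  simp

end

/-! ### The Wigner function through its Fourier coefficients -/

/-- The signed characteristic function `(-1)^{mn} Tr[D(nℓ, mℓ) A]`. -/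
def charTrace (d : ℕ) (A : Hilb →L[ℂ] Hilb) (m n : ℤ) : ℂ :=
  (-1 : ℂ) ^ (m * n) * trace (disp (n * step d) (m * step d) ∘L A)

lemma norm_neg_one_zpow (k : ℤ) : ‖(-1 : ℂ) ^ k‖ = 1 := by simp

section
variable {d : ℕ} [NeZero d]

lemma chr_mul_val (m : ℤ) (a : ZMod d) :
    chr (d * step d) m (a.val * step d) = ZMod.stdAddChar ((m : ZMod d) * a) := by
  have h := exp_eq_stdAddChar (d := d) (m * (a.val : ℤ))
  have h1 : ((m * (a.val : ℤ) : ℤ) : ZMod d) = (m : ZMod d) * a := by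
    rw [Int.cast_mul, Int.cast_natCast, ZMod.natCast_rightInverse]
  rw [h1] at h
  rw [← h, chr_mul_step]
  congr 1
  push_cast
  ring

lemma chr₂_add_corner (m n : ℤ) (z : ℝ × ℝ) (p : ZMod d × ZMod d) :
    chr₂ (d * step d) m n (z + corner p) = chr₂ (d * step d) m n z *
      (ZMod.stdAddChar ((m : ZMod d) * p.1) * ZMod.stdAddChar ((n : ZMod d) * p.2)) := by
  simp only [chr₂, corner, Prod.fst_add, Prod.snd_add, chr_add_right, chr_mul_val]
  ring

/-- In odd dimension the sign `(-1)^{mn}` turns the half-integral phase of `D(nℓ, mℓ)` into a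
character of `ℤ/d`. -/
lemma neg_one_zpow_mul_exp (hd : Odd d) (m n : ℤ) :
    (-1 : ℂ) ^ (m * n) * Complex.exp (-(Complex.I * (n * m * step d ^ 2 / 2))) =
      ZMod.stdAddChar (-((m : ZMod d) * (n : ZMod d) * half d)) := by
  have h := exp_eq_stdAddChar (d := d) (-(m * n * ((d + 1) / 2 : ℕ)))
  have h1 : ((-(m * n * ((d + 1) / 2 : ℕ)) : ℤ) : ZMod d) =
      -((m : ZMod d) * (n : ZMod d) * half d) := by
    rw [half]; generalize (d + 1) / 2 = q; push_cast; ring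
  rw [h1] at h
  rw [← h]
  obtain ⟨r, hr⟩ := hd
  have h2 : (d + 1) / 2 = r + 1 := by omega
  have h3 : ((2 * r + 1 : ℕ) : ℂ) * (step d : ℂ) ^ 2 = 2 * Real.pi := by
    rw [← hr]; exact_mod_cast mul_step_sq (pos_of_neZero (d := d))
  have h4 : (-1 : ℂ) ^ (m * n) = Complex.exp (-(Complex.I * (m * n * Real.pi))) := by
    have e : -(Complex.I * (m * n * Real.pi)) = ((-(m * n) : ℤ) : ℂ) * (Real.pi * Complex.I) := by
      push_cast; ring
    rw [e, Complex.exp_int_mul, Complex.exp_pi_mul_I, zpow_neg, ← inv_zpow, inv_neg,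
      inv_one]
  rw [h4, ← Complex.exp_add, h2]
  congr 1
  push_cast at h3 ⊢
  linear_combination (Complex.I * (m * n) / 2) * h3

/-- The Wigner function of `A` as an explicit function: on each tile, the discrete Wigner function
of the code matrix. -/
def wignerFun (d : ℕ) [NeZero d] (A : Hilb →L[ℂ] Hilb) : ℝ × ℝ → ℂ :=
  glue fun p z => discreteWigner (cm d A z) p.1 p.2

lemma wignerFun_add_corner (A : Hilb →L[ℂ] Hilb) (p : ZMod d × ZMod d) :
    (fun z => wignerFun d A (z + corner p)) =ᵐ[cellMeasure (step d)]
      fun z => discreteWigner (cm d A z) p.1 p.2 :=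
  glue_add_corner _ p

lemma integrable_discreteWigner {A : Hilb →L[ℂ] Hilb} (h : IsTraceClass A) (a b : ZMod d) :
    Integrable (fun z => discreteWigner (cm d A z) a b) (cellMeasure (step d)) :=
  integrable_finsetSum _ fun k _ => (integrable_cm h (a + k) (a - k)).const_mul _

lemma integrable_wignerFun {A : Hilb →L[ℂ] Hilb} (h : IsTraceClass A) :
    Integrable (wignerFun d A) (cellMeasure (d * step d)) :=
  integrable_torus_iff.2 fun p =>
    (integrable_discreteWigner h p.1 p.2).congr (wignerFun_add_corner A p).symm

lemma Integrable.mul_chr₂ {f : ℝ × ℝ → ℂ} {μ : Measure (ℝ × ℝ)} (hf : Integrable f μ) (L : ℝ)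
    (m n : ℤ) : Integrable (fun z => f z * chr₂ L m n z) μ :=
  hf.mul_bdd (c := 1) (continuous_chr₂ L m n).aestronglyMeasurable
    (Eventually.of_forall fun z => (norm_chr₂ L m n z).le)

/-- The Fourier coefficients of the explicit Wigner function. -/
lemma integral_wignerFun_mul_chr₂ (hd : Odd d) {A : Hilb →L[ℂ] Hilb} (h : IsTraceClass A)
    (m n : ℤ) :
    ∫ z, wignerFun d A z * chr₂ (d * step d) m (-n) z ∂(cellMeasure (d * step d)) =
      d * charTrace d A m n := by
  have hi := Integrable.mul_chr₂ (integrable_wignerFun (d := d) h) (d * step d) m (-n)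
  have hp : ∀ p : ZMod d × ZMod d,
      (fun z => wignerFun d A (z + corner p) * chr₂ (d * step d) m (-n) (z + corner p))
        =ᵐ[cellMeasure (step d)] fun z => chr₂ (d * step d) m (-n) z *
          (ZMod.stdAddChar ((m : ZMod d) * p.1) * ZMod.stdAddChar (-((n : ZMod d) * p.2)) *
            discreteWigner (cm d A z) p.1 p.2) := by
    intro p
    filter_upwards [wignerFun_add_corner A p] with z hz
    rw [hz, chr₂_add_corner]
    push_cast
    rw [neg_mul]
    ring
  have hi' : ∀ p : ZMod d × ZMod d, Integrable (fun z => chr₂ (d * step d) m (-n) z *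
      (ZMod.stdAddChar ((m : ZMod d) * p.1) * ZMod.stdAddChar (-((n : ZMod d) * p.2)) *
        discreteWigner (cm d A z) p.1 p.2)) (cellMeasure (step d)) := fun p =>
    (integrable_torus_iff.1 hi p).congr (hp p)
  rw [integral_torus hi, Finset.sum_congr rfl fun p _ => integral_congr_ae (hp p),
    ← integral_finsetSum _ fun p _ => hi' p]
  simp only [← Finset.mul_sum, sum_stdAddChar_mul_discreteWigner hd]
  rw [charTrace, trace_disp_eq_integral h, Finset.mul_sum, Finset.mul_sum]
  have hi2 : ∀ J : ZMod d, Integrable (fun z => d * (chr₂ (d * step d) m (-n) z *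
      (ZMod.stdAddChar ((m : ZMod d) * J) *
        ZMod.stdAddChar (-((m : ZMod d) * (n : ZMod d) * half d)) *
        cm d A z (J - (n : ZMod d)) J))) (cellMeasure (step d)) := by
    intro J
    refine ((Integrable.mul_chr₂ (integrable_cm h (J - (n : ZMod d)) J)
      (d * step d) m (-n)).const_mul
      (d * (ZMod.stdAddChar ((m : ZMod d) * J) *
        ZMod.stdAddChar (-((m : ZMod d) * (n : ZMod d) * half d))))).congr
          (Eventually.of_forall fun z => ?_)
    simp only; ring
  have e : ∀ z, chr₂ (d * step d) m (-n) z * (d * ∑ J : ZMod d,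
      ZMod.stdAddChar ((m : ZMod d) * J) *
        ZMod.stdAddChar (-((m : ZMod d) * (n : ZMod d) * half d)) *
        cm d A z (J - (n : ZMod d)) J) = ∑ J : ZMod d, d * (chr₂ (d * step d) m (-n) z *
      (ZMod.stdAddChar ((m : ZMod d) * J) *
        ZMod.stdAddChar (-((m : ZMod d) * (n : ZMod d) * half d)) *
        cm d A z (J - (n : ZMod d)) J)) := by
    intro z
    rw [mul_left_comm, Finset.mul_sum, Finset.mul_sum]
  simp only [e]
  rw [integral_finsetSum _ fun J _ => hi2 J]
  refine Finset.sum_congr rfl fun J _ => ?_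
  rw [integral_const_mul, ← integral_const_mul ((-1 : ℂ) ^ (m * n))]
  congr 2 with z
  rw [weylPhase, ← neg_one_zpow_mul_exp hd]
  ring

end

lemma exp_eq_chr₂ {d : ℕ} [NeZero d] (m n : ℤ) (z : ℝ × ℝ) :
    Complex.exp (Complex.I * (z.2 * (n * step d) - z.1 * (m * step d))) =
      chr₂ (d * step d) (-m) n z := by
  rw [chr₂, chr_mul_step, chr_mul_step, ← Complex.exp_add]
  congr 1
  push_cast
  ring

lemma disp_kernelTerm {d : ℕ} [NeZero d] (m n : ℤ) (z : ℝ × ℝ) (φ : Hilb) :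
    disp z.1 z.2 (kernelTerm d m n (((disp z.1 z.2)†) φ)) =
      ((1 / (2 * Real.pi) : ℂ) * (-1 : ℂ) ^ (m * n) * chr₂ (d * step d) (-m) n z) •
        disp (n * step d) (m * step d) φ := by
  have h : kernelTerm d m n (((disp z.1 z.2)†) φ) = ((1 / (2 * Real.pi) : ℂ) * (-1 : ℂ) ^ (m * n)) •
      disp (n * step d) (m * step d) (((disp z.1 z.2)†) φ) := rfl
  rw [h, map_smul, disp_adjoint, disp_conj, smul_smul, ← exp_eq_chr₂]
  push_cast
  rfl

lemma trace_kernelPartial {d : ℕ} [NeZero d] (N : ℕ) (z : ℝ × ℝ) {A : Hilb →L[ℂ] Hilb}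
    (h : IsTraceClass A) :
    trace (kernelPartial d N z ∘L A) = ∑ m ∈ Finset.Icc (-(N : ℤ)) N,
      ∑ n ∈ Finset.Icc (-(N : ℤ)) N,
        (1 / (2 * Real.pi) : ℂ) * charTrace d A m n * chr₂ (d * step d) (-m) n z := by
  have e : kernelPartial d N z = ∑ m ∈ Finset.Icc (-(N : ℤ)) N, ∑ n ∈ Finset.Icc (-(N : ℤ)) N,
      ((1 / (2 * Real.pi) : ℂ) * (-1 : ℂ) ^ (m * n) * chr₂ (d * step d) (-m) n z) •
        disp (n * step d) (m * step d) := by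
    ext1 φ
    have e1 : kernelPartial d N z φ = disp z.1 z.2 ((∑ m ∈ Finset.Icc (-(N : ℤ)) N,
      ∑ n ∈ Finset.Icc (-(N : ℤ)) N, kernelTerm d m n) (((disp z.1 z.2)†) φ)) := rfl
    rw [e1]
    simp only [sum_apply, map_sum, disp_kernelTerm, smul_apply]
  rw [e, h.trace_sum]
  refine Finset.sum_congr rfl fun m _ => ?_
  rw [h.trace_sum]
  refine Finset.sum_congr rfl fun n _ => ?_
  rw [h.trace_smul, charTrace]
  ring

/-- A Wigner function is recognised by its Fourier coefficients, since the Fourier series of a test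
function converges absolutely. -/
lemma isWigner_of_fourier {d : ℕ} [NeZero d] {A : Hilb →L[ℂ] Hilb} (hA : IsTraceClass A)
    {W : Lp ℂ 1 (torusMeasure d)}
    (hW : ∀ m n : ℤ, ∫ z, W z * chr₂ (d * step d) m (-n) z ∂(torusMeasure d) =
      charTrace d A m n) : IsWigner d A W := by
  intro h hh
  have hd : 0 < d := pos_of_neZero
  have hL := mul_step_pos hd
  set L : ℝ := d * step d with hLdef
  have hL2 : (L : ℂ) ^ 2 = d * (2 * Real.pi) := by
    have : L ^ 2 = d * (2 * Real.pi) := by rw [← mul_step_sq hd]; ring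
    exact_mod_cast this
  have hdC : (d : ℂ) ≠ 0 := by exact_mod_cast hd.ne'
  have hpi : (Real.pi : ℂ) ≠ 0 := by exact_mod_cast Real.pi_ne_zero
  have hL0 : (L : ℂ) ^ 2 ≠ 0 := by rw [hL2]; simp [hdC, hpi]
  have hs := hh.summable_fourier hd
  rw [← hLdef] at hs
  let c : ℤ × ℤ → ℂ := fun k =>
    ((L : ℂ) ^ 2)⁻¹ * ∫ z, h z * chr₂ L (-k.1) (-k.2) z ∂(cellMeasure L)
  have hc : Summable c :=
    (((Equiv.neg (ℤ × ℤ)).summable_iff (f := fun k : ℤ × ℤ =>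
      ∫ z, h z * chr₂ L k.1 k.2 z ∂(cellMeasure L))).2 hs).mul_left _
  have hhi := hh.continuous.integrable_cellMeasure L
  have hsum : h =ᵐ[cellMeasure L] fourierSum L c := by
    refine ae_eq_fourierSum L hL hhi hc fun m n => ?_
    simp only [c, neg_neg]
    rw [← mul_assoc, mul_inv_cancel₀ hL0, one_mul]
  have h1 := hasSum_integral_mul_fourierSum L hc (L1.integrable_coeFn W)
  have h2 : ∫ z, W z * fourierSum L c z ∂(torusMeasure d) = ∫ z, W z * h z ∂(torusMeasure d) := by
    refine integral_congr_ae (torusMeasure_ae.2 ?_)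
    filter_upwards [hsum] with z hz
    rw [hz]
  rw [h2, ← (Equiv.prodCongr (Equiv.refl ℤ) (Equiv.neg ℤ)).hasSum_iff] at h1
  refine (tendsto_sum_square h1).congr fun N => ?_
  simp only [trace_kernelPartial N _ hA, Finset.sum_mul]
  have hi : ∀ m n : ℤ, Integrable (fun z => (1 / (2 * Real.pi) : ℂ) * charTrace d A m n *
      chr₂ (d * step d) (-m) n z * h z) (torusMeasure d) := fun m n =>
    torusMeasure_integrable.2 (((continuous_const.mul (continuous_chr₂ _ _ _)).mul
      hh.continuous).integrable_cellMeasure _)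
  rw [integral_finsetSum _ fun m _ => integrable_finsetSum _ fun n _ => hi m n]
  refine Finset.sum_congr rfl fun m _ => ?_
  rw [integral_finsetSum _ fun n _ => hi m n]
  refine Finset.sum_congr rfl fun n _ => ?_
  rw [torusMeasure_integral]
  simp only [Function.comp, Equiv.prodCongr_apply, Prod.map, Equiv.refl_apply, Equiv.neg_apply, hW,
    neg_neg, c, hL2]
  have e : ∀ z, (1 / (2 * Real.pi) : ℂ) * charTrace d A m n * chr₂ (d * step d) (-m) n z * h z =
      ((1 / (2 * Real.pi) : ℂ) * charTrace d A m n) * (h z * chr₂ L (-m) n z) := fun z => by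
    rw [hLdef]; ring
  simp only [e]
  rw [integral_const_mul, mul_inv]
  ring

section
variable {d : ℕ} [NeZero d]

/-- The explicit Wigner function as an element of `L¹` of the torus. -/
def wignerL1 {A : Hilb →L[ℂ] Hilb} (h : IsTraceClass A) : Lp ℂ 1 (torusMeasure d) :=
  (torusMeasure_integrable.2 (integrable_wignerFun (d := d) h)).toL1 _

lemma isWigner_wignerL1 (hd : Odd d) {A : Hilb →L[ℂ] Hilb} (h : IsTraceClass A) :
    IsWigner d A (wignerL1 h) := by
  refine isWigner_of_fourier h fun m n => ?_
  have hc := (torusMeasure_integrable.2 (integrable_wignerFun (d := d) h)).coeFn_toL1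
  have e : ∫ z, wignerL1 (d := d) h z * chr₂ (d * step d) m (-n) z ∂(torusMeasure d) =
      ∫ z, wignerFun d A z * chr₂ (d * step d) m (-n) z ∂(torusMeasure d) := by
    refine integral_congr_ae ?_
    filter_upwards [hc] with z hz
    rw [← hz]; rfl
  rw [e, torusMeasure_integral, integral_wignerFun_mul_chr₂ hd h, ← mul_assoc,
    inv_mul_cancel₀ (by exact_mod_cast NeZero.ne d), one_mul]

lemma integrable_torus_coe (W : Lp ℂ 1 (torusMeasure d)) :
    Integrable W (cellMeasure (d * step d)) :=
  torusMeasure_integrable.1 (L1.integrable_coeFn W)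

/-- Trigonometric test functions determine a function on the torus. -/
lemma IsWigner.unique {A : Hilb →L[ℂ] Hilb} {W W' : Lp ℂ 1 (torusMeasure d)}
    (h : IsWigner d A W) (h' : IsWigner d A W') : W = W' := by
  refine Lp.ext (torusMeasure_ae.2 (ae_eq_of_fourier₂ _ (mul_step_pos pos_of_neZero)
    (integrable_torus_coe W) (integrable_torus_coe W') fun m n => ?_))
  have ht := isTorusTest_chr₂ (d := d) pos_of_neZero m n
  have := tendsto_nhds_unique (h _ ht) (h' _ ht)
  rw [torusMeasure_integral, torusMeasure_integral] at this
  exact mul_left_cancel₀ (inv_ne_zero (by exact_mod_cast NeZero.ne d)) this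

lemma isWigner_wigner (hd : Odd d) {A : Hilb →L[ℂ] Hilb} (h : IsTraceClass A) :
    IsWigner d A (wigner d A) := by
  have he : ∃ W : Lp ℂ 1 (torusMeasure d), IsWigner d A W := ⟨_, isWigner_wignerL1 hd h⟩
  rw [wigner, dif_pos he]
  exact he.choose_spec

lemma wigner_eq_wignerL1 (hd : Odd d) {A : Hilb →L[ℂ] Hilb} (h : IsTraceClass A) :
    wigner d A = wignerL1 h :=
  (isWigner_wigner hd h).unique (isWigner_wignerL1 hd h)

lemma wigner_ae_eq (hd : Odd d) {A : Hilb →L[ℂ] Hilb} (h : IsTraceClass A) :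
    wigner d A =ᵐ[cellMeasure (d * step d)] wignerFun d A := by
  rw [wigner_eq_wignerL1 hd h]
  exact torusMeasure_ae.1 (torusMeasure_integrable.2 (integrable_wignerFun (d := d) h)).coeFn_toL1

/-- On the tiles of the torus, the Wigner function is the discrete Wigner function of the code
matrix. -/
lemma wigner_add_corner (hd : Odd d) {A : Hilb →L[ℂ] Hilb} (h : IsTraceClass A) :
    ∀ᵐ z ∂(cellMeasure (step d)), ∀ p : ZMod d × ZMod d,
      wigner d A (z + corner p) = discreteWigner (cm d A z) p.1 p.2 := by
  refine ae_all_iff.2 fun p => ?_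
  filter_upwards [ae_torus_iff.1 (wigner_ae_eq hd h) p, wignerFun_add_corner A p] with z h1 h2
  rw [h1, ← h2]

lemma integral_wigner_mul_chr₂ (hd : Odd d) {A : Hilb →L[ℂ] Hilb} (h : IsTraceClass A)
    (m n : ℤ) :
    ∫ z, wigner d A z * chr₂ (d * step d) m (-n) z ∂(torusMeasure d) = charTrace d A m n := by
  rw [torusMeasure_integral, integral_congr_ae (g := fun z => wignerFun d A z *
    chr₂ (d * step d) m (-n) z), integral_wignerFun_mul_chr₂ hd h, ← mul_assoc,
    inv_mul_cancel₀ (by exact_mod_cast NeZero.ne d), one_mul]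
  filter_upwards [wigner_ae_eq hd h] with z hz
  rw [hz]

lemma wigner_ae_eq_of_fourier (hd : Odd d) {A : Hilb →L[ℂ] Hilb} (h : IsTraceClass A)
    {f : ℝ × ℝ → ℂ} (hf : Integrable f (torusMeasure d))
    (hc : ∀ m n : ℤ, ∫ z, f z * chr₂ (d * step d) m (-n) z ∂(torusMeasure d) =
      charTrace d A m n) :
    wigner d A =ᵐ[torusMeasure d] f := by
  refine torusMeasure_ae.2 (ae_eq_of_fourier₂ _ (mul_step_pos pos_of_neZero)
    (integrable_torus_coe _) (torusMeasure_integrable.1 hf) fun m n => ?_)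
  have h1 := (integral_wigner_mul_chr₂ hd h m (-n)).trans (hc m (-n)).symm
  rw [torusMeasure_integral, torusMeasure_integral, neg_neg] at h1
  exact mul_left_cancel₀ (inv_ne_zero (by exact_mod_cast NeZero.ne d)) h1

end

/-! ### Linearity, reality, standardisation and covariance -/

lemma measurable_modL (L : ℝ) : Measurable (modL L) := by
  unfold modL
  exact measurable_const.mul (measurable_fract.comp (measurable_id.div_const L))

lemma modL_of_mem {L t : ℝ} (h : t ∈ Set.Ico 0 L) : modL L t = t := by
  have hL : 0 < L := h.1.trans_lt h.2
  have : Int.fract (t / L) = t / L :=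
    Int.fract_eq_self.2 ⟨div_nonneg h.1 hL.le, (div_lt_one hL).2 h.2⟩
  rw [modL, this, mul_div_cancel₀ _ hL.ne']

/-- Translations of the circle `ℝ / Lℤ` preserve Lebesgue measure on the fundamental domain. -/
lemma measurePreserving_modL_add (L : ℝ) (hL : 0 < L) (x : ℝ) :
    MeasurePreserving (fun t => modL L (t + x)) (volume.restrict (Set.Ico 0 L))
      (volume.restrict (Set.Ico 0 L)) := by
  have : Fact (0 < L) := ⟨hL⟩
  have hm : Measurable fun t => modL L (t + x) :=
    (measurable_modL L).comp (measurable_id.add_const x)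
  refine ⟨hm, ?_⟩
  have hr : Measurable fun y : AddCircle L =>
      ((AddCircle.equivIco L 0 y : Set.Ico (0 : ℝ) (0 + L)) : ℝ) :=
    measurable_subtype_coe.comp (AddCircle.measurableEquivIco L 0).measurable
  have hrm : (fun y : AddCircle L => ((AddCircle.equivIco L 0 y : Set.Ico (0 : ℝ) (0 + L)) : ℝ)) ∘
      ((↑) : ℝ → AddCircle L) = modL L := by
    ext t
    exact (AddCircle.coe_equivIco_mk_apply L t).trans (mul_comm _ _)
  have h1 : ∀ a : ℝ, (volume.restrict (Set.Ioc a (a + L))).map (modL L) =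
      (volume : Measure (AddCircle L)).map
        (fun y => ((AddCircle.equivIco L 0 y : Set.Ico (0 : ℝ) (0 + L)) : ℝ)) := by
    intro a
    rw [← (AddCircle.measurePreserving_mk L a).map_eq,
      Measure.map_map hr (AddCircle.measurePreserving_mk L a).measurable, hrm]
  have h2 : (volume.restrict (Set.Ico 0 L)).map (modL L) = volume.restrict (Set.Ico 0 L) := by
    conv_rhs => rw [← Measure.map_id (μ := volume.restrict (Set.Ico 0 L))]
    refine Measure.map_congr ?_
    filter_upwards [ae_restrict_mem measurableSet_Ico] with t ht
    exact modL_of_mem ht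
  have h3 : (volume.restrict (Set.Ico 0 L)).map (fun t => t + x) =
      volume.restrict (Set.Ioc x (x + L)) := by
    have hp : (fun t : ℝ => t + x) ⁻¹' Set.Ioc x (x + L) = Set.Ioc 0 L := by
      ext t
      simp only [Set.mem_preimage, Set.mem_Ioc]
      constructor <;> rintro ⟨h0, h1⟩ <;> constructor <;> linarith
    have := ((measurePreserving_add_right volume x).restrict_preimage
      (s := Set.Ioc x (x + L)) measurableSet_Ioc).map_eq
    rw [hp] at this
    rw [restrict_Ico_eq_restrict_Ioc]
    exact this
  have h4 : (fun t => modL L (t + x)) = modL L ∘ fun t => t + x := rfl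
  rw [h4, ← Measure.map_map (measurable_modL L) (by fun_prop : Measurable fun t : ℝ => t + x), h3,
    h1 x, ← h1 0, zero_add, ← restrict_Ico_eq_restrict_Ioc, h2]

lemma measurePreserving_act {d : ℕ} [NeZero d] (x p : ℝ) :
    MeasurePreserving (act d x p) (torusMeasure d) (torusMeasure d) := by
  have hL := mul_step_pos (pos_of_neZero (d := d))
  have h : MeasurePreserving (act d x p) (cellMeasure (d * step d)) (cellMeasure (d * step d)) :=
    (measurePreserving_modL_add _ hL x).prod (measurePreserving_modL_add _ hL p)
  exact h.smul_measure _

lemma chr_modL (L : ℝ) (hL : L ≠ 0) (n : ℤ) (t : ℝ) : chr L n (modL L t) = chr L n t := by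
  have h : ∀ k : ℤ, chr L n (L * k) = 1 := by
    intro k
    rw [chr, ← Complex.exp_int_mul_two_pi_mul_I (n * k)]
    congr 1
    have : (L : ℂ) ≠ 0 := by exact_mod_cast hL
    push_cast
    field_simp
  have h2 : t = modL L t + L * ⌊t / L⌋ := by
    rw [modL, ← mul_add, Int.fract_add_floor, mul_div_cancel₀ _ hL]
  conv_rhs => rw [h2, chr_add_right, h, mul_one]

lemma charTrace_adjoint {d : ℕ} {A : Hilb →L[ℂ] Hilb} (hA : IsTraceClass A) (m n : ℤ) :
    charTrace d (A†) m n = conj (charTrace d A (-m) (-n)) := by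
  have h1 : disp (n * step d) (m * step d) ∘L A† =
      (A ∘L disp ((-n : ℤ) * step d) ((-m : ℤ) * step d))† := by
    rw [ContinuousLinearMap.adjoint_comp, disp_adjoint]
    congr 2 <;> push_cast <;> ring
  rw [charTrace, charTrace, h1, trace_adjoint, hA.trace_comm, map_mul, map_zpow₀, map_neg, map_one,
    neg_mul_neg]

section
variable {d : ℕ} [NeZero d]

lemma chr₂_act (m n : ℤ) (x p : ℝ) (z : ℝ × ℝ) :
    chr₂ (d * step d) m n (act d x p z) =
      chr₂ (d * step d) m n z * chr₂ (d * step d) m n (x, p) := by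
  have hL := (mul_step_pos (pos_of_neZero (d := d))).ne'
  simp only [chr₂, act, chr_modL _ hL, chr_add_right]
  ring

lemma wigner_add (hd : Odd d) {A B : Hilb →L[ℂ] Hilb} (hA : IsTraceClass A)
    (hB : IsTraceClass B) : wigner d (A + B) = wigner d A + wigner d B := by
  have iA := L1.integrable_coeFn (wigner d A)
  have iB := L1.integrable_coeFn (wigner d B)
  refine Lp.ext ((wigner_ae_eq_of_fourier hd (hA.add hB) (iA.add iB) fun m n => ?_).trans
    (Lp.coeFn_add _ _).symm)
  simp only [Pi.add_apply, add_mul]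
  rw [integral_add (Integrable.mul_chr₂ iA _ _ _) (Integrable.mul_chr₂ iB _ _ _),
    integral_wigner_mul_chr₂ hd hA, integral_wigner_mul_chr₂ hd hB, charTrace, charTrace, charTrace,
    hA.trace_comp_add hB, mul_add]

lemma wigner_smul (hd : Odd d) (c : ℂ) {A : Hilb →L[ℂ] Hilb} (hA : IsTraceClass A) :
    wigner d (c • A) = c • wigner d A := by
  have iA := L1.integrable_coeFn (wigner d A)
  refine Lp.ext ((wigner_ae_eq_of_fourier hd (hA.smul c) (iA.smul c) fun m n => ?_).trans
    (Lp.coeFn_smul _ _).symm)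
  simp only [Pi.smul_apply, smul_eq_mul, mul_assoc]
  rw [integral_const_mul, integral_wigner_mul_chr₂ hd hA, charTrace, charTrace]
  have e : disp (n * step d) (m * step d) ∘L (c • A) =
      (c • disp (n * step d) (m * step d)) ∘L A := by
    ext1 φ; simp
  rw [e, hA.trace_smul]
  ring

lemma wigner_adjoint (hd : Odd d) {A : Hilb →L[ℂ] Hilb} (hA : IsTraceClass A) :
    ∀ᵐ z ∂(torusMeasure d), wigner d (A†) z = conj (wigner d A z) := by
  have iA := L1.integrable_coeFn (wigner d A)
  have iA' : Integrable (fun z => conj (wigner d A z)) (torusMeasure d) :=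
    (LinearIsometryEquiv.integrable_comp_iff RCLike.conjLIE).2 iA
  refine wigner_ae_eq_of_fourier hd hA.adjoint iA' fun m n => ?_
  rw [charTrace_adjoint hA, ← integral_wigner_mul_chr₂ hd hA, ← integral_conj]
  congr 1 with z
  rw [map_mul, conj_chr₂, neg_neg, neg_neg]

lemma integral_wigner (hd : Odd d) {A : Hilb →L[ℂ] Hilb} (hA : IsTraceClass A) :
    ∫ z, wigner d A z ∂(torusMeasure d) = trace A := by
  have h := integral_wigner_mul_chr₂ hd hA 0 0
  have e : disp ((0 : ℤ) * step d) ((0 : ℤ) * step d) ∘L A = A := by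
    ext1 φ
    simp [disp_zero]
  rw [charTrace, e] at h
  simpa [chr₂_zero] using h

lemma trace_disp_conj {A : Hilb →L[ℂ] Hilb} (hA : IsTraceClass A) (c x p a b : ℝ) :
    trace (disp a b ∘L ((heisenberg c x p)† ∘L A ∘L heisenberg c x p)) =
      Complex.exp (Complex.I * (p * a - x * b)) * trace (disp a b ∘L A) := by
  have h1 : disp a b ∘L ((heisenberg c x p)† ∘L A ∘L heisenberg c x p) =
      ((disp a b ∘L (heisenberg c x p)†) ∘L A) ∘L heisenberg c x p := rfl
  rw [h1, ← (hA.comp_left _).trace_comm]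
  have h2 : heisenberg c x p ∘L ((disp a b ∘L (heisenberg c x p)†) ∘L A) =
      (heisenberg c x p ∘L disp a b ∘L (heisenberg c x p)†) ∘L A := rfl
  have h3 : heisenberg c x p = Complex.exp (Complex.I * ((c - x * p / 2 : ℝ) : ℂ)) • disp x p := by
    ext1 φ
    rw [heisenberg_eq, smul_apply]
    push_cast; rfl
  have h4 : heisenberg c x p ∘L disp a b ∘L (heisenberg c x p)† =
      Complex.exp (Complex.I * (p * a - x * b)) • disp a b := by
    ext1 φ
    rw [h3, map_smulₛₗ, disp_adjoint]
    simp only [ContinuousLinearMap.comp_apply, smul_apply, map_smul]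
    rw [disp_conj, smul_smul, smul_smul]
    congr 1
    rw [mul_comm (conj _), Complex.mul_conj, Complex.normSq_eq_norm_sq, norm_exp_I_mul]
    simp
  rw [h2, h4, hA.trace_smul]

lemma wigner_covariant (hd : Odd d) {A : Hilb →L[ℂ] Hilb} (hA : IsTraceClass A) (c x p : ℝ) :
    ∀ᵐ z ∂(torusMeasure d),
      wigner d ((heisenberg c x p)† ∘L A ∘L heisenberg c x p) z = wigner d A (act d x p z) := by
  have hact := measurePreserving_act (d := d) x p
  have iA := L1.integrable_coeFn (wigner d A)
  refine wigner_ae_eq_of_fourier hd ((hA.comp_right _).comp_left _)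
    (hact.integrable_comp_of_integrable iA) fun m n => ?_
  have h1 : ∀ z, wigner d A (act d x p z) * chr₂ (d * step d) m (-n) z =
      chr₂ (d * step d) (-m) n (x, p) *
        (wigner d A (act d x p z) * chr₂ (d * step d) m (-n) (act d x p z)) := by
    intro z
    have h2 : chr₂ (d * step d) (-m) n (x, p) * chr₂ (d * step d) m (-n) (x, p) = 1 := by
      rw [chr₂_mul, neg_add_cancel, add_neg_cancel, chr₂_zero]
    rw [chr₂_act]
    linear_combination (-(wigner d A (act d x p z) * chr₂ (d * step d) m (-n) z)) * h2
  simp only [h1]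
  rw [integral_const_mul]
  have h3 : ∫ z, wigner d A (act d x p z) * chr₂ (d * step d) m (-n) (act d x p z)
      ∂(torusMeasure d) = ∫ z, wigner d A z * chr₂ (d * step d) m (-n) z ∂(torusMeasure d) := by
    have h4 : AEStronglyMeasurable (fun z => wigner d A z * chr₂ (d * step d) m (-n) z)
        ((torusMeasure d).map (act d x p)) := by
      rw [hact.map_eq]
      exact (Integrable.mul_chr₂ iA _ _ _).1
    rw [← integral_map hact.measurable.aemeasurable h4, hact.map_eq]
  rw [h3, integral_wigner_mul_chr₂ hd hA, charTrace, charTrace, trace_disp_conj hA, ← exp_eq_chr₂]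
  push_cast
  ring

/-! ### Parseval's identity -/

lemma sum_wigner_mul_wigner (hd : Odd d) {A B : Hilb →L[ℂ] Hilb} (hA : IsTraceClass A)
    (hB : IsTraceClass B) :
    ∀ᵐ z ∂(cellMeasure (step d)), ∑ p : ZMod d × ZMod d,
      wigner d A (z + corner p) * wigner d B (z + corner p) = d * codeTrace d A B z := by
  filter_upwards [wigner_add_corner hd hA, wigner_add_corner hd hB] with z h1 h2
  simp only [h1, h2]
  rw [sum_discreteWigner_mul hd, codeTrace_eq]

lemma integrable_codeTrace (hd : Odd d) {A B : Hilb →L[ℂ] Hilb} (hA : IsTraceClass A)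
    (hB : IsTraceClass B)
    (h : Integrable (fun z => wigner d A z * wigner d B z) (torusMeasure d)) :
    Integrable (codeTrace d A B) (cellMeasure (step d)) := by
  have h1 := integrable_finsetSum Finset.univ fun p _ =>
    integrable_torus_iff.1 (torusMeasure_integrable.1 h) p
  refine (h1.const_mul (d : ℂ)⁻¹).congr ?_
  filter_upwards [sum_wigner_mul_wigner hd hA hB] with z hz
  rw [hz, ← mul_assoc, inv_mul_cancel₀ (by exact_mod_cast NeZero.ne d), one_mul]

lemma integral_wigner_mul_wigner (hd : Odd d) {A B : Hilb →L[ℂ] Hilb} (hA : IsTraceClass A)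
    (hB : IsTraceClass B)
    (h : Integrable (fun z => wigner d A z * wigner d B z) (torusMeasure d)) :
    ∫ z, wigner d A z * wigner d B z ∂(torusMeasure d) = twirlTrace d A B := by
  have hi := torusMeasure_integrable.1 h
  rw [torusMeasure_integral, integral_torus hi,
    ← integral_finsetSum _ fun p _ => integrable_torus_iff.1 hi p, twirlTrace,
    ← integral_const_mul]
  refine integral_congr_ae ?_
  filter_upwards [sum_wigner_mul_wigner hd hA hB] with z hz
  rw [hz, ← mul_assoc, inv_mul_cancel₀ (by exact_mod_cast NeZero.ne d), one_mul]

/-- The code matrix in terms of the Wigner function. -/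
lemma cm_eq_sum_wigner (hd : Odd d) {A : Hilb →L[ℂ] Hilb} (hA : IsTraceClass A) :
    ∀ᵐ z ∂(cellMeasure (step d)), ∀ J K : ZMod d,
      d * cm d A z J K = ∑ b : ZMod d, ZMod.stdAddChar (-((K - J) * b)) *
        wigner d A (z + corner ((J + K) * half d, b)) := by
  filter_upwards [wigner_add_corner hd hA] with z h J K
  rw [discreteWigner_inversion hd]
  simp only [h]

lemma wigner_eq_of_cm_congr (hd : Odd d) {A B : Hilb →L[ℂ] Hilb} (hA : IsTraceClass A)
    (hB : IsTraceClass B) (h : ∀ᵐ z ∂(cellMeasure (step d)), cm d A z = cm d B z) :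
    wigner d A = wigner d B := by
  refine Lp.ext (torusMeasure_ae.2 (ae_torus_iff.2 fun p => ?_))
  filter_upwards [h, wigner_add_corner hd hA, wigner_add_corner hd hB] with z h h1 h2
  rw [h1, h2, h]

/-- A bound on the Wigner function is a bound on the code matrix, each entry being a mean of phases
times values of the Wigner function. -/
lemma norm_cm_le (hd : Odd d) {A : Hilb →L[ℂ] Hilb} (hA : IsTraceClass A) {C : ℝ}
    (hC : ∀ᵐ z ∂(torusMeasure d), ‖wigner d A z‖ ≤ C) :
    ∀ᵐ z ∂(cellMeasure (step d)), ∀ J K : ZMod d, ‖cm d A z J K‖ ≤ C := by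
  have h1 := ae_all_iff.2 (ae_torus_iff.1 (torusMeasure_ae.1 hC))
  have hd0 : (0 : ℝ) < d := by exact_mod_cast pos_of_neZero (d := d)
  filter_upwards [cm_eq_sum_wigner hd hA, h1] with z h h1 J K
  have h2 : ‖(d : ℂ) * cm d A z J K‖ ≤ d * C := by
    rw [h J K]
    refine (norm_sum_le _ _).trans ((Finset.sum_le_sum fun b _ => (?_ : _ ≤ C)).trans
      (le_of_eq ?_))
    · rw [norm_mul, norm_stdAddChar, one_mul]; exact h1 _
    · rw [Finset.sum_const, Finset.card_univ, ZMod.card, nsmul_eq_mul]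
  rw [norm_mul, Complex.norm_natCast] at h2
  exact le_of_mul_le_mul_left h2 hd0

end

/-! ### Displacements of Schwartz functions -/

lemma hasDerivAt_modulation (p a y : ℝ) :
    HasDerivAt (fun y : ℝ => Complex.exp (Complex.I * (p * y - a)))
      (Complex.I * p * Complex.exp (Complex.I * (p * y - a))) y := by
  have h := ((((hasDerivAt_id (y : ℂ)).const_mul (p : ℂ)).sub_const (a : ℂ)).const_mul
    Complex.I).cexp.comp_ofReal
  refine h.congr_deriv ?_
  simp only [id]
  ring

lemma hasTemperateGrowth_modulation (p a : ℝ) :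
    Function.HasTemperateGrowth fun y : ℝ => Complex.exp (Complex.I * (p * y - a)) := by
  have h : ∀ n : ℕ, iteratedDeriv n (fun y : ℝ => Complex.exp (Complex.I * (p * y - a))) =
      fun y : ℝ => (Complex.I * p) ^ n * Complex.exp (Complex.I * (p * y - a)) := by
    intro n
    induction n with
    | zero => simp
    | succ n ih =>
      rw [iteratedDeriv_succ, ih]
      ext y
      rw [((hasDerivAt_modulation p a y).const_mul _).deriv]
      ring
  have hc : ContDiff ℝ ((⊤ : ℕ∞) : WithTop ℕ∞) fun y : ℝ => (y : ℂ) := Complex.ofRealCLM.contDiff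
  refine ⟨by fun_prop, fun n => ⟨0, |p| ^ n, fun y => ?_⟩⟩
  rw [norm_iteratedFDeriv_eq_norm_iteratedDeriv, h]
  have : ‖Complex.exp (Complex.I * (p * y - a))‖ = 1 := by
    simpa using norm_exp_I_mul (p * y - a)
  simp [this]

/-- The displacement operator on Schwartz functions. -/
def schwartzDisp (x p : ℝ) (g : 𝓢(ℝ, ℂ)) : 𝓢(ℝ, ℂ) :=
  SchwartzMap.smulLeftCLM ℂ (fun y : ℝ => Complex.exp (Complex.I * (p * y - (x * p / 2 : ℝ))))
    (g.compSubConstCLM ℂ x)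

lemma schwartzDisp_apply (x p : ℝ) (g : 𝓢(ℝ, ℂ)) (y : ℝ) :
    schwartzDisp x p g y = Complex.exp (Complex.I * (p * y - (x * p / 2 : ℝ))) * g (y - x) := by
  rw [schwartzDisp, SchwartzMap.smulLeftCLM_apply_apply (hasTemperateGrowth_modulation _ _)]
  rfl

lemma coeFn_vec (f : 𝓢(ℝ, ℂ)) : vec f =ᵐ[volume] f := f.coeFn_toLp 2 volume

lemma vec_schwartzDisp (x p : ℝ) (g : 𝓢(ℝ, ℂ)) : vec (schwartzDisp x p g) = disp x p (vec g) := by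
  refine Lp.ext ?_
  filter_upwards [coeFn_vec (schwartzDisp x p g), coeFn_disp x p (vec g),
    (measurePreserving_sub_right volume x).quasiMeasurePreserving.ae (coeFn_vec g)] with y h1 h2 h3
  rw [h1, h2, h3, schwartzDisp_apply]
  push_cast
  rfl

lemma inner_vec (f g : 𝓢(ℝ, ℂ)) : (inner ℂ (vec f) (vec g) : ℂ) = ∫ y, conj (f y) * g y := by
  rw [inner_eq_integral]
  refine integral_congr_ae ?_
  filter_upwards [coeFn_vec f, coeFn_vec g] with y h1 h2
  rw [h1, h2]

/-- The position operator on Schwartz functions. -/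
def position (f : 𝓢(ℝ, ℂ)) : 𝓢(ℝ, ℂ) := SchwartzMap.smulLeftCLM ℂ (fun y : ℝ => (y : ℂ)) f

lemma position_apply (f : 𝓢(ℝ, ℂ)) (y : ℝ) : position f y = y * f y :=
  SchwartzMap.smulLeftCLM_apply_apply Function.Complex.hasTemperateGrowth_ofReal f y

/-- The derivative on Schwartz functions. -/
def differentiate (f : 𝓢(ℝ, ℂ)) : 𝓢(ℝ, ℂ) := SchwartzMap.derivCLM ℂ ℂ f

lemma differentiate_apply (f : 𝓢(ℝ, ℂ)) (y : ℝ) : differentiate f y = deriv f y := rfl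

lemma position_schwartzDisp (x p : ℝ) (g : 𝓢(ℝ, ℂ)) :
    position (schwartzDisp x p g) =
      (x : ℂ) • schwartzDisp x p g + schwartzDisp x p (position g) := by
  ext y
  simp only [add_apply, smul_apply, position_apply, schwartzDisp_apply,
    smul_eq_mul]
  push_cast
  ring

lemma differentiate_schwartzDisp (x p : ℝ) (g : 𝓢(ℝ, ℂ)) :
    differentiate (schwartzDisp x p g) =
      (Complex.I * p) • schwartzDisp x p g + schwartzDisp x p (differentiate g) := by
  ext y
  have h1 : (schwartzDisp x p g : ℝ → ℂ) =
      fun y : ℝ => Complex.exp (Complex.I * (p * y - (x * p / 2 : ℝ))) * g (y - x) :=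
    funext (schwartzDisp_apply x p g)
  have h2 : HasDerivAt (fun y : ℝ => g (y - x)) (deriv (⇑g) (y - x)) y :=
    (g.hasDerivAt (y - x)).comp_sub_const y x
  simp only [add_apply, smul_apply, smul_eq_mul]
  rw [differentiate_apply, schwartzDisp_apply, schwartzDisp_apply, differentiate_apply, h1]
  refine ((hasDerivAt_modulation p (x * p / 2) y).mul h2).deriv.trans ?_
  ring

lemma vec_add (f g : 𝓢(ℝ, ℂ)) : vec (f + g) = vec f + vec g :=
  (SchwartzMap.toLpCLM ℂ ℂ 2 volume).map_add f g

lemma vec_smul (c : ℂ) (f : 𝓢(ℝ, ℂ)) : vec (c • f) = c • vec f :=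
  (SchwartzMap.toLpCLM ℂ ℂ 2 volume).map_smul c f

lemma inner_position (f g : 𝓢(ℝ, ℂ)) :
    (inner ℂ (vec (position f)) (vec g) : ℂ) = inner ℂ (vec f) (vec (position g)) := by
  rw [inner_vec, inner_vec]
  congr 1 with y
  rw [position_apply, position_apply, map_mul, Complex.conj_ofReal]
  ring

lemma inner_differentiate (f g : 𝓢(ℝ, ℂ)) :
    (inner ℂ (vec f) (vec (differentiate g)) : ℂ) =
      -inner ℂ (vec (differentiate f)) (vec g) := by
  rw [inner_vec, inner_vec]
  exact SchwartzMap.integral_bilinear_deriv_right_eq_neg_left f g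
    ((ContinuousLinearMap.mul ℝ ℂ).comp (Complex.conjCLE : ℂ →L[ℝ] ℂ))

/-! ### Absolute convergence of the kernel -/

/-- The ambiguity function `⟨f|D(nℓ, mℓ)|g⟩` on the lattice, at `k = (m, n)`. -/
def ambiguity (d : ℕ) (f g : 𝓢(ℝ, ℂ)) (k : ℤ × ℤ) : ℂ :=
  inner ℂ (vec f) (disp (k.2 * step d) (k.1 * step d) (vec g))

lemma mul_ambiguity_fst (d : ℕ) (f g : 𝓢(ℝ, ℂ)) (k : ℤ × ℤ) :
    Complex.I * (k.1 * step d) * ambiguity d f g k =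
      -(ambiguity d (differentiate f) g k + ambiguity d f (differentiate g) k) := by
  have h := inner_differentiate f (schwartzDisp (k.2 * step d) (k.1 * step d) g)
  rw [differentiate_schwartzDisp, vec_add, vec_smul, inner_add_right, inner_smul_right,
    vec_schwartzDisp, vec_schwartzDisp] at h
  simp only [ambiguity]
  push_cast at h
  linear_combination h

lemma mul_ambiguity_snd (d : ℕ) (f g : 𝓢(ℝ, ℂ)) (k : ℤ × ℤ) :
    (k.2 * step d) * ambiguity d f g k =
      ambiguity d (position f) g k - ambiguity d f (position g) k := by
  have h := inner_position f (schwartzDisp (k.2 * step d) (k.1 * step d) g)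
  rw [position_schwartzDisp, vec_add, vec_smul, inner_add_right, inner_smul_right,
    vec_schwartzDisp, vec_schwartzDisp] at h
  simp only [ambiguity]
  push_cast at h
  linear_combination -h

lemma norm_ambiguity_le (d : ℕ) (f g : 𝓢(ℝ, ℂ)) (k : ℤ × ℤ) :
    ‖ambiguity d f g k‖ ≤ ‖vec f‖ * ‖vec g‖ := by
  have h := norm_inner_le_norm (𝕜 := ℂ) (vec f) (disp (k.2 * step d) (k.1 * step d) (vec g))
  rwa [norm_disp] at h

/-- Integration by parts: the ambiguity function of two Schwartz functions decays rapidly on the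
lattice. -/
lemma summable_ambiguity {d : ℕ} (hd : 0 < d) (f g : 𝓢(ℝ, ℂ)) : Summable (ambiguity d f g) := by
  have hs : (step d : ℂ) ≠ 0 := by exact_mod_cast (step_pos hd).ne'
  refine summable_of_mul_mem_span (T := {c | ∃ f g, c = ambiguity d f g}) ?_ ?_ ?_ ⟨f, g, rfl⟩
  · rintro _ ⟨f, g, rfl⟩
    exact ⟨_, norm_ambiguity_le d f g⟩
  · rintro _ ⟨f, g, rfl⟩
    have := Submodule.smul_mem _ (-(Complex.I * step d)⁻¹) (Submodule.add_mem _
      (Submodule.subset_span (R := ℂ) (s := {c | ∃ f g, c = ambiguity d f g})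
        ⟨differentiate f, g, rfl⟩)
      (Submodule.subset_span ⟨f, differentiate g, rfl⟩))
    convert this using 1
    ext k
    have h := mul_ambiguity_fst d f g k
    simp only [Pi.smul_apply, Pi.add_apply, smul_eq_mul]
    rw [neg_mul, ← mul_neg, ← h]
    have := Complex.I_ne_zero
    field_simp
  · rintro _ ⟨f, g, rfl⟩
    have := Submodule.smul_mem _ ((step d : ℂ)⁻¹) (Submodule.sub_mem _
      (Submodule.subset_span (R := ℂ) (s := {c | ∃ f g, c = ambiguity d f g})
        ⟨position f, g, rfl⟩)
      (Submodule.subset_span ⟨f, position g, rfl⟩))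
    convert this using 1
    ext k
    have h := mul_ambiguity_snd d f g k
    simp only [Pi.smul_apply, Pi.sub_apply, smul_eq_mul]
    rw [← h]
    field_simp

section
variable {d : ℕ} [NeZero d]

/-- The Fourier coefficients of the kernel `⟨f|Δ(u, v)|g⟩`. Conjugation by `D(u, v)` multiplies
`D(nℓ, mℓ)` by `exp (2π i (n v - m u) / dℓ)`, hence the sign of the first index. -/
def kernelCoeff (d : ℕ) (f g : 𝓢(ℝ, ℂ)) (k : ℤ × ℤ) : ℂ :=
  (1 / (2 * Real.pi) : ℂ) * (-1 : ℂ) ^ (-k.1 * k.2) * ambiguity d f g (-k.1, k.2)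

lemma summable_kernelCoeff (f g : 𝓢(ℝ, ℂ)) : Summable (kernelCoeff d f g) := by
  have h := (((Equiv.prodCongr (Equiv.neg ℤ) (Equiv.refl ℤ)).summable_iff).2
    (summable_ambiguity (d := d) pos_of_neZero f g)).norm.mul_left ‖(1 / (2 * Real.pi) : ℂ)‖
  refine Summable.of_norm (h.congr fun k => ?_)
  rw [kernelCoeff, norm_mul, norm_mul, norm_neg_one_zpow, mul_one]
  rfl

lemma inner_kernelTerm (z : ℝ × ℝ) (f g : 𝓢(ℝ, ℂ)) (k : ℤ × ℤ) :
    (inner ℂ (((disp z.1 z.2)†) (vec f))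
      (kernelTerm d k.1 k.2 (((disp z.1 z.2)†) (vec g))) : ℂ) =
      kernelCoeff d f g (-k.1, k.2) * chr₂ (d * step d) (-k.1) k.2 z := by
  rw [ContinuousLinearMap.adjoint_inner_left, disp_kernelTerm, inner_smul_right, kernelCoeff,
    ambiguity, neg_neg]
  ring

lemma summable_kernel (z : ℝ × ℝ) (f g : 𝓢(ℝ, ℂ)) :
    Summable fun mn : ℤ × ℤ => (inner ℂ (((disp z.1 z.2)†) (vec f))
      (kernelTerm d mn.1 mn.2 (((disp z.1 z.2)†) (vec g))) : ℂ) := by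
  simp only [inner_kernelTerm]
  exact ((Equiv.prodCongr (Equiv.neg ℤ) (Equiv.refl ℤ)).summable_iff).2
    (summable_mul_chr₂ (d * step d) (summable_kernelCoeff (d := d) f g) z)

lemma kernel_eq_fourierSum (z : ℝ × ℝ) (f g : 𝓢(ℝ, ℂ)) :
    kernel d z f g = fourierSum (d * step d) (kernelCoeff d f g) z := by
  simp only [kernel, inner_kernelTerm]
  exact (Equiv.prodCongr (Equiv.neg ℤ) (Equiv.refl ℤ)).tsum_eq
    fun k => kernelCoeff d f g k * chr₂ (d * step d) k.1 k.2 z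

instance : IsFiniteMeasure (torusMeasure d) :=
  Measure.smul_finite _ (ENNReal.inv_ne_top.2 (by exact_mod_cast NeZero.ne d))

/-- The kernel is the Wigner function of a rank-one operator: `⟨f|Δ(u, v)|g⟩` is the trace of
`Δ(u, v) |g⟩⟨f|`. -/
lemma wigner_ketbra (hd : Odd d) (f g : 𝓢(ℝ, ℂ)) :
    wigner d (ketbra (vec g) (vec f)) =ᵐ[torusMeasure d] fun z => kernel d z f g := by
  have hd0 : 0 < d := pos_of_neZero
  simp only [kernel_eq_fourierSum]
  refine wigner_ae_eq_of_fourier hd (isTraceClass_ketbra _ _)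
    (integrable_fourierSum _ (summable_kernelCoeff (d := d) f g)) fun m n => ?_
  rw [torusMeasure_integral, integral_fourierSum_mul_chr₂ _ (mul_step_pos hd0)
    (summable_kernelCoeff (d := d) f g), charTrace, trace_comp_ketbra, kernelCoeff, ambiguity]
  have hL2 : ((d * step d : ℝ) : ℂ) ^ 2 = d * (2 * Real.pi) := by
    have : (d * step d) ^ 2 = d * (2 * Real.pi) := by rw [← mul_step_sq hd0]; ring
    exact_mod_cast this
  have hdC : (d : ℂ) ≠ 0 := by exact_mod_cast hd0.ne'
  have hpi : (Real.pi : ℂ) ≠ 0 := by exact_mod_cast Real.pi_ne_zero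
  simp only [neg_neg]
  rw [hL2]
  field_simp

lemma exists_kernel_bound (f g : 𝓢(ℝ, ℂ)) : ∃ C : ℝ, ∀ z, ‖kernel d z f g‖ ≤ C :=
  ⟨_, fun z => by
    rw [kernel_eq_fourierSum]
    exact norm_fourierSum_le _ (summable_kernelCoeff (d := d) f g) z⟩

/-- Matrix elements over the displaced code spaces are traces against rank-one operators. -/
lemma codePairing_ae_eq (A : Hilb →L[ℂ] Hilb) (f g : Hilb) :
    codePairing d A f g =ᵐ[cellMeasure (step d)] codeTrace d A (ketbra g f) := by
  filter_upwards [cm_ketbra (d := d) g f] with z hz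
  rw [codePairing_eq, codeTrace_eq]
  refine Finset.sum_congr rfl fun J _ => Finset.sum_congr rfl fun K _ => ?_
  rw [hz]
  ring

/-! ### Reconstruction -/

lemma integrable_wigner_mul_kernel (A : Hilb →L[ℂ] Hilb) (f g : 𝓢(ℝ, ℂ)) :
    Integrable (fun z => wigner d A z * kernel d z f g) (torusMeasure d) := by
  obtain ⟨C, hC⟩ := exists_kernel_bound (d := d) f g
  refine (L1.integrable_coeFn (wigner d A)).mul_bdd (c := C) ?_ (Eventually.of_forall hC)
  simp only [kernel_eq_fourierSum]
  exact (continuous_fourierSum _ (summable_kernelCoeff (d := d) f g)).aestronglyMeasurable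

lemma integrable_wigner_mul_ketbra (hd : Odd d) (A : Hilb →L[ℂ] Hilb) (f g : 𝓢(ℝ, ℂ)) :
    Integrable (fun z => wigner d A z * wigner d (ketbra (vec g) (vec f)) z) (torusMeasure d) := by
  refine (integrable_wigner_mul_kernel A f g).congr ?_
  filter_upwards [wigner_ketbra hd f g] with z hz
  rw [hz]

lemma integrable_codePairing (hd : Odd d) {A : Hilb →L[ℂ] Hilb} (hA : IsTraceClass A)
    (f g : 𝓢(ℝ, ℂ)) : Integrable (codePairing d A (vec f) (vec g)) (cellMeasure (step d)) :=
  (integrable_codeTrace hd hA (isTraceClass_ketbra _ _)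
    (integrable_wigner_mul_ketbra hd A f g)).congr (codePairing_ae_eq A _ _).symm

lemma twirl_eq_integral (hd : Odd d) {A : Hilb →L[ℂ] Hilb} (hA : IsTraceClass A)
    (f g : 𝓢(ℝ, ℂ)) :
    twirl d A f g = ∫ z, wigner d A z * kernel d z f g ∂(torusMeasure d) := by
  rw [twirl, integral_congr_ae (codePairing_ae_eq A (vec f) (vec g))]
  have h := integral_wigner_mul_wigner hd hA (isTraceClass_ketbra (vec g) (vec f))
    (integrable_wigner_mul_ketbra hd A f g)
  rw [twirlTrace] at h
  rw [← h]
  refine integral_congr_ae ?_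
  filter_upwards [wigner_ketbra hd f g] with z hz
  rw [hz]

end

/-! ### Schwartz functions separate the displaced code spaces -/

section
variable {d : ℕ} [NeZero d]

lemma exists_bump (d : ℕ) [NeZero d] :
    ∃ b : 𝓢(ℝ, ℂ), Function.support b = Set.Ioo 0 (step d) := by
  obtain ⟨b, hs, hb, -⟩ := (isOpen_Ioo (a := (0 : ℝ)) (b := step d)).exists_contDiff_support_eq
    (n := ⊤)
  have hs' : Function.support (fun y => (b y : ℂ)) = Set.Ioo 0 (step d) := by
    rw [← hs]
    ext y
    simp
  have hc : HasCompactSupport fun y => (b y : ℂ) :=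
    HasCompactSupport.of_support_subset_isCompact (isCompact_Icc (a := (0 : ℝ)) (b := step d))
      (hs'.le.trans Set.Ioo_subset_Icc_self)
  exact ⟨hc.toSchwartzMap (Complex.ofRealCLM.contDiff.comp hb), hs'⟩

/-- A fixed Schwartz function, nonzero exactly on the open interval `(0, ℓ)`. -/
def bump (d : ℕ) [NeZero d] : 𝓢(ℝ, ℂ) := (exists_bump d).choose

lemma bump_ne_zero_iff (y : ℝ) : bump d y ≠ 0 ↔ y ∈ Set.Ioo 0 (step d) := by
  rw [← (exists_bump d).choose_spec]
  rfl

lemma dispVal_bump {N : ℤ} (hN : N ≠ 0) : dispVal d (N * step d) (vec (bump d)) = 0 := by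
  refine Lp.ext ?_
  filter_upwards [coeFn_dispVal d (N * step d) (vec (bump d)), ae_mem_cell (step d),
    ae_cellMeasure_of_ae (coeFn_vec (bump d)) (step d) (N * step d),
    Lp.coeFn_zero ℂ 2 (cellMeasure (step d))] with z h1 h2 h3 h4
  rw [h1, h4, dispAdjAt, h3, Pi.zero_apply, mul_eq_zero]
  right
  by_contra h
  obtain ⟨h5, h6⟩ := (bump_ne_zero_iff _).1 h
  have hs := step_pos (pos_of_neZero (d := d))
  obtain ⟨h7, h8⟩ := h2.1
  rcases lt_or_gt_of_ne hN with h9 | h9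
  · have : (N : ℝ) ≤ -1 := by exact_mod_cast Int.le_sub_one_of_lt h9
    nlinarith
  · have : (1 : ℝ) ≤ N := by exact_mod_cast h9
    nlinarith

lemma ov_bump_of_ne {J : ZMod d} (hJ : J ≠ 0) : ov J (vec (bump d)) = 0 := by
  obtain ⟨N, rfl⟩ := ZMod.intCast_surjective J
  refine (hasSum_ov N (vec (bump d))).unique (hasSum_zero.congr_fun fun n => ?_)
  rw [dispVal_bump, smul_zero]
  intro h
  refine hJ ?_
  simpa using congrArg (Int.cast : ℤ → ZMod d) h

lemma ov_zero_bump : ov (0 : ZMod d) (vec (bump d)) =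
    ((1 / Real.sqrt (step d) : ℝ) : ℂ) • dispVal d ((0 : ℤ) * step d) (vec (bump d)) := by
  have h := hasSum_ov (d := d) 0 (vec (bump d))
  rw [Int.cast_zero] at h
  refine h.unique ((hasSum_ite_eq (0 : ℤ) _).congr_fun fun n => ?_)
  by_cases hn : n = 0
  · subst hn; simp
  · rw [if_neg hn, dispVal_bump, smul_zero]
    simpa using ⟨NeZero.ne d, hn⟩

lemma ov_zero_bump_ne_zero :
    ∀ᵐ z ∂(cellMeasure (step d)), ov (0 : ZMod d) (vec (bump d)) z ≠ 0 := by
  rw [ov_zero_bump]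
  have h0 : ∀ᵐ y : ℝ, y ≠ 0 := by simp [ae_iff]
  filter_upwards [coeFn_dispVal d ((0 : ℤ) * step d) (vec (bump d)), ae_mem_cell (step d),
    ae_cellMeasure_of_ae (coeFn_vec (bump d)) (step d) ((0 : ℤ) * step d),
    ae_cellMeasure_of_ae h0 (step d) 0,
    Lp.coeFn_smul ((1 / Real.sqrt (step d) : ℝ) : ℂ)
      (dispVal d ((0 : ℤ) * step d) (vec (bump d)))] with z h1 h2 h3 h4 h5
  rw [h5, Pi.smul_apply, h1, dispAdjAt, h3, smul_eq_mul]
  refine mul_ne_zero ?_ (mul_ne_zero (Complex.exp_ne_zero _) ((bump_ne_zero_iff _).2 ?_))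
  · have := Real.sqrt_pos.2 (step_pos (pos_of_neZero (d := d)))
    exact_mod_cast (one_div_pos.2 this).ne'
  · rw [Int.cast_zero, zero_mul, zero_add]
    rw [zero_add] at h4
    exact ⟨lt_of_le_of_ne h2.1.1 h4.symm, h2.1.2⟩

/-- A bump displaced by `(nℓ, mℓ)` meets only the codeword with label `n`. -/
lemma ov_displaced_bump (m n : ℤ) : ∀ᵐ z ∂(cellMeasure (step d)), ∀ J : ZMod d,
    ov J (vec (schwartzDisp (n * step d) (m * step d) (bump d))) z =
      if J = (n : ZMod d) then weylPhase m n J z * ov (0 : ZMod d) (vec (bump d)) z else 0 := by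
  refine ae_all_iff.2 fun J => ?_
  rw [vec_schwartzDisp]
  filter_upwards [ov_disp m n J (vec (bump d)), Lp.coeFn_zero ℂ 2 (cellMeasure (step d))]
    with z h1 h2
  rw [h1]
  split_ifs with h
  · rw [sub_eq_zero.2 h]
  · rw [ov_bump_of_ne (sub_ne_zero.2 h), h2, Pi.zero_apply, mul_zero]

lemma chr_mul_self (n : ℤ) (t : ℝ) : chr (d * step d) (d * n) t = chr (step d) n t := by
  have hd0 : (d : ℂ) ≠ 0 := by exact_mod_cast NeZero.ne d
  have hs : (step d : ℂ) ≠ 0 := by exact_mod_cast (step_pos (pos_of_neZero (d := d))).ne'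
  rw [chr, chr]
  congr 1
  push_cast
  field_simp

/-- A family of functions, one for each codeword, that is orthogonal to all Schwartz functions
vanishes: the overlaps of displaced bumps provide all characters of the cell. -/
lemma ae_eq_zero_of_schwartz {H : ZMod d → ℝ × ℝ → ℂ}
    (hi : ∀ f : 𝓢(ℝ, ℂ), Integrable (fun z => ∑ J : ZMod d, conj (ov J (vec f) z) * H J z)
      (cellMeasure (step d)))
    (h0 : ∀ f : 𝓢(ℝ, ℂ), ∫ z, ∑ J : ZMod d, conj (ov J (vec f) z) * H J z
      ∂(cellMeasure (step d)) = 0) :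
    ∀ᵐ z ∂(cellMeasure (step d)), ∀ J : ZMod d, H J z = 0 := by
  refine ae_all_iff.2 fun J => ?_
  let G : ℝ × ℝ → ℂ := fun z => conj (ov (0 : ZMod d) (vec (bump d)) z) * H J z
  have hG : ∀ m n : ℤ, (n : ZMod d) = J →
      (fun z => ∑ K : ZMod d,
        conj (ov K (vec (schwartzDisp (n * step d) (m * step d) (bump d))) z) * H K z)
        =ᵐ[cellMeasure (step d)] fun z => conj (weylPhase m n J z) * G z := by
    intro m n hn
    filter_upwards [ov_displaced_bump (d := d) m n] with z hz
    rw [Finset.sum_eq_single J]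
    · rw [hz, if_pos hn.symm, map_mul, mul_assoc]
    · intro K _ hK
      rw [hz, if_neg (by rw [hn]; exact hK), map_zero, zero_mul]
    · exact fun h => absurd (Finset.mem_univ J) h
  have hJ : ((J.val : ℤ) : ZMod d) = J := by
    rw [Int.cast_natCast, ZMod.natCast_rightInverse]
  -- the displacements by `(J + d n, d m)` give the characters of the cell, up to fixed phases
  have hphase : ∀ m n : ℤ, ∃ u : ℂ, u ≠ 0 ∧ ∀ z,
      conj (weylPhase (d * m) (J.val + d * n) J z) =
        u * (chr (d * step d) J.val z.2 * chr₂ (step d) (-m) n z) := by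
    intro m n
    refine ⟨conj (ZMod.stdAddChar (((d * m : ℤ) : ZMod d) * J) * Complex.exp (-(Complex.I *
      ((J.val + d * n : ℤ) * (d * m : ℤ) * step d ^ 2 / 2)))), ?_, fun z => ?_⟩
    · refine (map_ne_zero _).2 (mul_ne_zero ?_ (Complex.exp_ne_zero _))
      rw [← norm_ne_zero_iff, norm_stdAddChar]
      exact one_ne_zero
    · rw [weylPhase, map_mul, conj_chr₂, neg_neg, mul_comm]
      congr 1
      rw [chr₂, chr₂, chr_add, ← mul_neg, chr_mul_self, chr_mul_self]
      ring
  let F : ℝ × ℝ → ℂ := fun z => G z * chr (d * step d) J.val z.2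
  have hF : ∀ m n : ℤ, Integrable (fun z => F z * chr₂ (step d) m n z) (cellMeasure (step d)) ∧
      ∫ z, F z * chr₂ (step d) m n z ∂(cellMeasure (step d)) = 0 := by
    intro m n
    obtain ⟨u, hu, hz⟩ := hphase (-m) n
    have e : ∀ z, F z * chr₂ (step d) m n z =
        u⁻¹ * (conj (weylPhase (d * (-m)) (J.val + d * n) J z) * G z) := by
      intro z
      rw [hz, neg_neg]
      simp only [F]
      field_simp
    have hn : ((J.val + d * n : ℤ) : ZMod d) = J := by
      rw [Int.cast_add, hJ]; simp
    have h1 := hG (d * (-m)) (J.val + d * n) hn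
    simp only [e]
    refine ⟨((hi _).congr h1).const_mul _, ?_⟩
    rw [integral_const_mul, ← integral_congr_ae h1, h0, mul_zero]
  have hF0 : Integrable F (cellMeasure (step d)) := by
    simpa [chr₂_zero] using (hF 0 0).1
  filter_upwards [ae_eq_zero_of_fourier₂ (step d) (step_pos pos_of_neZero) F hF0
    fun m n => (hF m n).2, ov_zero_bump_ne_zero (d := d)] with z hz hb
  have hc : chr (d * step d) J.val z.2 ≠ 0 := Complex.exp_ne_zero _
  rcases mul_eq_zero.1 hz with h | h
  · exact (mul_eq_zero.1 h).resolve_left ((map_ne_zero _).2 hb)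
  · exact absurd h hc

/-- Distinct operators on the displaced code spaces have distinct twirls. -/
lemma cm_congr_of_twirl_eq (hd : Odd d) {A B : Hilb →L[ℂ] Hilb} (hA : IsTraceClass A)
    (hB : IsTraceClass B) (h : twirl d A = twirl d B) :
    ∀ᵐ z ∂(cellMeasure (step d)), cm d A z = cm d B z := by
  have h1 : ∀ g : 𝓢(ℝ, ℂ), ∀ᵐ z ∂(cellMeasure (step d)), ∀ J : ZMod d,
      ∑ K, (cm d A z J K - cm d B z J K) * ov K (vec g) z = 0 := by
    intro g
    have e : ∀ f : 𝓢(ℝ, ℂ), (fun z => ∑ J : ZMod d, conj (ov J (vec f) z) *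
        ∑ K, (cm d A z J K - cm d B z J K) * ov K (vec g) z) =
        fun z => codePairing d A (vec f) (vec g) z - codePairing d B (vec f) (vec g) z := by
      intro f
      ext z
      rw [codePairing_eq, codePairing_eq, ← Finset.sum_sub_distrib]
      refine Finset.sum_congr rfl fun J _ => ?_
      rw [← Finset.sum_sub_distrib, Finset.mul_sum]
      refine Finset.sum_congr rfl fun K _ => ?_
      ring
    refine ae_eq_zero_of_schwartz
      (H := fun J z => ∑ K, (cm d A z J K - cm d B z J K) * ov K (vec g) z)
      (fun f => ?_) fun f => ?_
    · rw [e]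
      exact (integrable_codePairing hd hA f g).sub (integrable_codePairing hd hB f g)
    · simp only [congrFun (e f)]
      rw [integral_sub (integrable_codePairing hd hA f g) (integrable_codePairing hd hB f g)]
      exact sub_eq_zero.2 (congrFun (congrFun h f) g)
  have h2 := ae_all_iff.2 fun K : ZMod d => h1 (schwartzDisp ((K.val : ℤ) * step d)
    ((0 : ℤ) * step d) (bump d))
  have h3 := ae_all_iff.2 fun K : ZMod d => ov_displaced_bump (d := d) 0 (K.val : ℤ)
  filter_upwards [h2, h3, ov_zero_bump_ne_zero (d := d)] with z h2 h3 h4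
  ext J K
  have h5 := h2 K J
  have hK : ((K.val : ℤ) : ZMod d) = K := by
    rw [Int.cast_natCast, ZMod.natCast_rightInverse]
  rw [Finset.sum_eq_single K] at h5
  · rw [h3, if_pos hK.symm] at h5
    have h6 : weylPhase 0 (K.val : ℤ) K z ≠ 0 := by
      rw [← norm_ne_zero_iff, norm_weylPhase]
      exact one_ne_zero
    exact sub_eq_zero.1 ((mul_eq_zero.1 h5).resolve_right (mul_ne_zero h6 h4))
  · intro L _ hL
    rw [h3, if_neg (by rw [hK]; exact hL), mul_zero]
  · exact fun h => absurd (Finset.mem_univ K) h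

lemma wigner_eq_iff_twirl_eq (hd : Odd d) {A B : Hilb →L[ℂ] Hilb} (hA : IsTraceClass A)
    (hB : IsTraceClass B) : wigner d A = wigner d B ↔ twirl d A = twirl d B := by
  refine ⟨fun h => ?_, fun h => wigner_eq_of_cm_congr hd hA hB (cm_congr_of_twirl_eq hd hA hB h)⟩
  ext f g
  rw [twirl_eq_integral hd hA, twirl_eq_integral hd hB, h]

end

/-! ### Products of a twirl with a trace-class operator -/

section
variable {d : ℕ} [NeZero d]

/-- The operator acting on the displaced code spaces by a bounded family of matrices `M`. -/
def matrixOp {M : ZMod d → ZMod d → ℝ × ℝ → ℂ}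
    (hM : ∀ J K, MemLp (M J K) ∞ (cellMeasure (step d))) : Hilb →L[ℂ] Hilb :=
  ∑ J, ∑ K, entryOp (hM J K) J K

lemma trace_matrixOp {M : ZMod d → ZMod d → ℝ × ℝ → ℂ}
    (hM : ∀ J K, MemLp (M J K) ∞ (cellMeasure (step d))) {A : Hilb →L[ℂ] Hilb}
    (hA : IsTraceClass A) :
    trace (matrixOp hM ∘L A) =
      ∫ z, ∑ J, ∑ K, M J K z * cm d A z K J ∂(cellMeasure (step d)) := by
  have hi : ∀ J K, Integrable (fun z => M J K z * cm d A z K J) (cellMeasure (step d)) :=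
    fun J K => Integrable.bdd_mul_top (integrable_cm hA K J) (hM J K)
  rw [matrixOp, hA.trace_sum,
    integral_finsetSum _ fun J _ => integrable_finsetSum _ fun K _ => hi J K]
  refine Finset.sum_congr rfl fun J _ => ?_
  rw [hA.trace_sum, integral_finsetSum _ fun K _ => hi J K]
  exact Finset.sum_congr rfl fun K _ => trace_entryOp hA _ _ _

lemma inner_matrixOp {M : ZMod d → ZMod d → ℝ × ℝ → ℂ}
    (hM : ∀ J K, MemLp (M J K) ∞ (cellMeasure (step d))) (φ ψ : Hilb) :
    Integrable (fun z => ∑ J, ∑ K, conj (ov J ψ z) * M J K z * ov K φ z) (cellMeasure (step d)) ∧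
    (inner ℂ ψ (matrixOp hM φ) : ℂ) =
      ∫ z, ∑ J, ∑ K, conj (ov J ψ z) * M J K z * ov K φ z ∂(cellMeasure (step d)) := by
  have hi : ∀ J K, Integrable (fun z => conj (ov J ψ z) * M J K z * ov K φ z)
      (cellMeasure (step d)) := by
    intro J K
    refine (Integrable.bdd_mul_top (integrable_mul_conj (ov K φ) (ov J ψ)) (hM J K)).congr
      (Eventually.of_forall fun z => ?_)
    simp only; ring
  refine ⟨integrable_finsetSum _ fun J _ => integrable_finsetSum _ fun K _ => hi J K, ?_⟩
  rw [integral_finsetSum _ fun J _ => integrable_finsetSum _ fun K _ => hi J K, matrixOp, sum_apply,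
    inner_sum]
  refine Finset.sum_congr rfl fun J _ => ?_
  rw [integral_finsetSum _ fun K _ => hi J K, sum_apply, inner_sum]
  refine Finset.sum_congr rfl fun K _ => ?_
  rw [inner_entryOp]
  congr 1 with z
  ring

/-- If `E(A) B = C`, then the identity holds on almost every displaced code space. -/
lemma IsTwirlMul.ov_eq {A B C : Hilb →L[ℂ] Hilb} (h : IsTwirlMul d A B C) (g : Hilb) :
    ∀ᵐ z ∂(cellMeasure (step d)), ∀ J : ZMod d,
      ∑ K, cm d A z J K * ov K (B g) z = ov J (C g) z := by
  have hi : ∀ (f : 𝓢(ℝ, ℂ)) (J : ZMod d), Integrable (fun z => conj (ov J (vec f) z) * ov J (C g) z)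
      (cellMeasure (step d)) := fun f J =>
    (integrable_mul_conj (ov J (C g)) (ov J (vec f))).congr
      (Eventually.of_forall fun z => mul_comm _ _)
  have e : ∀ f : 𝓢(ℝ, ℂ), (fun z => ∑ J : ZMod d, conj (ov J (vec f) z) *
      (∑ K, cm d A z J K * ov K (B g) z - ov J (C g) z)) =
      fun z => codePairing d A (vec f) (B g) z -
        ∑ J : ZMod d, conj (ov J (vec f) z) * ov J (C g) z := by
    intro f
    ext z
    rw [codePairing_eq, ← Finset.sum_sub_distrib]
    refine Finset.sum_congr rfl fun J _ => ?_
    rw [mul_sub, Finset.mul_sum]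
    congr 1
    exact Finset.sum_congr rfl fun K _ => (mul_assoc _ _ _).symm
  have h1 := ae_eq_zero_of_schwartz
    (H := fun J z => ∑ K, cm d A z J K * ov K (B g) z - ov J (C g) z)
    (fun f => by
      rw [e]
      exact (h f g).1.sub (integrable_finsetSum _ fun J _ => hi f J))
    (fun f => by
      simp only [congrFun (e f)]
      rw [integral_sub (h f g).1 (integrable_finsetSum _ fun J _ => hi f J), (h f g).2,
        integral_finsetSum _ fun J _ => hi f J, ← sum_inner_ov (d := d), sub_eq_zero]
      exact Finset.sum_congr rfl fun J _ => inner_eq_integral _ _)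
  filter_upwards [h1] with z hz J
  exact sub_eq_zero.1 (hz J)

/-- The part of the cell on which the code matrix of `A` is bounded by `R`. -/
def boundedPart (d : ℕ) [NeZero d] (A : Hilb →L[ℂ] Hilb) (R : ℕ) : Set (ℝ × ℝ) :=
  {z | ∑ J : ZMod d, ∑ K : ZMod d, ‖cm d A z J K‖ ≤ R}

lemma nullMeasurableSet_boundedPart {A : Hilb →L[ℂ] Hilb} (hA : IsTraceClass A) (R : ℕ) :
    NullMeasurableSet (boundedPart d A R) (cellMeasure (step d)) := by
  refine nullMeasurableSet_le ?_ aemeasurable_const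
  exact (integrable_finsetSum Finset.univ fun J _ => integrable_finsetSum Finset.univ fun K _ =>
    (integrable_cm hA J K).norm).1.aemeasurable

lemma memLp_indicator_cm {A : Hilb →L[ℂ] Hilb} (hA : IsTraceClass A) (R : ℕ) (J K : ZMod d) :
    MemLp ((boundedPart d A R).indicator fun z => cm d A z J K) ∞ (cellMeasure (step d)) := by
  refine memLp_top_of_bound
    ((integrable_cm hA J K).1.indicator₀ (nullMeasurableSet_boundedPart hA R)) R
    (Eventually.of_forall fun z => ?_)
  by_cases hz : z ∈ boundedPart d A R
  · rw [Set.indicator_of_mem hz]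
    refine le_trans ?_ (show ∑ J : ZMod d, ∑ K : ZMod d, ‖cm d A z J K‖ ≤ R from hz)
    refine le_trans ?_ (Finset.single_le_sum (f := fun J : ZMod d => ∑ K, ‖cm d A z J K‖)
      (fun J _ => Finset.sum_nonneg fun K _ => norm_nonneg _) (Finset.mem_univ J))
    exact Finset.single_le_sum (f := fun K : ZMod d => ‖cm d A z J K‖)
      (fun K _ => norm_nonneg _) (Finset.mem_univ K)
  · rw [Set.indicator_of_notMem hz, norm_zero]
    exact R.cast_nonneg

lemma memLp_indicator_one {A : Hilb →L[ℂ] Hilb} (hA : IsTraceClass A) (R : ℕ) (J K : ZMod d) :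
    MemLp ((boundedPart d A R).indicator fun _ => if J = K then (1 : ℂ) else 0) ∞
      (cellMeasure (step d)) := by
  refine memLp_top_of_bound
    (aestronglyMeasurable_const.indicator₀ (nullMeasurableSet_boundedPart hA R)) 1
    (Eventually.of_forall fun z => (norm_indicator_le_norm_self _ _).trans ?_)
  split_ifs <;> simp

lemma tendsto_integral_indicator {A : Hilb →L[ℂ] Hilb} (hA : IsTraceClass A) {F : ℝ × ℝ → ℂ}
    (hF : Integrable F (cellMeasure (step d))) :
    Tendsto (fun R : ℕ => ∫ z, (boundedPart d A R).indicator F z ∂(cellMeasure (step d))) atTop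
      (𝓝 (∫ z, F z ∂(cellMeasure (step d)))) := by
  refine tendsto_integral_of_dominated_convergence (fun z => ‖F z‖)
    (fun R => hF.1.indicator₀ (nullMeasurableSet_boundedPart hA R)) hF.norm
    (fun R => Eventually.of_forall fun z => norm_indicator_le_norm_self _ _)
    (Eventually.of_forall fun z => ?_)
  obtain ⟨R₀, hR⟩ := exists_nat_ge (∑ J : ZMod d, ∑ K : ZMod d, ‖cm d A z J K‖)
  refine tendsto_const_nhds.congr' ?_
  filter_upwards [eventually_ge_atTop R₀] with R h
  exact (Set.indicator_of_mem (show z ∈ boundedPart d A R from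
    hR.trans (by exact_mod_cast h)) F).symm

/-- The trace of `E(A) B`, computed over the displaced code spaces. Where the code matrix of `A` is
bounded, it defines a bounded operator whose product with `B` is a compression of `C`; the traces of
these operators exhaust both sides. -/
lemma twirlTrace_eq_trace {A B C : Hilb →L[ℂ] Hilb} (hA : IsTraceClass A) (hB : IsTraceClass B)
    (hC : IsTraceClass C) (h : IsTwirlMul d A B C)
    (hi : Integrable (codeTrace d A B) (cellMeasure (step d))) :
    twirlTrace d A B = trace C := by
  have hcC : Integrable (fun z => ∑ J : ZMod d, cm d C z J J) (cellMeasure (step d)) :=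
    integrable_finsetSum _ fun J _ => integrable_cm hC J J
  have hT : trace C = ∫ z, ∑ J : ZMod d, cm d C z J J ∂(cellMeasure (step d)) := by
    rw [integral_finsetSum _ fun J _ => integrable_cm hC J J, trace_eq_integral (d := d) hC]
  rw [hT, twirlTrace]
  refine tendsto_nhds_unique (tendsto_integral_indicator hA hi)
    ((tendsto_integral_indicator hA hcC).congr fun R => ?_)
  have h1 : matrixOp (memLp_indicator_cm (d := d) hA R) ∘L B =
      matrixOp (memLp_indicator_one (d := d) hA R) ∘L C := by
    ext1 φ
    refine ext_inner_left ℂ fun ψ => ?_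
    rw [ContinuousLinearMap.comp_apply, ContinuousLinearMap.comp_apply,
      (inner_matrixOp (d := d) _ _ _).2,
      (inner_matrixOp (d := d) _ _ _).2]
    refine integral_congr_ae ?_
    filter_upwards [h.ov_eq φ] with z hz
    refine Finset.sum_congr rfl fun J _ => ?_
    by_cases hm : z ∈ boundedPart d A R
    · simp only [Set.indicator_of_mem hm, mul_ite, mul_one, mul_zero, ite_mul, zero_mul,
        Finset.sum_ite_eq, Finset.mem_univ, if_true]
      rw [← hz, Finset.mul_sum]
      exact Finset.sum_congr rfl fun K _ => mul_assoc _ _ _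
    · simp only [Set.indicator_of_notMem hm, mul_zero, zero_mul]
  have h2 := congrArg trace h1
  rw [trace_matrixOp _ hB, trace_matrixOp _ hC] at h2
  refine (integral_congr_ae (Eventually.of_forall fun z => ?_)).trans (h2.symm.trans
    (integral_congr_ae (Eventually.of_forall fun z => ?_)))
  · by_cases hm : z ∈ boundedPart d A R
    · simp [Set.indicator_of_mem hm]
    · simp [Set.indicator_of_notMem hm]
  · by_cases hm : z ∈ boundedPart d A R
    · simp only [Set.indicator_of_mem hm]
      rw [codeTrace_eq]
    · simp [Set.indicator_of_notMem hm]

lemma codePairing_adjoint {A : Hilb →L[ℂ] Hilb} (hA : IsTraceClass A) (f g : Hilb) :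
    codePairing d (A†) f g =ᵐ[cellMeasure (step d)] fun z => conj (codePairing d A g f z) := by
  filter_upwards [cm_adjoint (d := d) hA] with z hz
  rw [codePairing_eq, codePairing_eq, map_sum, Finset.sum_comm]
  refine Finset.sum_congr rfl fun J _ => ?_
  rw [map_sum]
  refine Finset.sum_congr rfl fun K _ => ?_
  rw [hz, map_mul, map_mul, Complex.conj_conj]
  ring

lemma codeTrace_adjoint {A B : Hilb →L[ℂ] Hilb} (hA : IsTraceClass A) (hB : IsTraceClass B) :
    codeTrace d (B†) (A†) =ᵐ[cellMeasure (step d)] fun z => conj (codeTrace d A B z) := by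
  filter_upwards [cm_adjoint (d := d) hA, cm_adjoint (d := d) hB] with z h1 h2
  rw [codeTrace_eq, codeTrace_eq, map_sum]
  refine Finset.sum_congr rfl fun J _ => ?_
  rw [map_sum]
  refine Finset.sum_congr rfl fun K _ => ?_
  rw [h1, h2, map_mul]
  ring

lemma IsMulTwirl.adjoint {A B C : Hilb →L[ℂ] Hilb} (hB : IsTraceClass B)
    (h : IsMulTwirl d A B C) : IsTwirlMul d (B†) (A†) (C†) := by
  intro f g
  have e := codePairing_adjoint (d := d) hB (vec f) ((A†) g)
  refine ⟨((LinearIsometryEquiv.integrable_comp_iff RCLike.conjLIE).2 (h g f).1).congr e.symm, ?_⟩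
  rw [integral_congr_ae e, integral_conj, (h g f).2, inner_conj_symm,
    ContinuousLinearMap.adjoint_inner_right]

lemma twirlTrace_eq_trace_right {A B C : Hilb →L[ℂ] Hilb} (hA : IsTraceClass A)
    (hB : IsTraceClass B) (hC : IsTraceClass C) (h : IsMulTwirl d A B C)
    (hi : Integrable (codeTrace d A B) (cellMeasure (step d))) :
    twirlTrace d A B = trace C := by
  have e := codeTrace_adjoint (d := d) hA hB
  have h1 := twirlTrace_eq_trace hB.adjoint hA.adjoint hC.adjoint (h.adjoint hB)
    (((LinearIsometryEquiv.integrable_comp_iff RCLike.conjLIE).2 hi).congr e.symm)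
  rw [twirlTrace, integral_congr_ae e, integral_conj, trace_adjoint] at h1
  exact (starRingEnd ℂ).injective h1

/-! ### Bounded Wigner functions -/

lemma memLp_cm (hd : Odd d) {A : Hilb →L[ℂ] Hilb} (hA : IsTraceClass A)
    (h : MemLp (wigner d A) ⊤ (torusMeasure d)) (J K : ZMod d) :
    MemLp (fun z => cm d A z J K) ∞ (cellMeasure (step d)) := by
  obtain ⟨C, hC⟩ := MemLp.exists_ae_bound h
  refine memLp_top_of_bound (integrable_cm hA J K).1 C ?_
  filter_upwards [norm_cm_le hd hA hC] with z hz
  exact hz J K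

lemma inner_matrixOp_cm {A : Hilb →L[ℂ] Hilb}
    (h : ∀ J K, MemLp (fun z => cm d A z J K) ∞ (cellMeasure (step d))) (φ ψ : Hilb) :
    Integrable (codePairing d A ψ φ) (cellMeasure (step d)) ∧
      ∫ z, codePairing d A ψ φ z ∂(cellMeasure (step d)) = inner ℂ ψ (matrixOp h φ) := by
  have e : codePairing d A ψ φ =
      fun z => ∑ J, ∑ K, conj (ov J ψ z) * cm d A z J K * ov K φ z :=
    funext fun z => codePairing_eq A ψ φ z
  rw [e]
  exact ⟨(inner_matrixOp h φ ψ).1, (inner_matrixOp h φ ψ).2.symm⟩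

lemma exists_isTwirlMul {A B : Hilb →L[ℂ] Hilb} (hB : IsTraceClass B)
    (h : ∀ J K, MemLp (fun z => cm d A z J K) ∞ (cellMeasure (step d))) :
    ∃ C, IsTraceClass C ∧ IsTwirlMul d A B C :=
  ⟨_, hB.comp_left (matrixOp h), fun f g => inner_matrixOp_cm h (B g) (vec f)⟩

lemma exists_isMulTwirl {A B : Hilb →L[ℂ] Hilb} (hB : IsTraceClass B)
    (h : ∀ J K, MemLp (fun z => cm d A z J K) ∞ (cellMeasure (step d))) :
    ∃ C, IsTraceClass C ∧ IsMulTwirl d B A C := by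
  refine ⟨_, hB.comp_right (matrixOp h), fun f g => ?_⟩
  obtain ⟨h1, h2⟩ := inner_matrixOp_cm h (vec g) ((B†) f)
  exact ⟨h1, h2.trans (ContinuousLinearMap.adjoint_inner_left _ _ _)⟩

end

end ZakGross

end

open ZakGross in
theorem theorem1 (d : ℕ) (hd : Odd d) :
    -- the Wigner function exists, as an integrable function on the torus
    (∀ A : Hilb →L[ℂ] Hilb, IsTraceClass A → IsWigner d A (wigner d A)) ∧
    -- the twirl is well defined
    (∀ A : Hilb →L[ℂ] Hilb, IsTraceClass A →
      (∀ φ ψ : ℕ → Hilb, IsNuclearRep A φ ψ → ∀ᵐ z ∂(cellMeasure (step d)), ∀ j k : Fin d,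
        HasSum (fun i => overlap d j (φ i) z * conj (overlap d k (ψ i) z))
          (codeMatrix d A z j k)) ∧
      ∀ f g : 𝓢(ℝ, ℂ), Integrable (codePairing d A (vec f) (vec g)) (cellMeasure (step d))) ∧
    -- linearity
    (∀ A B : Hilb →L[ℂ] Hilb, IsTraceClass A → IsTraceClass B →
      wigner d (A + B) = wigner d A + wigner d B) ∧
    (∀ (c : ℂ) (A : Hilb →L[ℂ] Hilb), IsTraceClass A → wigner d (c • A) = c • wigner d A) ∧
    (∀ A B : Hilb →L[ℂ] Hilb, IsTraceClass A → IsTraceClass B →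
      (wigner d A = wigner d B ↔ twirl d A = twirl d B)) ∧
    -- reality
    (∀ A : Hilb →L[ℂ] Hilb, IsTraceClass A →
      ∀ᵐ z ∂(torusMeasure d), wigner d (A†) z = conj (wigner d A z)) ∧
    -- standardisation
    (∀ A : Hilb →L[ℂ] Hilb, IsTraceClass A →
      ∫ z, wigner d A z ∂(torusMeasure d) = trace A) ∧
    -- covariance
    (∀ A : Hilb →L[ℂ] Hilb, IsTraceClass A → ∀ φ x p : ℝ, ∀ᵐ z ∂(torusMeasure d),
      wigner d ((heisenberg φ x p)† ∘L A ∘L heisenberg φ x p) z = wigner d A (act d x p z)) ∧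
    -- traciality
    (∀ A B : Hilb →L[ℂ] Hilb, IsTraceClass A → IsTraceClass B →
      Integrable (fun z => wigner d A z * wigner d B z) (torusMeasure d) →
        Integrable (codeTrace d A B) (cellMeasure (step d)) ∧
        ∫ z, wigner d A z * wigner d B z ∂(torusMeasure d) = twirlTrace d A B ∧
        (∀ C : Hilb →L[ℂ] Hilb, IsTraceClass C → IsTwirlMul d A B C →
          ∫ z, wigner d A z * wigner d B z ∂(torusMeasure d) = trace C) ∧
        (∀ C : Hilb →L[ℂ] Hilb, IsTraceClass C → IsMulTwirl d A B C →
          ∫ z, wigner d A z * wigner d B z ∂(torusMeasure d) = trace C)) ∧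
    -- for a bounded Wigner function all the products above exist
    (∀ A B : Hilb →L[ℂ] Hilb, IsTraceClass A → IsTraceClass B →
      MemLp (wigner d A) ⊤ (torusMeasure d) →
        Integrable (fun z => wigner d A z * wigner d B z) (torusMeasure d) ∧
        (∃ C : Hilb →L[ℂ] Hilb, IsTraceClass C ∧ IsTwirlMul d A B C) ∧
        (∃ C : Hilb →L[ℂ] Hilb, IsTraceClass C ∧ IsMulTwirl d B A C)) ∧
    -- reconstruction
    (∀ A : Hilb →L[ℂ] Hilb, IsTraceClass A → ∀ f g : 𝓢(ℝ, ℂ),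
      (∀ z : ℝ × ℝ, Summable fun mn : ℤ × ℤ =>
        (inner ℂ (((disp z.1 z.2)†) (vec f))
          (kernelTerm d mn.1 mn.2 (((disp z.1 z.2)†) (vec g))) : ℂ)) ∧
      Integrable (fun z => wigner d A z * kernel d z f g) (torusMeasure d) ∧
      twirl d A f g = ∫ z, wigner d A z * kernel d z f g ∂(torusMeasure d)) := by
  have hd0 : NeZero d := ⟨hd.pos.ne'⟩
  refine ⟨fun A hA => isWigner_wigner hd hA,
    fun A hA => ⟨fun φ ψ h => ae_hasSum_codeMatrix h, integrable_codePairing hd hA⟩,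
    fun A B => wigner_add hd, fun c A => wigner_smul hd c, fun A B => wigner_eq_iff_twirl_eq hd,
    fun A => wigner_adjoint hd, fun A => integral_wigner hd,
    fun A hA φ x p => wigner_covariant hd hA φ x p, fun A B hA hB hi => ?_,
    fun A B hA hB hW => ?_,
    fun A hA f g => ⟨fun z => summable_kernel z f g, integrable_wigner_mul_kernel A f g,
      twirl_eq_integral hd hA f g⟩⟩
  · have hW := integral_wigner_mul_wigner hd hA hB hi
    have hc := integrable_codeTrace hd hA hB hi
    exact ⟨hc, hW, fun C hC h => hW.trans (twirlTrace_eq_trace hA hB hC h hc),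
      fun C hC h => hW.trans (twirlTrace_eq_trace_right hA hB hC h hc)⟩
  · have hcm := memLp_cm hd hA hW
    exact ⟨Integrable.bdd_mul_top (L1.integrable_coeFn _) hW, exists_isTwirlMul hB hcm,
      exists_isMulTwirl hB hcm⟩
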